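/- Let $n\ge 2$ and let $S\mathbb{C}^n=\mathbb{C}^n\times S^{2n-1}\subset\mathbb{C}^n\times\mathbb{C}^n$ be the sphere bundle of $\mathbb{C}^n$, with the coordinates $(z_1,\dots,z_n,\zeta_1,\dots,\zeta_n)$ of $\mathbb{C}^n\times\mathbb{C}^n$. The group $SU(n)\ltimes\mathbb{C}^n$ acts on $S\mathbb{C}^n$ by $(g,a)\cdot(z,\zeta)=(gz+a,g\zeta)$. Define, by restriction to $S\mathbb{C}^n$, the forms $$\alpha=\tfrac12\sum_{j=1}^n(\zeta_j\,d\bar z_j+\bar\zeta_j\,dz_j),\quad \beta=\tfrac i2\sum_{j=1}^n(\zeta_j\,d\bar z_j-\bar\zeta_j\,dz_j),\quad \gamma=\tfrac i2\sum_{j=1}^n(\zeta_j\,d\bar\zeta_j-\bar\zeta_j\,d\zeta_j),$$ $$\theta_0=\tfrac i2\sum_{j=1}^n d\zeta_j\wedge d\bar\zeta_j,\qquad \theta_2=\tfrac i2\sum_{j=1}^n dz_j\wedge d\bar z_j-\alpha\wedge\beta,$$ the real-valued forms $\theta_s,\theta_1$ determined by $$\theta_s-i\theta_1=\sum_{j=1}^n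 dz_j\wedge d\bar\zeta_j-\beta\wedge\gamma+i\,\alpha\wedge\gamma,$$ and, for $k=0,\dots,n-1$, the complex-valued $(n-1)$-forms $$\chi_k=\frac{1}{k!\,(n-k-1)!}\sum_{\pi\in\mathcal S_n}\operatorname{sgn}(\pi)\,\zeta_{\pi(1)}\,dz_{\pi(2)}\wedge\dots\wedge dz_{\pi(k+1)}\wedge d\zeta_{\pi(k+2)}\wedge\dots\wedge d\zeta_{\pi(n)},$$ with complex conjugates $\bar\chi_k$; put $\chi_k=0$ for integers $k\notin\{0,\dots,n-1\}$. Then the algebra (over $\mathbb{C}$, with the wedge product) of all smooth complex-valued differential forms on $S\mathbb{C}^n$ that are invariant under $SU(n)$ and under the translations of $\mathbb{C}^n$ is generated by $\alpha,\beta,\gamma,\theta_0,\theta_1,\theta_2,\theta_s$ and $\chi_k,\bar\chi_k$ $(k=0,\dots,n-1)$. Moreover, for all integers $k$, $$d\chi_k=(n-k)\bigl((\alpha+i\beta)\wedge\chi_{k-1}+i\,\gamma\wedge\chi_k\bigr).$$ -/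

import Mathlib

noncomputable section

namespace SUForms

/-! ### Complex-valued exterior forms on a real vector space -/

/-- The exterior algebra `Λ(V*) ⊗ ℂ` of complex-valued alternating `ℝ`-multilinear forms on the
(finite-dimensional) real vector space `V`, realised as the exterior algebra over `ℂ` of the space
of `ℝ`-linear maps `V → ℂ`. The product is the wedge product. -/
abbrev CForms (V : Type*) [AddCommGroup V] [Module ℝ V] : Type _ :=
  ExteriorAlgebra ℂ (V →ₗ[ℝ] ℂ)

/-- Pull-back of exterior forms along a real linear map. -/
def pullback {V W : Type*} [AddCommGroup V] [Module ℝ V] [AddCommGroup W] [Module ℝ W]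
    (f : V →ₗ[ℝ] W) : CForms W →ₐ[ℂ] CForms V :=
  ExteriorAlgebra.map (LinearMap.lcomp ℂ ℂ f)

/-- `(φ₁, …, φₖ) ↦ ((v₁, …, vₖ) ↦ det (φᵢ (vⱼ)))`. -/
def detForm (V : Type*) [AddCommGroup V] [Module ℝ V] (k : ℕ) :
    (V →ₗ[ℝ] ℂ) [⋀^Fin k]→ₗ[ℂ] (V [⋀^Fin k]→ₗ[ℝ] ℂ) where
  toFun φ :=
    { toFun := fun v => Matrix.det (Matrix.of fun j i => φ i (v j))
      map_update_add' := by
        intro inst v j x y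
        obtain rfl : inst = instDecidableEqFin k := Subsingleton.elim _ _
        have h : ∀ w : V, (Matrix.of fun a i => φ i (Function.update v j w a)) =
            (Matrix.of fun a i => φ i (v a)).updateRow j (fun i => φ i w) := by
          intro w; ext a i
          rcases eq_or_ne a j with rfl | ha <;> simp [*]
        have h' : (fun i => φ i (x + y)) = (fun i => φ i x) + fun i => φ i y := by
          ext i; simp
        rw [h, h, h, h', Matrix.det_updateRow_add]
      map_update_smul' := by
        intro inst v j c x
        obtain rfl : inst = instDecidableEqFin k := Subsingleton.elim _ _
        have h : ∀ w : V, (Matrix.of fun a i => φ i (Function.update v j w a)) =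
            (Matrix.of fun a i => φ i (v a)).updateRow j (fun i => φ i w) := by
          intro w; ext a i
          rcases eq_or_ne a j with rfl | ha <;> simp [*]
        have h' : (fun i => φ i (c • x)) = (c : ℂ) • fun i => φ i x := by
          ext i; simp
        rw [h, h, h', Matrix.det_updateRow_smul, Complex.real_smul]
      map_eq_zero_of_eq' := by
        intro v a b hab hne
        exact Matrix.det_zero_of_row_eq hne (by ext i; simp [hab]) }
  map_update_add' := by
    intro inst φ i x y
    obtain rfl : inst = instDecidableEqFin k := Subsingleton.elim _ _
    ext v
    have h : ∀ w : V →ₗ[ℝ] ℂ, (Matrix.of fun a b => Function.update φ i w b (v a)) =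
        (Matrix.of fun a b => φ b (v a)).updateCol i (fun a => w (v a)) := by
      intro w; ext a b
      rcases eq_or_ne b i with rfl | hb <;> simp [*]
    have h' : (fun a => (x + y) (v a)) = (fun a => x (v a)) + fun a => y (v a) := rfl
    change Matrix.det (Matrix.of fun a b => Function.update φ i (x + y) b (v a)) =
      Matrix.det (Matrix.of fun a b => Function.update φ i x b (v a)) +
        Matrix.det (Matrix.of fun a b => Function.update φ i y b (v a))
    rw [h, h, h, h', Matrix.det_updateCol_add]
  map_update_smul' := by
    intro inst φ i c x
    obtain rfl : inst = instDecidableEqFin k := Subsingleton.elim _ _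
    ext v
    have h : ∀ w : V →ₗ[ℝ] ℂ, (Matrix.of fun a b => Function.update φ i w b (v a)) =
        (Matrix.of fun a b => φ b (v a)).updateCol i (fun a => w (v a)) := by
      intro w; ext a b
      rcases eq_or_ne b i with rfl | hb <;> simp [*]
    have h' : (fun a => (c • x) (v a)) = c • fun a => x (v a) := rfl
    change Matrix.det (Matrix.of fun a b => Function.update φ i (c • x) b (v a)) =
      c * Matrix.det (Matrix.of fun a b => Function.update φ i x b (v a))
    rw [h, h, h', Matrix.det_updateCol_smul]
  map_eq_zero_of_eq' := by
    intro φ a b hab hne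
    ext v
    exact Matrix.det_zero_of_column_eq hne (by intro i; simp [hab])

/-- The degree `k` component of an exterior form, as an alternating `k`-linear map;
`φ₁ ∧ … ∧ φₖ` corresponds to `(v₁, …, vₖ) ↦ det (φᵢ (vⱼ))`. -/
def toAlt {V : Type*} [AddCommGroup V] [Module ℝ V] (k : ℕ) :
    CForms V →ₗ[ℂ] (V [⋀^Fin k]→ₗ[ℝ] ℂ) :=
  ExteriorAlgebra.liftAlternating (Pi.single k (detForm V k))

/-! ### The sphere bundle and its differential forms -/

/-- `ℂⁿ × ℂⁿ`, with coordinates `(z, ζ)`. -/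
abbrev Ambient (n : ℕ) : Type := (Fin n → ℂ) × (Fin n → ℂ)

/-- The sphere bundle `Sℂⁿ = ℂⁿ × S²ⁿ⁻¹ ⊆ ℂⁿ × ℂⁿ`. -/
def SphereBundle (n : ℕ) : Type := {p : Ambient n // ∑ j, ‖p.2 j‖ ^ 2 = 1}

/-- The tangent space of `Sℂⁿ` at `p = (z, ζ)`, as a real subspace of `ℂⁿ × ℂⁿ`: the pairs
`(v, w)` for which `w` is orthogonal to `ζ` in the real inner product. -/
def tangent {n : ℕ} (p : SphereBundle n) : Submodule ℝ (Ambient n) where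
  carrier := {v | ∑ j, (star (p.1.2 j) * v.2 j).re = 0}
  add_mem' := by
    intro v w hv hw
    simp only [Set.mem_ofPred_eq, Prod.snd_add, Pi.add_apply, mul_add, Complex.add_re,
      Finset.sum_add_distrib] at *
    rw [hv, hw, add_zero]
  zero_mem' := by simp
  smul_mem' := by
    intro c v hv
    have h : ∀ j, (star (p.1.2 j) * (c • v).2 j).re = c * (star (p.1.2 j) * v.2 j).re := by
      intro j
      simp only [Prod.smul_snd, Pi.smul_apply, Complex.real_smul, Complex.mul_re, Complex.mul_im,
        Complex.ofReal_re, Complex.ofReal_im]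
      ring
    simp only [Set.mem_ofPred_eq] at *
    simp only [h, ← Finset.mul_sum, hv, mul_zero]

/-- The algebra of all (not necessarily smooth) complex-valued differential forms of mixed degree
on `Sℂⁿ`, with pointwise addition, wedge product and multiplication by complex constants. -/
abbrev Form (n : ℕ) : Type := ∀ p : SphereBundle n, CForms (tangent p)

/-- A family `η` of forms on `ℂⁿ × ℂⁿ`, one in each degree, restricts to the form `ω`
on `Sℂⁿ`. -/
def RestrictsTo {n : ℕ} (η : ∀ k : ℕ, Ambient n → Ambient n [⋀^Fin k]→L[ℝ] ℂ) (ω : Form n) :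
    Prop :=
  ∀ (k : ℕ) (p : SphereBundle n) (v : Fin k → tangent p),
    η k p.1 (fun i => (v i : Ambient n)) = toAlt k (ω p) v

/-- A form on the closed submanifold `Sℂⁿ` of `ℂⁿ × ℂⁿ` is smooth if it is the restriction of a
smooth form on `ℂⁿ × ℂⁿ`. -/
def IsSmooth {n : ℕ} (ω : Form n) : Prop :=
  ∃ η : ∀ k : ℕ, Ambient n → Ambient n [⋀^Fin k]→L[ℝ] ℂ,
    (∀ k, ContDiff ℝ (⊤ : ℕ∞) (η k)) ∧ RestrictsTo η ω

/-- The exterior derivative on all degrees of forms on `ℂⁿ × ℂⁿ`. -/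
def ambientD {n : ℕ} (η : ∀ k : ℕ, Ambient n → Ambient n [⋀^Fin k]→L[ℝ] ℂ) :
    ∀ k : ℕ, Ambient n → Ambient n [⋀^Fin k]→L[ℝ] ℂ
  | 0 => 0
  | k + 1 => extDeriv (η k)

/-- The differential of `(z, ζ) ↦ ∑ |ζ_j|²`. -/
theorem hasFDerivAt_normSq {n : ℕ} (x : Ambient n) :
    ∃ L : Ambient n →L[ℝ] ℝ, (∀ v, L v = 2 * ∑ j, (star (x.2 j) * v.2 j).re) ∧
      HasFDerivAt (fun y : Ambient n => ∑ j, ‖y.2 j‖ ^ 2) L x := by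
  have hc : ∀ j : Fin n, HasFDerivAt (fun y : Ambient n => y.2 j)
      ((ContinuousLinearMap.proj (R := ℝ) (φ := fun _ : Fin n => ℂ) j).comp
        (ContinuousLinearMap.snd ℝ (Fin n → ℂ) (Fin n → ℂ))) x := fun j =>
    ((ContinuousLinearMap.proj (R := ℝ) (φ := fun _ : Fin n => ℂ) j).comp
        (ContinuousLinearMap.snd ℝ (Fin n → ℂ) (Fin n → ℂ))).hasFDerivAt
  refine ⟨_, ?_, HasFDerivAt.fun_sum fun j _ => (hc j).norm_sq⟩
  intro v
  simp [Finset.mul_sum, Complex.inner, mul_comm, mul_add]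

/-- If `η` restricts to zero on `Sℂⁿ`, then so does `dη`. -/
theorem extDeriv_restrict_eq_zero {n k : ℕ} (η : Ambient n → Ambient n [⋀^Fin k]→L[ℝ] ℂ)
    (hη : Differentiable ℝ η)
    (h0 : ∀ (p : SphereBundle n) (v : Fin k → tangent p), η p.1 (fun i => (v i : Ambient n)) = 0)
    (p : SphereBundle n) (v : Fin (k + 1) → tangent p) :
    extDeriv η p.1 (fun i => (v i : Ambient n)) = 0 := by
  let q : Ambient n → ℝ := fun y => ∑ j, ‖y.2 j‖ ^ 2
  let r : Ambient n → Ambient n := fun x => (x.1, (Real.sqrt (q x))⁻¹ • x.2)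
  have hqs : ContDiff ℝ 2 q := by
    refine ContDiff.sum fun j _ => ContDiff.norm_sq ℝ ?_
    exact (contDiff_apply ℝ ℂ j).comp contDiff_snd
  have hU : IsOpen {x | 0 < q x} := isOpen_lt continuous_const hqs.continuous
  have hrs : ∀ x, 0 < q x → ContDiffAt ℝ 2 r x := by
    intro x hx
    have hs : ContDiffAt ℝ 2 (fun x => (Real.sqrt (q x))⁻¹) x :=
      (hqs.contDiffAt.sqrt hx.ne').inv (Real.sqrt_pos.2 hx).ne'
    exact contDiffAt_fst.prodMk (hs.fun_smul contDiffAt_snd)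
  have hqr : ∀ x, 0 < q x → q (r x) = 1 := by
    intro x hx
    have : q (r x) = ((Real.sqrt (q x))⁻¹) ^ 2 * q x := by
      simp only [q, r, Pi.smul_apply, norm_smul, mul_pow, Finset.mul_sum]
      simp
    rw [this, inv_pow, Real.sq_sqrt hx.le, inv_mul_cancel₀ hx.ne']
  have hp : q p.1 = 1 := p.2
  have hp0 : 0 < q p.1 := by rw [hp]; exact one_pos
  have hrp : r p.1 = p.1 := by
    simp only [r, hp, Real.sqrt_one, inv_one, one_smul]
  have htan : ∀ x (hx : 0 < q x) (u : Ambient n),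
      fderiv ℝ r x u ∈ tangent ⟨r x, hqr x hx⟩ := by
    intro x hx u
    obtain ⟨L, hL, hLd⟩ := hasFDerivAt_normSq (r x)
    have h1 := hLd.comp x ((hrs x hx).differentiableAt (by norm_num)).hasFDerivAt
    have h2 : HasFDerivAt (q ∘ r) (0 : Ambient n →L[ℝ] ℝ) x := by
      refine (hasFDerivAt_const (1 : ℝ) x).congr_of_eventuallyEq ?_
      filter_upwards [hU.mem_nhds hx] with y hy using hqr y hy
    have h3 := congrArg (fun M : Ambient n →L[ℝ] ℝ => M u) (h1.unique h2)
    have h4 : L (fderiv ℝ r x u) = 0 := h3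
    rw [hL] at h4
    change ∑ j, _ = (0 : ℝ)
    linarith
  have hfix : ∀ w : tangent p, fderiv ℝ r p.1 w = w := by
    intro w
    obtain ⟨L, hL, hLd⟩ := hasFDerivAt_normSq p.1
    have hLw : L w = 0 := by
      rw [hL]
      have : ∑ j, (star (p.1.2 j) * (w : Ambient n).2 j).re = 0 := w.2
      rw [this, mul_zero]
    have hs : HasFDerivAt (fun x => (Real.sqrt (q x))⁻¹) _ p.1 :=
      (hasDerivAt_inv (Real.sqrt_pos.2 hp0).ne').comp_hasFDerivAt p.1
        (HasFDerivAt.sqrt hLd hp0.ne')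
    have hd := (hasFDerivAt_fst (𝕜 := ℝ) (p := p.1)).prodMk (hs.smul hasFDerivAt_snd)
    have hd' : HasFDerivAt r _ p.1 := hd
    rw [hd'.fderiv]
    simp [hLw, hp]
  have hpb := extDeriv_pullback (r := 2) (f := r) (x := p.1) (hη (r p.1)) (hrs p.1 hp0)
    (by simp)
  have hz : extDeriv (fun x => (η (r x)).compContinuousLinearMap (fderiv ℝ r x)) p.1 = 0 := by
    have : (fun x => (η (r x)).compContinuousLinearMap (fderiv ℝ r x)) =ᶠ[nhds p.1]
        fun _ => 0 := by
      filter_upwards [hU.mem_nhds hp0] with x hx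
      ext u
      exact h0 ⟨r x, hqr x hx⟩ fun i => ⟨_, htan x hx (u i)⟩
    rw [this.extDeriv_eq]
    have h := extDeriv_smul (0 : ℝ) (fun _ : Ambient n => (0 : Ambient n [⋀^Fin k]→L[ℝ] ℂ))
      (x := p.1)
    rw [zero_smul, zero_smul] at h
    exact h
  rw [hz, hrp] at hpb
  have := congrArg (fun M => M fun i => (v i : Ambient n)) hpb
  simp only [ContinuousAlternatingMap.compContinuousLinearMap_apply, Function.comp_def,
    hfix] at this
  exact this.symm

/-- Two smooth extensions of `ω` have exterior derivatives with the same restriction to `Sℂⁿ`, so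
that the exterior derivative on `Sℂⁿ` is well defined. -/
theorem ambientD_restrict_congr {n : ℕ} {ω : Form n}
    {η η' : ∀ k : ℕ, Ambient n → Ambient n [⋀^Fin k]→L[ℝ] ℂ}
    (hη : ∀ k, ContDiff ℝ (⊤ : ℕ∞) (η k)) (hη' : ∀ k, ContDiff ℝ (⊤ : ℕ∞) (η' k))
    (h : RestrictsTo η ω) (h' : RestrictsTo η' ω) (k : ℕ) (p : SphereBundle n)
    (v : Fin k → tangent p) :
    ambientD η k p.1 (fun i => (v i : Ambient n)) =
      ambientD η' k p.1 (fun i => (v i : Ambient n)) := by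
  cases k with
  | zero => rfl
  | succ k =>
    have hd := (hη k).differentiable (by simp)
    have hd' := (hη' k).differentiable (by simp)
    have h0 := extDeriv_restrict_eq_zero (η k + (-1 : ℝ) • η' k) (hd.add (hd'.const_smul _))
      (fun p v => by simp [h k p v, h' k p v]) p v
    rw [extDeriv_add (hd _) ((hd'.const_smul _) _), extDeriv_smul] at h0
    simp only [ambientD]
    have h1 : extDeriv (η k) p.1 (fun i => (v i : Ambient n)) +
      (-1 : ℝ) • extDeriv (η' k) p.1 (fun i => (v i : Ambient n)) = 0 := h0
    rw [neg_smul, one_smul] at h1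
    exact eq_of_sub_eq_zero (by rw [sub_eq_add_neg]; exact h1)

/-- `ω` is smooth and `ω'` is its exterior derivative `dω`: for a smooth form `η` on `ℂⁿ × ℂⁿ`
extending `ω`, the form `ω'` is the restriction of `dη`. (It does not matter which `η` is
taken, see `ambientD_restrict_congr`.) -/
def HasExtDeriv {n : ℕ} (ω ω' : Form n) : Prop :=
  ∃ η : ∀ k : ℕ, Ambient n → Ambient n [⋀^Fin k]→L[ℝ] ℂ,
    (∀ k, ContDiff ℝ (⊤ : ℕ∞) (η k)) ∧ RestrictsTo η ω ∧ RestrictsTo (ambientD η) ω'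

/-! ### The action of `SU(n) ⋉ ℂⁿ` -/

/-- Unitary matrices preserve the real inner product. -/
theorem sum_re_star_mulVec {n : ℕ} (g : Matrix.specialUnitaryGroup (Fin n) ℂ)
    (x y : Fin n → ℂ) :
    ∑ j, (star (g.1.mulVec x j) * g.1.mulVec y j).re = ∑ j, (star (x j) * y j).re := by
  have hg : star g.1 * g.1 = 1 :=
    Matrix.mem_unitaryGroup_iff'.1 (Matrix.specialUnitaryGroup_le_unitaryGroup g.2)
  have h : star (g.1.mulVec x) ⬝ᵥ g.1.mulVec y = star x ⬝ᵥ y := by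
    rw [Matrix.star_mulVec, ← Matrix.dotProduct_mulVec, Matrix.mulVec_mulVec,
      ← Matrix.star_eq_conjTranspose, hg, Matrix.one_mulVec]
  simpa [dotProduct] using congrArg Complex.re h

theorem re_star_mul_self (x : ℂ) : (star x * x).re = ‖x‖ ^ 2 := by
  rw [← Complex.normSq_eq_norm_sq, Complex.normSq_apply]; simp

/-- The action `(z, ζ) ↦ (g z + a, g ζ)` on `Sℂⁿ`. -/
def act {n : ℕ} (g : Matrix.specialUnitaryGroup (Fin n) ℂ) (a : Fin n → ℂ)
    (p : SphereBundle n) : SphereBundle n :=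
  ⟨(g.1.mulVec p.1.1 + a, g.1.mulVec p.1.2), by
    have h := sum_re_star_mulVec g p.1.2 p.1.2
    simp only [re_star_mul_self] at h
    exact h.trans p.2⟩

/-- The differential `(v, w) ↦ (g v, g w)` of the map `act g a` at `p`. -/
def actDiff {n : ℕ} (g : Matrix.specialUnitaryGroup (Fin n) ℂ) (a : Fin n → ℂ)
    (p : SphereBundle n) : tangent p →ₗ[ℝ] tangent (act g a p) :=
  LinearMap.restrict
    (LinearMap.prodMap (g.1.mulVecLin.restrictScalars ℝ) (g.1.mulVecLin.restrictScalars ℝ))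
    (fun v (hv : _ = _) => (sum_re_star_mulVec g p.1.2 v.2).trans hv)

/-- Invariance under `SU(n)` (acting diagonally) and under the translations of `ℂⁿ`. -/
def IsInvariant {n : ℕ} (ω : Form n) : Prop :=
  ∀ (g : Matrix.specialUnitaryGroup (Fin n) ℂ) (a : Fin n → ℂ) (p : SphereBundle n),
    pullback (actDiff g a p) (ω (act g a p)) = ω p

/-! ### The generating forms -/

/-- The restriction to `Sℂⁿ` of a complex-valued function on `ℂⁿ × ℂⁿ`, as a `0`-form. -/
def fn {n : ℕ} (f : Ambient n → ℂ) : Form n := fun p => algebraMap ℂ _ (f p.1)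

/-- The restriction to `Sℂⁿ` of a constant complex-valued `1`-form on `ℂⁿ × ℂⁿ`. -/
def oneForm {n : ℕ} (φ : Ambient n →ₗ[ℝ] ℂ) : Form n :=
  fun p => ExteriorAlgebra.ι ℂ (φ ∘ₗ (tangent p).subtype)

/-- The coordinate `z_j`. -/
def zCoord {n : ℕ} (j : Fin n) : Ambient n →ₗ[ℝ] ℂ :=
  LinearMap.proj j ∘ₗ LinearMap.fst ℝ (Fin n → ℂ) (Fin n → ℂ)

/-- The coordinate `ζ_j`. -/
def zetaCoord {n : ℕ} (j : Fin n) : Ambient n →ₗ[ℝ] ℂ :=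
  LinearMap.proj j ∘ₗ LinearMap.snd ℝ (Fin n → ℂ) (Fin n → ℂ)

/-- The complex conjugate of a complex-valued `ℝ`-linear form. -/
def conjForm {n : ℕ} (φ : Ambient n →ₗ[ℝ] ℂ) : Ambient n →ₗ[ℝ] ℂ :=
  Complex.conjAe.toLinearMap ∘ₗ φ

/-- The function `ζ_j`. -/
def zeta {n : ℕ} (j : Fin n) : Form n := fn (zetaCoord j)
/-- The function `ζ̄_j`. -/
def zetaBar {n : ℕ} (j : Fin n) : Form n := fn (conjForm (zetaCoord j))
/-- `dz_j` -/
def dz {n : ℕ} (j : Fin n) : Form n := oneForm (zCoord j)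
/-- `dz̄_j` -/
def dzBar {n : ℕ} (j : Fin n) : Form n := oneForm (conjForm (zCoord j))
/-- `dζ_j` -/
def dzeta {n : ℕ} (j : Fin n) : Form n := oneForm (zetaCoord j)
/-- `dζ̄_j` -/
def dzetaBar {n : ℕ} (j : Fin n) : Form n := oneForm (conjForm (zetaCoord j))

def alpha (n : ℕ) : Form n :=
  (1 / 2 : ℂ) • ∑ j, (zeta j * dzBar j + zetaBar j * dz j)

def beta (n : ℕ) : Form n :=
  (Complex.I / 2) • ∑ j, (zeta j * dzBar j - zetaBar j * dz j)

def gamma (n : ℕ) : Form n :=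
  (Complex.I / 2) • ∑ j, (zeta j * dzetaBar j - zetaBar j * dzeta j)

def theta0 (n : ℕ) : Form n :=
  (Complex.I / 2) • ∑ j, dzeta j * dzetaBar j

def theta2 (n : ℕ) : Form n :=
  (Complex.I / 2) • ∑ j, dz j * dzBar j - alpha n * beta n

/-- The complex form `θ_s - i θ₁`. -/
def thetaC (n : ℕ) : Form n :=
  ∑ j, dz j * dzetaBar j - beta n * gamma n + Complex.I • (alpha n * gamma n)

/-- The complex conjugate `θ_s + i θ₁` of `thetaC` (the forms `α, β, γ` being real). -/
def thetaCBar (n : ℕ) : Form n :=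
  ∑ j, dzBar j * dzeta j - beta n * gamma n - Complex.I • (alpha n * gamma n)

/-- The real part of `θ_s - i θ₁`. -/
def thetaS (n : ℕ) : Form n := (1 / 2 : ℂ) • (thetaC n + thetaCBar n)

/-- Minus the imaginary part of `θ_s - i θ₁`. -/
def theta1 (n : ℕ) : Form n := (Complex.I / 2) • (thetaC n - thetaCBar n)

/-- `1 / (k! (n-k-1)!) ∑_π sgn(π) f_{π(1)} a_{π(2)} ∧ … ∧ a_{π(k+1)} ∧ b_{π(k+2)} ∧ … ∧ b_{π(n)}`,
where the position `i ∈ {1, …, n}` is the element `i - 1` of `Fin n`. -/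
def chiSum {n : ℕ} (k : ℕ) (f a b : Fin n → Form n) : Form n :=
  (1 / ((k.factorial : ℂ) * ((n - k - 1).factorial : ℂ))) •
    ∑ π : Equiv.Perm (Fin n), ((Equiv.Perm.sign π : ℤ) : ℂ) •
      (List.ofFn fun i : Fin n =>
        if (i : ℕ) = 0 then f (π i) else if (i : ℕ) ≤ k then a (π i) else b (π i)).prod

/-- The form `χ_k`, which is zero for `k ∉ {0, …, n-1}`. -/
def chi (n : ℕ) (k : ℤ) : Form n :=
  if 0 ≤ k ∧ k < n then chiSum k.toNat zeta dz dzeta else 0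

/-- The complex conjugate of `χ_k`. -/
def chiBar (n : ℕ) (k : ℤ) : Form n :=
  if 0 ≤ k ∧ k < n then chiSum k.toNat zetaBar dzBar dzetaBar else 0

/-- `α, β, γ, θ₀, θ₁, θ₂, θ_s` and `χ_k, χ̄_k` for `k = 0, …, n-1`. -/
def generators (n : ℕ) : Set (Form n) :=
  {alpha n, beta n, gamma n, theta0 n, theta1 n, theta2 n, thetaS n} ∪
    (Set.range fun k : Fin n => chi n (k : ℕ)) ∪ Set.range fun k : Fin n => chiBar n (k : ℕ)

end SUForms

end

/-! Write n = m + 1. As n ≥ 2, the group SU(n) ⋉ ℂⁿ acts transitively on the sphere bundle, so an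
invariant form is determined by its value at the base point (0, e₀) (`IsInvariant.eq_of_basePt`).
The stabiliser SU(m) fixes this value. The complexified cotangent space there consists of three
trivial lines dz₀, dz̄₀, dζ₀ (dζ̄₀ = -dζ₀ on tangent vectors), two copies x of the standard
representation of SU(m), namely dz_j and dζ_j with j > 0, and two copies y of its dual, their
conjugates. Differentiating along one-parameter subgroups of SU(m) gives invariance under the Lie
algebra sl(m) (`isSlInvariant_of_invariant`).

The core is a first fundamental theorem on this exterior algebra (`mem_of_isSlInvariant`): the
invariants are generated by the trivial covectors, the pairings ∑ x_i ∧ y_i, and the symmetrised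
products of one x-covector for each index, or one y-covector for each index. Make the monomials
orthonormal, so that contraction is adjoint to multiplication. An invariant orthogonal to all
invariants in the algebra stays so under the adjoints of multiplication by trivial covectors and by
pairings; induction on the degree shows that these adjoints kill it. It then suffices to show that
such a primitive invariant lies in the algebra.

Split the action of the matrix unit E_ij as X_ij - Y_ji, with X acting on the x and Y on the y. For
primitive v the sum over i, j of ⟨X_ij v, Y_ji v⟩ is the sum of the squared norms of the contracted
pairings, hence zero. By invariance all its terms have nonnegative real part, so X and Y kill v
separately off the diagonal, and no monomial of v has both an x and a y at the same index
(`hop_eq_zero_of_lower`). The charge of a monomial at an index does not depend on the index, so the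
monomials are 1, the full x- or y-product, or have exactly one covector per index, all x or all y;
in the last cases the coefficients are symmetric in the types of the covectors (`mem_of_primitive`).

At the base point α ± iβ and γ give the trivial covectors, the θ give the pairings, and χ_k, χ̄_k
give the symmetrised products (`pairing_mem`, `siteMon_idxX_sum_mem`, `siteMon_idxY_sum_mem`).

For the structure equation, dχ_k is the alternating sum with ζ replaced by dζ. Both sides are
invariant, so they are compared at the base point, by counting which factors of the alternating sum
carry the index 0 (`chiSum_dzeta_eq`). -/

noncomputable section

namespace SUForms

open Module CliffordAlgebra

/-! ### Exterior algebra as a Fock space: monomials, contractions and a Hermitian form. -/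

section Fock

variable {G : Type*} [LinearOrder G] {M : Type*} [AddCommGroup M] [Module ℂ M]
  (e : Basis G ℂ M)

/-- The exterior product of distinct basis vectors is a basis monomial, up to sign. -/
theorem ιMulti_eq_sign_smul_basis {k : ℕ} (w : Fin k → G) (hw : Function.Injective w) :
    ∃ ε : ℤˣ, ExteriorAlgebra.ιMulti ℂ k (fun i => e (w i)) =
      ε • e.ExteriorAlgebra (Finset.univ.image w) := by
  have hc : (Finset.univ.image w).card = k := by
    rw [Finset.card_image_of_injective _ hw, Finset.card_univ, Fintype.card_fin]
  rw [ExteriorAlgebra.basis_apply_ofCard e hc, ExteriorAlgebra.ιMulti_family]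
  set f := Set.powersetCard.ofFinEmbEquiv.symm (Set.powersetCard.ofCard hc) with hf
  have hr : ∀ i, ∃ j, f j = w i := by
    intro i
    refine (Set.powersetCard.mem_range_ofFinEmbEquiv_symm_iff_mem _ _).2 ?_
    change w i ∈ Finset.univ.image w
    simp
  choose σ hσ using hr
  have hinj : Function.Injective σ := fun i j hij => hw (by rw [← hσ, ← hσ, hij])
  let σ' : Equiv.Perm (Fin k) := Equiv.ofBijective σ (Finite.injective_iff_bijective.1 hinj)
  refine ⟨Equiv.Perm.sign σ', ?_⟩
  rw [← AlternatingMap.map_perm]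
  congr 1
  ext i
  simp [σ', hσ]

theorem ι_mul_basis_of_mem {g : G} {S : Finset G} (h : g ∈ S) :
    ExteriorAlgebra.ι ℂ (e g) * e.ExteriorAlgebra S = 0 := by
  rw [ExteriorAlgebra.basis_apply_ofCard e rfl, ExteriorAlgebra.ιMulti_family]
  set f := Set.powersetCard.ofFinEmbEquiv.symm (Set.powersetCard.ofCard (rfl : S.card = S.card))
  obtain ⟨j, hj⟩ : ∃ j, f j = g :=
    (Set.powersetCard.mem_range_ofFinEmbEquiv_symm_iff_mem _ _).2 h
  have := ExteriorAlgebra.ι_mul_prod_list (R := ℂ) (fun i => e (f i)) j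
  simpa [ExteriorAlgebra.ιMulti_apply, hj, Function.comp_def] using this

theorem exists_basis_eq_ιMulti (S : Finset G) :
    ∃ f : Fin S.card → G, Function.Injective f ∧ Finset.univ.image f = S ∧
      e.ExteriorAlgebra S = ExteriorAlgebra.ιMulti ℂ S.card (fun i => e (f i)) := by
  refine ⟨Set.powersetCard.ofFinEmbEquiv.symm (Set.powersetCard.ofCard (rfl : S.card = S.card)),
    (RelEmbedding.injective _), ?_, ?_⟩
  · ext g
    have := Set.powersetCard.mem_range_ofFinEmbEquiv_symm_iff_mem
      (Set.powersetCard.ofCard (rfl : S.card = S.card)) g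
    simp only [Finset.mem_image, Finset.mem_univ, true_and]
    exact this
  · rw [ExteriorAlgebra.basis_apply_ofCard e rfl, ExteriorAlgebra.ιMulti_family]
    rfl

theorem ι_mul_basis_of_notMem {g : G} {S : Finset G} (h : g ∉ S) :
    ∃ ε : ℤˣ, ExteriorAlgebra.ι ℂ (e g) * e.ExteriorAlgebra S =
      ε • e.ExteriorAlgebra (insert g S) := by
  obtain ⟨f, hf, hS, hb⟩ := exists_basis_eq_ιMulti e S
  have hg : g ∉ Set.range f := by
    rintro ⟨i, rfl⟩
    apply h
    rw [← hS]
    simp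
  obtain ⟨ε, hε⟩ := ιMulti_eq_sign_smul_basis e (Fin.cons g f : Fin (S.card + 1) → G)
    (Fin.cons_injective_iff.2 ⟨hg, hf⟩)
  refine ⟨ε, ?_⟩
  have hi : Finset.univ.image (Fin.cons g f : Fin (S.card + 1) → G) = insert g S := by
    conv_rhs => rw [← hS]
    ext a
    simp [Fin.exists_fin_succ, eq_comm]
  rw [hi] at hε
  rw [← hε, hb, ExteriorAlgebra.ιMulti_succ_apply]
  simp [Matrix.vecTail, Function.comp_def]

theorem basis_mul_basis_of_disjoint {S T : Finset G} (h : Disjoint S T) :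
    ∃ ε : ℤˣ, e.ExteriorAlgebra S * e.ExteriorAlgebra T = ε • e.ExteriorAlgebra (S ∪ T) := by
  obtain ⟨f, hf, hS, hb⟩ := exists_basis_eq_ιMulti e S
  obtain ⟨f', hf', hT, hb'⟩ := exists_basis_eq_ιMulti e T
  have hd : ∀ i j, f i ≠ f' j := by
    intro i j hij
    have h1 : f i ∈ S := by rw [← hS]; simp
    have h2 : f i ∈ T := by rw [hij, ← hT]; simp
    exact Finset.disjoint_left.1 h h1 h2
  obtain ⟨ε, hε⟩ := ιMulti_eq_sign_smul_basis e (Fin.append f f')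
    (Fin.append_injective_iff.2 ⟨hf, hf', hd⟩)
  refine ⟨ε, ?_⟩
  have hi : Finset.univ.image (Fin.append f f') = S ∪ T := by
    conv_rhs => rw [← hS, ← hT]
    ext a
    simp only [Finset.mem_image, Finset.mem_univ, true_and, Finset.mem_union]
    constructor
    · rintro ⟨i, rfl⟩
      refine Fin.addCases (fun i => ?_) (fun i => ?_) i <;> simp
    · rintro (⟨i, rfl⟩ | ⟨i, rfl⟩)
      · exact ⟨Fin.castAdd _ i, by simp⟩
      · exact ⟨Fin.natAdd _ i, by simp⟩
  rw [hi] at hε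
  rw [← hε, hb, hb', ExteriorAlgebra.ιMulti_mul_ιMulti]
  congr 1
  ext i
  refine Fin.addCases (fun i => ?_) (fun i => ?_) i <;> simp

theorem contractLeft_ιMulti_eq_zero (d : Dual ℂ M) {k : ℕ} (w : Fin k → M) (h : ∀ i, d (w i) = 0) :
    contractLeft d (ExteriorAlgebra.ιMulti ℂ k w) = 0 := by
  induction k with
  | zero => rw [ExteriorAlgebra.ιMulti_zero_apply]; exact contractLeft_one _ _
  | succ k ih =>
    rw [ExteriorAlgebra.ιMulti_succ_apply, contractLeft_ι_mul, h, zero_smul,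
      ih (Matrix.vecTail w) fun i => h i.succ, mul_zero, sub_zero]

theorem contractLeft_basis_of_notMem {g : G} {S : Finset G} (h : g ∉ S) :
    contractLeft (e.coord g) (e.ExteriorAlgebra S) = 0 := by
  obtain ⟨f, hf, hS, hb⟩ := exists_basis_eq_ιMulti e S
  rw [hb]
  refine contractLeft_ιMulti_eq_zero _ _ fun i => ?_
  have : f i ≠ g := by
    rintro rfl
    apply h
    rw [← hS]
    simp
  simp [this]

theorem contractLeft_ι_mul_basis {g : G} {S : Finset G} (h : g ∉ S) :
    contractLeft (e.coord g) (ExteriorAlgebra.ι ℂ (e g) * e.ExteriorAlgebra S) =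
      e.ExteriorAlgebra S := by
  rw [contractLeft_ι_mul, contractLeft_basis_of_notMem e h]
  simp

variable [Fintype G]

/-- The Hermitian form on the exterior algebra for which the monomials in `e` are orthonormal. -/
def herm : ExteriorAlgebra ℂ M →ₛₗ[starRingEnd ℂ] ExteriorAlgebra ℂ M →ₗ[ℂ] ℂ :=
  LinearMap.mk₂'ₛₗ (starRingEnd ℂ) (RingHom.id ℂ)
    (fun u v => ∑ S, starRingEnd ℂ (e.ExteriorAlgebra.repr u S) * e.ExteriorAlgebra.repr v S)
    (fun u u' v => by simp [add_mul, Finset.sum_add_distrib])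
    (fun c u v => by simp [Finset.mul_sum, mul_assoc])
    (fun u v v' => by simp [mul_add, Finset.sum_add_distrib])
    (fun c u v => by simp [Finset.mul_sum, mul_left_comm])

theorem herm_apply (u v : ExteriorAlgebra ℂ M) :
    herm e u v = ∑ S, starRingEnd ℂ (e.ExteriorAlgebra.repr u S) * e.ExteriorAlgebra.repr v S :=
  rfl

theorem herm_basis_left (S : Finset G) (v : ExteriorAlgebra ℂ M) :
    herm e (e.ExteriorAlgebra S) v = e.ExteriorAlgebra.repr v S := by
  simp [herm_apply, Finsupp.single_apply, apply_ite (starRingEnd ℂ)]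

theorem herm_conj (u v : ExteriorAlgebra ℂ M) : starRingEnd ℂ (herm e u v) = herm e v u := by
  simp [herm_apply, mul_comm]

theorem herm_self (u : ExteriorAlgebra ℂ M) :
    herm e u u = ((∑ S, ‖e.ExteriorAlgebra.repr u S‖ ^ 2 : ℝ) : ℂ) := by
  rw [herm_apply]
  push_cast
  exact Finset.sum_congr rfl fun S _ => Complex.conj_mul' _

theorem herm_self_re_nonneg (u : ExteriorAlgebra ℂ M) : 0 ≤ (herm e u u).re := by
  rw [herm_self, Complex.ofReal_re]
  positivity

theorem eq_zero_of_herm_self_re (u : ExteriorAlgebra ℂ M) (h : (herm e u u).re = 0) : u = 0 := by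
  rw [herm_self, Complex.ofReal_re, Finset.sum_eq_zero_iff_of_nonneg (by intros; positivity)] at h
  refine (LinearEquiv.map_eq_zero_iff e.ExteriorAlgebra.repr).1 (Finsupp.ext fun S => ?_)
  simpa using h S (Finset.mem_univ _)

theorem eq_zero_of_herm (u : ExteriorAlgebra ℂ M) (h : ∀ v, herm e v u = 0) : u = 0 :=
  eq_zero_of_herm_self_re e u (by rw [h]; rfl)

theorem herm_ι_mul_basis (g : G) (S T : Finset G) :
    herm e (ExteriorAlgebra.ι ℂ (e g) * e.ExteriorAlgebra S) (e.ExteriorAlgebra T) =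
      herm e (e.ExteriorAlgebra S) (contractLeft (e.coord g) (e.ExteriorAlgebra T)) := by
  have key : ∀ T', g ∉ T' → T = insert g T' → ∃ ε : ℤˣ,
      ExteriorAlgebra.ι ℂ (e g) * e.ExteriorAlgebra T' = ε • e.ExteriorAlgebra T ∧
      contractLeft (e.coord g) (e.ExteriorAlgebra T) = ε • e.ExteriorAlgebra T' := by
    intro T' hT' hT
    obtain ⟨ε, hε⟩ := ι_mul_basis_of_notMem e hT'
    refine ⟨ε, hT ▸ hε, ?_⟩
    have h1 := contractLeft_ι_mul_basis e hT'
    rw [hε, ← hT, Units.smul_def, map_zsmul] at h1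
    rw [← h1, Units.smul_def, smul_smul, ← Units.val_mul]
    simp
  by_cases hT : g ∈ T
  · obtain ⟨ε, h1, h2⟩ := key (T.erase g) (Finset.notMem_erase _ _) (Finset.insert_erase hT).symm
    rw [h2]
    by_cases hS : g ∈ S
    · rw [ι_mul_basis_of_mem e hS, herm_basis_left, Units.smul_def, map_zsmul, map_zero]
      have : T.erase g ≠ S := by
        rintro rfl
        exact Finset.notMem_erase _ _ hS
      simp [this]
    · by_cases hST : S = T.erase g
      · subst hST
        rw [h1]
        rcases Int.units_eq_one_or ε with rfl | rfl <;> simp [herm_basis_left]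
      · obtain ⟨ε', hε'⟩ := ι_mul_basis_of_notMem e hS
        have h3 : T ≠ insert g S := by
          rintro rfl
          rw [Finset.erase_insert hS] at hST
          exact hST rfl
        rw [hε']
        rcases Int.units_eq_one_or ε with rfl | rfl <;>
        rcases Int.units_eq_one_or ε' with rfl | rfl <;>
          simp [herm_basis_left, h3, Ne.symm hST]
  · rw [contractLeft_basis_of_notMem e hT, map_zero]
    by_cases hS : g ∈ S
    · rw [ι_mul_basis_of_mem e hS]; simp
    · obtain ⟨ε', hε'⟩ := ι_mul_basis_of_notMem e hS
      have h3 : T ≠ insert g S := by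
        rintro rfl
        simp at hT
      rw [hε']
      rcases Int.units_eq_one_or ε' with rfl | rfl <;> simp [herm_basis_left, h3]

/-- Contraction with a coordinate is adjoint to multiplication by the basis vector. -/
theorem herm_ι_mul (g : G) (u v : ExteriorAlgebra ℂ M) :
    herm e (ExteriorAlgebra.ι ℂ (e g) * u) v = herm e u (contractLeft (e.coord g) v) := by
  rw [← e.ExteriorAlgebra.sum_repr u, ← e.ExteriorAlgebra.sum_repr v]
  simp only [Finset.mul_sum, map_sum, LinearMap.sum_apply, mul_smul_comm, map_smulₛₗ,
    LinearMap.smul_apply, herm_ι_mul_basis, RingHom.id_apply]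

theorem herm_contractLeft (g : G) (u v : ExteriorAlgebra ℂ M) :
    herm e (contractLeft (e.coord g) u) v = herm e u (ExteriorAlgebra.ι ℂ (e g) * v) := by
  rw [← herm_conj, ← herm_ι_mul, herm_conj]

/-- By adjointness, the coefficient at `S` is the pairing of `v` with e_g ∧ e_S. This is how
contractions are seen to lower the degree. -/
theorem repr_contractLeft (g : G) (v : ExteriorAlgebra ℂ M) (S : Finset G) (h : g ∉ S) :
    ∃ ε : ℤˣ, e.ExteriorAlgebra.repr (contractLeft (e.coord g) v) S =
      ε • e.ExteriorAlgebra.repr v (insert g S) := by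
  obtain ⟨ε, hε⟩ := ι_mul_basis_of_notMem e h
  refine ⟨ε, ?_⟩
  rw [← herm_basis_left, ← herm_ι_mul, hε, ← herm_basis_left]
  rcases Int.units_eq_one_or ε with rfl | rfl <;> simp

theorem repr_contractLeft_of_mem (g : G) (v : ExteriorAlgebra ℂ M) (S : Finset G) (h : g ∈ S) :
    e.ExteriorAlgebra.repr (contractLeft (e.coord g) v) S = 0 := by
  rw [← herm_basis_left, ← herm_ι_mul, ι_mul_basis_of_mem e h]
  simp

/-- The occupation number operator of `g` is diagonal. -/
theorem repr_ι_mul_contractLeft (g : G) (v : ExteriorAlgebra ℂ M) (S : Finset G) :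
    e.ExteriorAlgebra.repr (ExteriorAlgebra.ι ℂ (e g) * contractLeft (e.coord g) v) S =
      if g ∈ S then e.ExteriorAlgebra.repr v S else 0 := by
  rw [← herm_basis_left, ← herm_contractLeft]
  split_ifs with h
  · rw [← herm_ι_mul, ← herm_basis_left]
    obtain ⟨ε, hε⟩ := ι_mul_basis_of_notMem e (Finset.notMem_erase g S)
    rw [Finset.insert_erase h] at hε
    have h1 := contractLeft_ι_mul_basis e (Finset.notMem_erase g S)
    have h2 : e.ExteriorAlgebra S =
        ε • (ExteriorAlgebra.ι ℂ (e g) * e.ExteriorAlgebra (S.erase g)) := by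
      rw [hε, smul_smul]; simp
    congr 2
    rw [h2, Units.smul_def, map_zsmul, h1, mul_smul_comm]
  · rw [contractLeft_basis_of_notMem e h]; simp

end Fock

/-! ### The action of matrix units by derivations, and the positivity argument. -/

section Hopping

variable {G : Type*} {M : Type*} [AddCommGroup M] [Module ℂ M]
  (e : Basis G ℂ M) {m : ℕ} (w x y : Fin 2 × Fin m → G)

/-- The linear map sending the basis vector `w (a, j)` to `w (a, i)`, and the others to zero. -/
def hopLin (i j : Fin m) : M →ₗ[ℂ] M :=
  ∑ a, (e.coord (w (a, j))).smulRight (e (w (a, i)))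

/-- The derivation of the exterior algebra that extends `hopLin`. -/
def hop (i j : Fin m) : ExteriorAlgebra ℂ M →ₗ[ℂ] ExteriorAlgebra ℂ M :=
  ∑ a, LinearMap.mulLeft ℂ (ExteriorAlgebra.ι ℂ (e (w (a, i)))) ∘ₗ
    contractLeft (e.coord (w (a, j)))

theorem hop_apply (i j : Fin m) (u : ExteriorAlgebra ℂ M) :
    hop e w i j u =
      ∑ a, ExteriorAlgebra.ι ℂ (e (w (a, i))) * contractLeft (e.coord (w (a, j))) u := by
  simp [hop]

theorem hopLin_apply (i j : Fin m) (v : M) :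
    hopLin e w i j v = ∑ a, e.coord (w (a, j)) v • e (w (a, i)) := by
  simp [hopLin]

theorem hop_one (i j : Fin m) : hop e w i j 1 = 0 := by
  rw [hop_apply]
  refine Finset.sum_eq_zero fun a _ => ?_
  rw [contractLeft_one, mul_zero]

/-- Multiplication and contraction are both odd, so the two signs met on passing `v` cancel and
their composite obeys an unsigned Leibniz rule. -/
theorem hop_ι_mul (i j : Fin m) (v : M) (u : ExteriorAlgebra ℂ M) :
    hop e w i j (ExteriorAlgebra.ι ℂ v * u) =
      ExteriorAlgebra.ι ℂ (hopLin e w i j v) * u + ExteriorAlgebra.ι ℂ v * hop e w i j u := by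
  simp only [hop_apply, hopLin_apply, contractLeft_ι_mul, map_sum, Finset.sum_mul, Finset.mul_sum,
    ← Finset.sum_add_distrib]
  refine Finset.sum_congr rfl fun a _ => ?_
  have h := ExteriorAlgebra.ι_add_mul_swap (R := ℂ) (e (w (a, i))) v
  rw [mul_sub, ← mul_assoc, ← mul_assoc, eq_neg_of_add_eq_zero_left h, map_smul, smul_mul_assoc,
    mul_smul_comm, neg_mul, sub_neg_eq_add]

theorem hopLin_of_ne (i j : Fin m) (g : G) (h : ∀ a, g ≠ w (a, j)) :
    hopLin e w i j (e g) = 0 := by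
  rw [hopLin_apply]
  refine Finset.sum_eq_zero fun a _ => ?_
  rw [Basis.coord_apply, Basis.repr_self, Finsupp.single_eq_of_ne (h a).symm, zero_smul]

theorem hopLin_self (hw : Function.Injective w) (i j : Fin m) (a : Fin 2) :
    hopLin e w i j (e (w (a, j))) = e (w (a, i)) := by
  rw [hopLin_apply, Finset.sum_eq_single a]
  · simp
  · intro b _ hb
    rw [Basis.coord_apply, Basis.repr_self, Finsupp.single_eq_of_ne, zero_smul]
    intro h
    exact hb (Prod.ext_iff.1 (hw h)).1
  · simp

theorem hop_ιMulti (i j : Fin m) {k : ℕ} (v : Fin k → M) :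
    hop e w i j (ExteriorAlgebra.ιMulti ℂ k v) =
      ∑ s, ExteriorAlgebra.ιMulti ℂ k (Function.update v s (hopLin e w i j (v s))) := by
  induction k with
  | zero => simp [hop_one]
  | succ k ih =>
    rw [ExteriorAlgebra.ιMulti_succ_apply, hop_ι_mul, ih, Fin.sum_univ_succ, Finset.mul_sum]
    congr 1
    · rw [ExteriorAlgebra.ιMulti_succ_apply]
      simp [Matrix.vecTail, Function.comp_def]
    · refine Finset.sum_congr rfl fun s _ => ?_
      rw [ExteriorAlgebra.ιMulti_succ_apply]
      congr 2
      · ext r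
        rcases eq_or_ne r s with rfl | h
        · simp [Matrix.vecTail]
        · simp [Matrix.vecTail, h]

/-- The derivation by which the matrix unit `E_ij` acts on the exterior algebra, the vectors `x`
transforming by the standard representation and `y` by its dual. -/
def unitDer (i j : Fin m) : ExteriorAlgebra ℂ M →ₗ[ℂ] ExteriorAlgebra ℂ M :=
  hop e x i j - hop e y j i

/-- The restriction of `unitDer` to vectors. -/
def unitLin (i j : Fin m) : M →ₗ[ℂ] M := hopLin e x i j - hopLin e y j i

theorem unitDer_one (i j : Fin m) : unitDer e x y i j 1 = 0 := by
  simp [unitDer, hop_one]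

theorem unitDer_ι_mul (i j : Fin m) (v : M) (u : ExteriorAlgebra ℂ M) :
    unitDer e x y i j (ExteriorAlgebra.ι ℂ v * u) =
      ExteriorAlgebra.ι ℂ (unitLin e x y i j v) * u +
        ExteriorAlgebra.ι ℂ v * unitDer e x y i j u := by
  simp only [unitDer, unitLin, LinearMap.sub_apply, hop_ι_mul, map_sub, sub_mul, mul_sub]
  abel

/-- Invariance under the special linear Lie algebra. -/
def IsSlInvariant (u : ExteriorAlgebra ℂ M) : Prop :=
  (∀ i j, i ≠ j → unitDer e x y i j u = 0) ∧ ∀ i j, unitDer e x y i i u = unitDer e x y j j u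

/-- The invariant `∑ i, x (a, i) ∧ y (b, i)`. -/
def pairing (a b : Fin 2) : ExteriorAlgebra ℂ M :=
  ∑ i, ExteriorAlgebra.ι ℂ (e (x (a, i))) * ExteriorAlgebra.ι ℂ (e (y (b, i)))

/-- The adjoint of the multiplication by `pairing`. -/
def lower (a b : Fin 2) : ExteriorAlgebra ℂ M →ₗ[ℂ] ExteriorAlgebra ℂ M :=
  ∑ i, contractLeft (e.coord (y (b, i))) ∘ₗ contractLeft (e.coord (x (a, i)))

theorem lower_apply (a b : Fin 2) (u : ExteriorAlgebra ℂ M) :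
    lower e x y a b u =
      ∑ i, contractLeft (e.coord (y (b, i))) (contractLeft (e.coord (x (a, i))) u) := by
  simp [lower]

theorem unitDer_ι_mul_of_notMem {g : G} (hgx : g ∉ Set.range x) (hgy : g ∉ Set.range y)
    (i j : Fin m) (u : ExteriorAlgebra ℂ M) :
    unitDer e x y i j (ExteriorAlgebra.ι ℂ (e g) * u) =
      ExteriorAlgebra.ι ℂ (e g) * unitDer e x y i j u := by
  rw [unitDer_ι_mul, unitLin, LinearMap.sub_apply, hopLin_of_ne, hopLin_of_ne]
  · simp
  · rintro a rfl; exact hgy ⟨_, rfl⟩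
  · rintro a rfl; exact hgx ⟨_, rfl⟩

variable {x y}

/-- The pairing is the canonical invariant of a representation and its dual: E_ij replaces x_j by
x_i and y_i by -y_j, and the two resulting terms x_i ∧ y_j cancel. -/
theorem unitDer_pairing_mul (hx : Function.Injective x) (hy : Function.Injective y)
    (hxy : ∀ p q, x p ≠ y q) (a b : Fin 2) (i j : Fin m) (u : ExteriorAlgebra ℂ M) :
    unitDer e x y i j (pairing e x y a b * u) = pairing e x y a b * unitDer e x y i j u := by
  have h1 : ∀ k, unitLin e x y i j (e (x (a, k))) = if k = j then e (x (a, i)) else 0 := by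
    intro k
    rw [unitLin, LinearMap.sub_apply, hopLin_of_ne e y _ _ _ fun b => hxy _ _, sub_zero]
    split_ifs with h
    · subst h; exact hopLin_self e x hx _ _ _
    · refine hopLin_of_ne _ _ _ _ _ fun c hc => h (Prod.ext_iff.1 (hx hc)).2
  have h2 : ∀ k, unitLin e x y i j (e (y (b, k))) = if k = i then - e (y (b, j)) else 0 := by
    intro k
    rw [unitLin, LinearMap.sub_apply, hopLin_of_ne e x _ _ _ fun b => (hxy _ _).symm, zero_sub]
    split_ifs with h
    · subst h; rw [hopLin_self e y hy _ _ _]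
    · rw [hopLin_of_ne _ _ _ _ _ fun c hc => h (Prod.ext_iff.1 (hy hc)).2, neg_zero]
  simp only [pairing, Finset.sum_mul, map_sum, mul_assoc, unitDer_ι_mul, h1, h2, mul_add,
    Finset.sum_add_distrib, apply_ite (ExteriorAlgebra.ι ℂ), map_zero, ite_mul, mul_ite,
    zero_mul, mul_zero, Finset.sum_ite_eq', Finset.mem_univ, if_true, map_neg, neg_mul, mul_neg]
  abel

variable (x y)

section Adjoint

variable [LinearOrder G] [Fintype G]

theorem herm_hop (i j : Fin m) (u v : ExteriorAlgebra ℂ M) :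
    herm e (hop e w i j u) v = herm e u (hop e w j i v) := by
  simp only [hop_apply, map_sum, LinearMap.sum_apply, herm_ι_mul, herm_contractLeft]

/-- The adjoint of E_ij is E_ji, so commutation relations with all matrix units pass to adjoint
operators. -/
theorem herm_unitDer (i j : Fin m) (u v : ExteriorAlgebra ℂ M) :
    herm e (unitDer e x y i j u) v = herm e u (unitDer e x y j i v) := by
  simp only [unitDer, LinearMap.sub_apply, map_sub, herm_hop]

theorem herm_pairing_mul (a b : Fin 2) (u v : ExteriorAlgebra ℂ M) :
    herm e (pairing e x y a b * u) v = herm e u (lower e x y a b v) := by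
  simp only [pairing, lower_apply, Finset.sum_mul, map_sum, LinearMap.sum_apply, mul_assoc,
    herm_ι_mul]

theorem eq_of_herm {u u' : ExteriorAlgebra ℂ M} (h : ∀ v, herm e v u = herm e v u') : u = u' :=
  sub_eq_zero.1 (eq_zero_of_herm e _ fun v => by rw [map_sub, h, sub_self])

variable {x y}

theorem unitDer_lower (hx : Function.Injective x) (hy : Function.Injective y)
    (hxy : ∀ p q, x p ≠ y q) (a b : Fin 2) (i j : Fin m) (u : ExteriorAlgebra ℂ M) :
    unitDer e x y i j (lower e x y a b u) = lower e x y a b (unitDer e x y i j u) := by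
  refine eq_of_herm e fun v => ?_
  rw [← herm_unitDer, ← herm_pairing_mul, ← herm_pairing_mul,
    ← unitDer_pairing_mul e hx hy hxy, herm_unitDer]

theorem unitDer_contractLeft_of_notMem {g : G} (hgx : g ∉ Set.range x) (hgy : g ∉ Set.range y)
    (i j : Fin m) (u : ExteriorAlgebra ℂ M) :
    unitDer e x y i j (contractLeft (e.coord g) u) =
      contractLeft (e.coord g) (unitDer e x y i j u) := by
  refine eq_of_herm e fun v => ?_
  rw [← herm_unitDer, ← herm_ι_mul, ← herm_ι_mul,
    ← unitDer_ι_mul_of_notMem e x y hgx hgy, herm_unitDer]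

/-- Moving the creation operators across the Hermitian form turns each summand into a product of two
double contractions, one at index j and one at index i. The double sum then factors into the squared
norms of `lower e x y a b v`. -/
theorem sum_herm_hop_hop_eq_zero (hxy : ∀ p q, x p ≠ y q) (v : ExteriorAlgebra ℂ M)
    (hv : ∀ a b, lower e x y a b v = 0) :
    ∑ i, ∑ j, herm e (hop e x i j v) (hop e y j i v) = 0 := by
  have h1 : ∀ i j, herm e (hop e x i j v) (hop e y j i v) = ∑ a, ∑ b,
      herm e (contractLeft (e.coord (y (b, j))) (contractLeft (e.coord (x (a, j))) v))
        (contractLeft (e.coord (y (b, i))) (contractLeft (e.coord (x (a, i))) v)) := by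
    intro i j
    simp only [hop_apply, map_sum, LinearMap.sum_apply, herm_ι_mul]
    rw [Finset.sum_comm]
    refine Finset.sum_congr rfl fun a _ => Finset.sum_congr rfl fun b _ => ?_
    rw [contractLeft_ι_mul, contractLeft_comm, herm_contractLeft e (y (b, j)), Basis.coord_apply,
      Basis.repr_self, Finsupp.single_eq_of_ne (hxy _ _), zero_smul, zero_sub, mul_neg, neg_neg]
  calc ∑ i, ∑ j, herm e (hop e x i j v) (hop e y j i v)
      = ∑ a, ∑ b, herm e (lower e x y a b v) (lower e x y a b v) := by
        simp only [h1, lower_apply, map_sum, LinearMap.sum_apply]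
        simp only [Finset.sum_comm (s := (Finset.univ : Finset (Fin m)))
          (t := (Finset.univ : Finset (Fin 2)))]
    _ = 0 := by simp [hv]

/-- The number of vectors among `w (0, i)` and `w (1, i)` in the monomial `S`. -/
def occ (w : Fin 2 × Fin m → G) (i : Fin m) (S : Finset G) : ℕ :=
  (Finset.univ.filter fun a => w (a, i) ∈ S).card

theorem repr_hop_self (w : Fin 2 × Fin m → G) (i : Fin m) (v : ExteriorAlgebra ℂ M)
    (S : Finset G) :
    e.ExteriorAlgebra.repr (hop e w i i v) S = occ w i S * e.ExteriorAlgebra.repr v S := by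
  simp only [hop_apply, map_sum, Finsupp.finsetSum_apply, repr_ι_mul_contractLeft, occ]
  rw [← Finset.sum_filter, Finset.sum_const, nsmul_eq_mul]

theorem herm_hop_self_re (i : Fin m) (v : ExteriorAlgebra ℂ M) :
    (herm e (hop e x i i v) (hop e y i i v)).re =
      ∑ S, (occ x i S * occ y i S : ℝ) * ‖e.ExteriorAlgebra.repr v S‖ ^ 2 := by
  rw [herm_apply, Complex.re_sum]
  refine Finset.sum_congr rfl fun S _ => ?_
  rw [repr_hop_self, repr_hop_self, map_mul, mul_mul_mul_comm, Complex.conj_mul', map_natCast]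
  norm_cast

theorem herm_sub_self_re (u v : ExteriorAlgebra ℂ M) :
    (herm e (u - v) (u - v)).re = (herm e u u).re + (herm e v v).re - 2 * (herm e u v).re := by
  have h : (herm e v u).re = (herm e u v).re := by rw [← herm_conj, Complex.conj_re]
  simp only [map_sub, LinearMap.sub_apply, Complex.sub_re, h]
  ring

/-- An invariant killed by the contractions `lower` is killed separately by the parts of the
derivations `unitDer` in `x` and in `y`, and none of its monomials mixes the two at one index. -/
theorem hop_eq_zero_of_lower (hxy : ∀ p q, x p ≠ y q) (v : ExteriorAlgebra ℂ M)
    (hinv : IsSlInvariant e x y v) (hv : ∀ a b, lower e x y a b v = 0) :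
    (∀ i j, i ≠ j → hop e x i j v = 0 ∧ hop e y i j v = 0) ∧
      ∀ i S, e.ExteriorAlgebra.repr v S ≠ 0 → occ x i S * occ y i S = 0 := by
  -- By polarisation F i j is twice the real part of ⟨X_ij v, Y_ji v⟩, so it sums to zero. Off the
  -- diagonal invariance removes the negative term, and on the diagonal both operators are diagonal
  -- with nonnegative eigenvalues. Hence every F i j vanishes.
  let F : Fin m → Fin m → ℝ := fun i j =>
    (herm e (hop e x i j v) (hop e x i j v)).re + (herm e (hop e y j i v) (hop e y j i v)).re -
      (herm e (unitDer e x y i j v) (unitDer e x y i j v)).re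
  have hF : ∀ i j, F i j = 2 * (herm e (hop e x i j v) (hop e y j i v)).re := by
    intro i j
    simp only [F, unitDer, LinearMap.sub_apply, herm_sub_self_re]
    ring
  have hsum : ∑ i, ∑ j, F i j = 0 := by
    simp only [hF, ← Finset.mul_sum, ← Complex.re_sum, sum_herm_hop_hop_eq_zero e hxy v hv]
    simp
  have hne : ∀ i j, i ≠ j → F i j =
      (herm e (hop e x i j v) (hop e x i j v)).re +
        (herm e (hop e y j i v) (hop e y j i v)).re := by
    intro i j hij
    simp [F, hinv.1 i j hij]
  have hnn : ∀ i j, 0 ≤ F i j := by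
    intro i j
    by_cases hij : i = j
    · subst hij
      rw [hF, herm_hop_self_re]
      positivity
    · rw [hne i j hij]
      exact add_nonneg (herm_self_re_nonneg _ _) (herm_self_re_nonneg _ _)
  have hz : ∀ i j, F i j = 0 := by
    intro i j
    have h1 := (Finset.sum_eq_zero_iff_of_nonneg fun i _ =>
      Finset.sum_nonneg fun j _ => hnn i j).1 hsum i (Finset.mem_univ _)
    exact (Finset.sum_eq_zero_iff_of_nonneg fun j _ => hnn i j).1 h1 j (Finset.mem_univ _)
  constructor
  · intro i j hij
    have h1 := hz i j
    have h2 := hz j i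
    rw [hne i j hij] at h1
    rw [hne j i hij.symm] at h2
    have a1 := herm_self_re_nonneg e (hop e x i j v)
    have a2 := herm_self_re_nonneg e (hop e y j i v)
    have a3 := herm_self_re_nonneg e (hop e x j i v)
    have a4 := herm_self_re_nonneg e (hop e y i j v)
    exact ⟨eq_zero_of_herm_self_re e _ (by linarith), eq_zero_of_herm_self_re e _ (by linarith)⟩
  · intro i S hS
    have h1 := hz i i
    rw [hF, herm_hop_self_re, mul_eq_zero, or_iff_right two_ne_zero,
      Finset.sum_eq_zero_iff_of_nonneg fun S _ => by positivity] at h1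
    have h2 := h1 S (Finset.mem_univ _)
    have h3 : (occ x i S * occ y i S : ℝ) = 0 := by
      rcases mul_eq_zero.1 h2 with h | h
      · exact h
      · exact absurd (by simpa using h) hS
    exact_mod_cast h3

end Adjoint

end Hopping

/-! ### Primitive invariants and the first fundamental theorem. -/

section Invariants

variable {G : Type*} {M : Type*} [AddCommGroup M] [Module ℂ M]
  (e : Basis G ℂ M) {m : ℕ} (w x y : Fin 2 × Fin m → G)

/-- The monomial `w (t 0, 0) ∧ … ∧ w (t (m - 1), m - 1)`. -/
def siteMon (t : Fin m → Fin 2) : ExteriorAlgebra ℂ M :=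
  ExteriorAlgebra.ιMulti ℂ m fun s => e (w (t s, s))

variable {w x y}

/-- The monomial on the left has two factors of index i and none of index j. The derivation moves
either of them to j; the two outcomes differ by exchanging the types at i and j, and the
transposition of the slots produces the minus sign. -/
theorem hop_doubled (hw : Function.Injective w) {i j : Fin m} (hij : i ≠ j)
    (t : Fin m → Fin 2) :
    hop e w j i (ExteriorAlgebra.ιMulti ℂ m
      (Function.update (fun s => e (w (t s, s))) j (e (w (t j, i))))) =
        siteMon e w t - siteMon e w (t ∘ Equiv.swap i j) := by
  rw [hop_ιMulti, ← Finset.sum_subset (Finset.subset_univ {i, j}), Finset.sum_pair hij, add_comm,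
    sub_eq_add_neg]
  · congr 1
    · rw [Function.update_self, hopLin_self e w hw, Function.update_idem,
        Function.update_eq_self, siteMon]
    · rw [Function.update_of_ne hij, hopLin_self e w hw, siteMon,
        ← AlternatingMap.map_swap _ _ hij]
      congr 1
      ext s
      rcases eq_or_ne s i with rfl | hi
      · simp
      · rcases eq_or_ne s j with rfl | hj
        · simp [hi]
        · simp [hi, hj, Equiv.swap_apply_of_ne_of_ne hi hj]
  · intro s _ hs
    simp only [Finset.mem_insert, Finset.mem_singleton, not_or] at hs
    rw [Function.update_of_ne hs.2, hopLin_of_ne]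
    · exact AlternatingMap.map_coord_zero _ s (by simp)
    · intro a h
      exact hs.1 (Prod.ext_iff.1 (hw h)).2

variable [LinearOrder G]

/-- The set of vectors in the monomial `siteMon`. -/
def siteSet (w : Fin 2 × Fin m → G) (t : Fin m → Fin 2) : Finset G :=
  Finset.univ.image fun s => w (t s, s)

theorem siteSet_injective (hw : Function.Injective w) : Function.Injective (siteSet w) := by
  intro t t' h
  ext1 s
  have h1 : w (t s, s) ∈ siteSet w t' := by
    rw [← h]
    exact Finset.mem_image_of_mem _ (Finset.mem_univ _)
  obtain ⟨s', -, hs'⟩ := Finset.mem_image.1 h1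
  have := Prod.ext_iff.1 (hw hs')
  simp only at this
  rw [← this.1, this.2]

theorem siteMon_eq (hw : Function.Injective w) (t : Fin m → Fin 2) :
    ∃ ε : ℤˣ, siteMon e w t = ε • e.ExteriorAlgebra (siteSet w t) :=
  ιMulti_eq_sign_smul_basis e (fun s => w (t s, s)) fun _ _ h => (Prod.ext_iff.1 (hw h)).2

theorem exists_siteSet_eq {S : Finset G} (hS : ∀ g ∈ S, g ∈ Set.range w)
    (h : ∀ i, occ w i S = 1) : ∃ t, S = siteSet w t := by
  have h1 : ∀ i, ∃ a, Finset.univ.filter (fun a => w (a, i) ∈ S) = {a} :=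
    fun i => Finset.card_eq_one.1 (h i)
  -- Exactly one of the two types occurs at each index; `t` records which.
  choose t ht using h1
  have h2 : ∀ a i, w (a, i) ∈ S ↔ a = t i := by
    intro a i
    rw [← Finset.mem_singleton, ← ht i]
    simp
  refine ⟨t, Finset.ext fun g => ⟨fun hg => ?_, fun hg => ?_⟩⟩
  · obtain ⟨⟨a, i⟩, rfl⟩ := hS g hg
    rw [(h2 a i).1 hg]
    exact Finset.mem_image_of_mem _ (Finset.mem_univ _)
  · obtain ⟨s, -, rfl⟩ := Finset.mem_image.1 hg
    exact (h2 _ _).2 rfl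

theorem eq_image_of_occ {S : Finset G} (hS : ∀ g ∈ S, g ∈ Set.range w)
    (h : ∀ i, occ w i S = 2) : S = Finset.univ.image w := by
  have h1 : ∀ i, Finset.univ.filter (fun a => w (a, i) ∈ S) = Finset.univ :=
    fun i => Finset.card_eq_iff_eq_univ _ |>.1 (by simpa [occ] using h i)
  refine Finset.ext fun g => ⟨fun hg => ?_, fun hg => ?_⟩
  · obtain ⟨p, rfl⟩ := hS g hg
    exact Finset.mem_image_of_mem _ (Finset.mem_univ _)
  · obtain ⟨⟨a, i⟩, -, rfl⟩ := Finset.mem_image.1 hg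
    have := Finset.mem_univ a
    rw [← h1 i] at this
    simpa using this

theorem occ_le_two (w : Fin 2 × Fin m → G) (i : Fin m) (S : Finset G) : occ w i S ≤ 2 := by
  simpa [occ] using Finset.card_filter_le (Finset.univ : Finset (Fin 2)) fun a => w (a, i) ∈ S

theorem notMem_of_occ {S : Finset G} {i : Fin m} (h : occ w i S = 0) (a : Fin 2) :
    w (a, i) ∉ S := by
  rw [occ, Finset.card_eq_zero, Finset.filter_eq_empty_iff] at h
  exact h (Finset.mem_univ a)

/-- The possible supports when all indices carry the same charge of a single type. -/
theorem support_cases (i₀ : Fin m) {S : Finset G}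
    (hS : ∀ g ∈ S, g ∈ Set.range x ∨ g ∈ Set.range y)
    (h0 : ∀ i, occ x i S * occ y i S = 0)
    (hc : ∀ i j, (occ x i S : ℤ) - occ y i S = occ x j S - occ y j S) :
    S = ∅ ∨ S = Finset.univ.image x ∨ S = Finset.univ.image y ∨ (∃ t, S = siteSet x t) ∨
      ∃ t, S = siteSet y t := by
  have hpq : ∀ i, occ x i S = 0 ∨ occ y i S = 0 := fun i => mul_eq_zero.1 (h0 i)
  have hx2 := fun i => occ_le_two x i S
  have hy2 := fun i => occ_le_two y i S
  have onlyx : (∀ i, occ y i S = 0) → ∀ g ∈ S, g ∈ Set.range x := by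
    intro h g hg
    rcases hS g hg with h' | ⟨⟨a, i⟩, rfl⟩
    · exact h'
    · exact absurd hg (notMem_of_occ (h i) a)
  have onlyy : (∀ i, occ x i S = 0) → ∀ g ∈ S, g ∈ Set.range y := by
    intro h g hg
    rcases hS g hg with ⟨⟨a, i⟩, rfl⟩ | h'
    · exact absurd hg (notMem_of_occ (h i) a)
    · exact h'
  have hcase : (occ x i₀ S = 0 ∧ occ y i₀ S = 0) ∨ (occ x i₀ S = 1 ∧ occ y i₀ S = 0) ∨
      (occ x i₀ S = 2 ∧ occ y i₀ S = 0) ∨ (occ x i₀ S = 0 ∧ occ y i₀ S = 1) ∨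
      (occ x i₀ S = 0 ∧ occ y i₀ S = 2) := by
    have := hpq i₀; have := hx2 i₀; have := hy2 i₀; omega
  have all : ∀ i, (occ x i S = occ x i₀ S ∧ occ y i S = occ y i₀ S) := by
    intro i
    have := hpq i; have := hc i i₀; have := hpq i₀
    omega
  rcases hcase with h | h | h | h | h
  · left
    refine Finset.eq_empty_of_forall_notMem fun g hg => ?_
    rcases hS g hg with ⟨⟨a, i⟩, rfl⟩ | ⟨⟨a, i⟩, rfl⟩
    · exact notMem_of_occ ((all i).1.trans h.1) a hg
    · exact notMem_of_occ ((all i).2.trans h.2) a hg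
  · exact Or.inr (Or.inr (Or.inr (Or.inl (exists_siteSet_eq
      (onlyx fun i => (all i).2.trans h.2) fun i => (all i).1.trans h.1))))
  · exact Or.inr (Or.inl (eq_image_of_occ
      (onlyx fun i => (all i).2.trans h.2) fun i => (all i).1.trans h.1))
  · exact Or.inr (Or.inr (Or.inr (Or.inr (exists_siteSet_eq
      (onlyy fun i => (all i).1.trans h.1) fun i => (all i).2.trans h.2))))
  · exact Or.inr (Or.inr (Or.inl (eq_image_of_occ
      (onlyy fun i => (all i).1.trans h.1) fun i => (all i).2.trans h.2)))

/-- For constant `t` the symmetrised sum is m! times a single monomial, and the full product is, up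
to sign, the product of the monomials for the two constant types. -/
theorem basis_image_mem (hw : Function.Injective w) (A : Subalgebra ℂ (ExteriorAlgebra ℂ M))
    (hA : ∀ t : Fin m → Fin 2, ∑ σ : Equiv.Perm (Fin m), siteMon e w (t ∘ σ) ∈ A) :
    e.ExteriorAlgebra (Finset.univ.image w) ∈ A := by
  have h1 : ∀ a : Fin 2, e.ExteriorAlgebra (siteSet w fun _ => a) ∈ A := by
    intro a
    have h := hA fun _ => a
    have h2 : ∀ σ : Equiv.Perm (Fin m), (fun _ => a) ∘ σ = fun _ : Fin m => a := fun _ => rfl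
    simp only [h2, Finset.sum_const, Finset.card_univ] at h
    obtain ⟨ε, hε⟩ := siteMon_eq e hw fun _ => a
    have h3 : (Fintype.card (Equiv.Perm (Fin m)) : ℂ) ≠ 0 :=
      Nat.cast_ne_zero.2 Fintype.card_ne_zero
    have h4 : siteMon e w (fun _ => a) ∈ A := by
      rw [← Nat.cast_smul_eq_nsmul ℂ] at h
      have := A.smul_mem h (Fintype.card (Equiv.Perm (Fin m)) : ℂ)⁻¹
      rwa [smul_smul, inv_mul_cancel₀ h3, one_smul] at this
    rw [hε] at h4
    rcases Int.units_eq_one_or ε with rfl | rfl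
    · simpa using h4
    · simpa using A.neg_mem h4
  have hd : Disjoint (siteSet w fun _ => 0) (siteSet w fun _ => 1) := by
    rw [Finset.disjoint_left]
    intro g h h'
    obtain ⟨s, -, rfl⟩ := Finset.mem_image.1 h
    obtain ⟨s', -, hs⟩ := Finset.mem_image.1 h'
    simpa using hw hs
  obtain ⟨ε, hε⟩ := basis_mul_basis_of_disjoint e hd
  have hu : siteSet w (fun _ => 0) ∪ siteSet w (fun _ => 1) = Finset.univ.image w := by
    ext g
    simp [siteSet, Prod.exists, Fin.exists_fin_two]
  have h5 := A.mul_mem (h1 0) (h1 1)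
  rw [hε, hu] at h5
  rcases Int.units_eq_one_or ε with rfl | rfl
  · simpa using h5
  · simpa using A.neg_mem h5

variable [Fintype G]

/-- It is enough to treat a transposition. There the difference of the two monomials is in the image
of a hopping operator by `hop_doubled`, and the adjoint of that operator kills `v`. -/
theorem herm_siteMon_comp (hw : Function.Injective w) {v : ExteriorAlgebra ℂ M}
    (hv : ∀ i j, i ≠ j → hop e w i j v = 0) (σ : Equiv.Perm (Fin m)) (t : Fin m → Fin 2) :
    herm e (siteMon e w (t ∘ σ)) v = herm e (siteMon e w t) v := by
  induction σ using Equiv.Perm.swap_induction_on generalizing t with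
  | one => rfl
  | swap_mul f i j hij ih =>
    have h := hop_doubled e hw hij t
    have h1 : herm e (siteMon e w t - siteMon e w (t ∘ Equiv.swap i j)) v = 0 := by
      rw [← h, herm_hop, hv i j hij, map_zero]
    rw [map_sub, LinearMap.sub_apply, sub_eq_zero] at h1
    rw [h1, ← ih (t ∘ Equiv.swap i j)]
    rfl

/-- Averaging over permutations: replacing t by t ∘ σ leaves the coefficients unchanged, so m! times
the sum is a combination of symmetrised monomials. The sign relating `siteMon` to a basis monomial
occurs twice and disappears. -/
theorem sum_siteSet_mem (hw : Function.Injective w) {v : ExteriorAlgebra ℂ M}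
    (hv : ∀ i j, i ≠ j → hop e w i j v = 0) (A : Subalgebra ℂ (ExteriorAlgebra ℂ M))
    (hA : ∀ t : Fin m → Fin 2, ∑ σ : Equiv.Perm (Fin m), siteMon e w (t ∘ σ) ∈ A) :
    ∑ t, e.ExteriorAlgebra.repr v (siteSet w t) • e.ExteriorAlgebra (siteSet w t) ∈ A := by
  have h1 : ∀ t, e.ExteriorAlgebra.repr v (siteSet w t) • e.ExteriorAlgebra (siteSet w t) =
      herm e (siteMon e w t) v • siteMon e w t := by
    intro t
    obtain ⟨ε, hε⟩ := siteMon_eq e hw t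
    rw [hε]
    rcases Int.units_eq_one_or ε with rfl | rfl <;> simp [herm_basis_left]
  simp only [h1]
  have h3 : (Fintype.card (Equiv.Perm (Fin m)) : ℂ) ≠ 0 := Nat.cast_ne_zero.2 Fintype.card_ne_zero
  have h2 : (Fintype.card (Equiv.Perm (Fin m)) : ℂ) •
      ∑ t, herm e (siteMon e w t) v • siteMon e w t =
      ∑ t, herm e (siteMon e w t) v • ∑ σ : Equiv.Perm (Fin m), siteMon e w (t ∘ σ) := by
    simp only [Finset.smul_sum (r := herm e _ v)]
    rw [Finset.sum_comm, Nat.cast_smul_eq_nsmul, ← Finset.card_univ, ← Finset.sum_const]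
    refine Finset.sum_congr rfl fun σ _ => ?_
    rw [← Equiv.sum_comp (Equiv.arrowCongr σ.symm (Equiv.refl (Fin 2)))]
    refine Finset.sum_congr rfl fun t _ => ?_
    rw [← herm_siteMon_comp e hw hv σ t]
    rfl
  have h4 : (Fintype.card (Equiv.Perm (Fin m)) : ℂ) •
      ∑ t, herm e (siteMon e w t) v • siteMon e w t ∈ A := by
    rw [h2]
    exact A.sum_mem fun t _ => A.smul_mem (hA t) _
  have := A.smul_mem h4 (Fintype.card (Equiv.Perm (Fin m)) : ℂ)⁻¹
  rwa [smul_smul, inv_mul_cancel₀ h3, one_smul] at this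

/-- Invariants that are killed by all contractions lie in the algebra. -/
theorem mem_of_primitive (i₀ : Fin m) (hx : Function.Injective x) (hy : Function.Injective y)
    (hxy : ∀ p q, x p ≠ y q) (A : Subalgebra ℂ (ExteriorAlgebra ℂ M))
    (hAx : ∀ t : Fin m → Fin 2, ∑ σ : Equiv.Perm (Fin m), siteMon e x (t ∘ σ) ∈ A)
    (hAy : ∀ t : Fin m → Fin 2, ∑ σ : Equiv.Perm (Fin m), siteMon e y (t ∘ σ) ∈ A)
    {v : ExteriorAlgebra ℂ M} (hinv : IsSlInvariant e x y v)
    (hlow : ∀ a b, lower e x y a b v = 0)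
    (hcon : ∀ g, g ∉ Set.range x → g ∉ Set.range y → contractLeft (e.coord g) v = 0) :
    v ∈ A := by
  obtain ⟨hhop, hocc⟩ := hop_eq_zero_of_lower e hxy v hinv hlow
  have hsupp : ∀ S, e.ExteriorAlgebra.repr v S ≠ 0 →
      S = ∅ ∨ S = Finset.univ.image x ∨ S = Finset.univ.image y ∨ (∃ t, S = siteSet x t) ∨
      ∃ t, S = siteSet y t := by
    intro S hS
    refine support_cases i₀ ?_ (fun i => hocc i S hS) ?_
    · intro g hg
      by_contra! hcon'
      -- The occupation number operator of g acts as 1 on a monomial containing g, but it kills `v`;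
      -- so trivial vectors do not occur in the support.
      have h1 := repr_ι_mul_contractLeft e g v S
      rw [hcon g hcon'.1 hcon'.2, if_pos hg] at h1
      simp only [mul_zero, map_zero, Finsupp.coe_zero, Pi.zero_apply] at h1
      exact hS h1.symm
    · intro i j
      -- The diagonal matrix units act on a monomial by its charge, the number of x minus the number
      -- of y at the index. Invariance equates the charges at i and j.
      have h1 := congrArg (fun u => e.ExteriorAlgebra.repr u S) (hinv.2 i j)
      simp only [unitDer, LinearMap.sub_apply, map_sub, Finsupp.coe_sub, Pi.sub_apply,
        repr_hop_self, ← sub_mul] at h1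
      exact_mod_cast mul_right_cancel₀ hS h1
  have hdisj : ∀ t t', siteSet x t ≠ siteSet y t' := by
    intro t t' h
    have h1 : x (t i₀, i₀) ∈ siteSet y t' := by
      rw [← h]
      exact Finset.mem_image_of_mem _ (Finset.mem_univ _)
    obtain ⟨s, -, hs⟩ := Finset.mem_image.1 h1
    exact hxy _ _ hs.symm
  rw [← e.ExteriorAlgebra.sum_repr v]
  classical
  let Px := Finset.univ.image (siteSet x)
  let Py := Finset.univ.image (siteSet y)
  have hP : Disjoint Px Py := by
    rw [Finset.disjoint_left]
    intro S h h'
    obtain ⟨t, -, rfl⟩ := Finset.mem_image.1 h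
    obtain ⟨t', -, hs⟩ := Finset.mem_image.1 h'
    exact hdisj _ _ hs.symm
  rw [← Finset.sum_add_sum_compl (Px ∪ Py), Finset.sum_union hP,
    Finset.sum_image fun _ _ _ _ h => siteSet_injective hx h,
    Finset.sum_image fun _ _ _ _ h => siteSet_injective hy h]
  refine A.add_mem (A.add_mem (sum_siteSet_mem e hx (fun i j h => (hhop i j h).1) A hAx)
    (sum_siteSet_mem e hy (fun i j h => (hhop i j h).2) A hAy)) (A.sum_mem fun S hS => ?_)
  by_cases h0 : e.ExteriorAlgebra.repr v S = 0
  · rw [h0, zero_smul]; exact A.zero_mem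
  refine A.smul_mem ?_ _
  rw [Finset.mem_compl, Finset.mem_union, not_or] at hS
  rcases hsupp S h0 with rfl | rfl | rfl | ⟨t, rfl⟩ | ⟨t, rfl⟩
  · obtain ⟨f, -, -, hf⟩ := exists_basis_eq_ιMulti e (∅ : Finset G)
    rw [hf]
    exact A.one_mem
  · exact basis_image_mem e hx A hAx
  · exact basis_image_mem e hy A hAy
  · exact absurd (Finset.mem_image_of_mem _ (Finset.mem_univ _)) hS.1
  · exact absurd (Finset.mem_image_of_mem _ (Finset.mem_univ _)) hS.2

/-- A subspace is contained in another if it contains no nonzero vector orthogonal to the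
intersection of both. -/
theorem le_of_forall_herm_eq_zero (P Q : Submodule ℂ (ExteriorAlgebra ℂ M))
    (h : ∀ v ∈ Q, (∀ u ∈ P ⊓ Q, herm e u v = 0) → v = 0) : Q ≤ P := by
  let L : ExteriorAlgebra ℂ M ≃ₗ[ℂ] EuclideanSpace ℂ (Finset G) :=
    e.ExteriorAlgebra.equivFun ≪≫ₗ (WithLp.linearEquiv 2 ℂ (Finset G → ℂ)).symm
  have hL : ∀ u v, inner ℂ (L u) (L v) = herm e u v := by
    intro u v
    simp [L, PiLp.inner_apply, herm_apply, mul_comm]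
  let R := (P ⊓ Q).map (L : ExteriorAlgebra ℂ M →ₗ[ℂ] EuclideanSpace ℂ (Finset G))
  intro v hv
  -- Project v orthogonally to the intersection; the remainder is still in `Q` and is orthogonal to
  -- the intersection, hence zero.
  obtain ⟨a, ha, b, hb, hab⟩ := R.exists_add_mem_mem_orthogonal (L v)
  obtain ⟨a', ha', rfl⟩ := Submodule.mem_map.1 ha
  have h1 : L.symm b = v - a' := by
    rw [LinearEquiv.symm_apply_eq, map_sub, hab]
    simp
  have h2 : v - a' = 0 := by
    refine h _ (Q.sub_mem hv ha'.2) fun u hu => ?_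
    rw [← hL, ← h1, LinearEquiv.apply_symm_apply]
    exact hb _ (Submodule.mem_map_of_mem hu)
  rw [sub_eq_zero.1 h2]
  exact ha'.1

theorem repr_contractLeft_eq_zero {d : ℕ} {v : ExteriorAlgebra ℂ M}
    (h : ∀ S : Finset G, d + 1 ≤ S.card → e.ExteriorAlgebra.repr v S = 0) (g : G)
    (S : Finset G) (hS : d ≤ S.card) :
    e.ExteriorAlgebra.repr (contractLeft (e.coord g) v) S = 0 := by
  by_cases hg : g ∈ S
  · exact repr_contractLeft_of_mem e g v S hg
  · obtain ⟨ε, hε⟩ := repr_contractLeft e g v S hg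
    rw [hε, h _ (by rw [Finset.card_insert_of_notMem hg]; omega), smul_zero]

/-- **First fundamental theorem** of the invariant theory of the special linear Lie algebra, on the
exterior algebra of two copies of the standard representation (spanned by `x`), two copies of its
dual (spanned by `y`) and a trivial representation. -/
theorem mem_of_isSlInvariant (i₀ : Fin m) (hx : Function.Injective x) (hy : Function.Injective y)
    (hxy : ∀ p q, x p ≠ y q) (A : Subalgebra ℂ (ExteriorAlgebra ℂ M))
    (hA : ∀ g, g ∉ Set.range x → g ∉ Set.range y → ExteriorAlgebra.ι ℂ (e g) ∈ A)
    (hAp : ∀ a b, pairing e x y a b ∈ A)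
    (hAx : ∀ t : Fin m → Fin 2, ∑ σ : Equiv.Perm (Fin m), siteMon e x (t ∘ σ) ∈ A)
    (hAy : ∀ t : Fin m → Fin 2, ∑ σ : Equiv.Perm (Fin m), siteMon e y (t ∘ σ) ∈ A)
    {v : ExteriorAlgebra ℂ M} (hv : IsSlInvariant e x y v) : v ∈ A := by
  let I : Submodule ℂ (ExteriorAlgebra ℂ M) :=
    { carrier := {u | IsSlInvariant e x y u}
      add_mem' := fun {u u'} hu hu' =>
        ⟨fun i j hij => by rw [map_add, hu.1 i j hij, hu'.1 i j hij, add_zero],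
          fun i j => by rw [map_add, map_add, hu.2 i j, hu'.2 i j]⟩
      zero_mem' := ⟨fun i j _ => map_zero _, fun i j => by rw [map_zero, map_zero]⟩
      smul_mem' := fun c u hu =>
        ⟨fun i j hij => by rw [map_smul, hu.1 i j hij, smul_zero],
          fun i j => by rw [map_smul, map_smul, hu.2 i j]⟩ }
  have stable : ∀ r : ExteriorAlgebra ℂ M →ₗ[ℂ] ExteriorAlgebra ℂ M,
      (∀ i j u, unitDer e x y i j (r u) = r (unitDer e x y i j u)) → ∀ u ∈ I, r u ∈ I := by
    intro r hr u hu
    exact ⟨fun i j hij => by rw [hr, hu.1 i j hij, map_zero], fun i j => by rw [hr, hr, hu.2 i j]⟩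
  refine (le_of_forall_herm_eq_zero e (Subalgebra.toSubmodule A) I ?_) hv
  -- Induction on a strict bound for the degree. Contractions preserve invariance and, by
  -- adjointness, orthogonality to A ⊓ I, while lowering the degree; so they vanish on v. Then v is
  -- primitive, lies in A, and is orthogonal to itself.
  have key : ∀ d : ℕ, ∀ v ∈ I, (∀ u ∈ Subalgebra.toSubmodule A ⊓ I, herm e u v = 0) →
      (∀ S : Finset G, d ≤ S.card → e.ExteriorAlgebra.repr v S = 0) → v = 0 := by
    intro d
    induction d with
    | zero =>
      intro v _ _ h
      refine (LinearEquiv.map_eq_zero_iff e.ExteriorAlgebra.repr).1 (Finsupp.ext fun S => ?_)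
      simpa using h S (Nat.zero_le _)
    | succ d ih =>
      intro v hvI hvA hd
      have hlow : ∀ a b, lower e x y a b v = 0 := by
        intro a b
        refine ih _ (stable _ (fun i j u => unitDer_lower e hx hy hxy a b i j u) v hvI) ?_ ?_
        · intro u hu
          rw [← herm_pairing_mul]
          exact hvA _ ⟨A.mul_mem (hAp a b) hu.1, stable (LinearMap.mulLeft ℂ _)
            (fun i j u => unitDer_pairing_mul e hx hy hxy a b i j u) u hu.2⟩
        · intro S hS
          rw [lower_apply, map_sum, Finsupp.finsetSum_apply]
          refine Finset.sum_eq_zero fun i _ => ?_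
          refine repr_contractLeft_eq_zero e (fun T hT => ?_) _ S hS
          exact repr_contractLeft_eq_zero e hd _ T (by omega)
      have hcon : ∀ g, g ∉ Set.range x → g ∉ Set.range y → contractLeft (e.coord g) v = 0 := by
        intro g hgx hgy
        refine ih _ (stable _
          (fun i j u => unitDer_contractLeft_of_notMem e hgx hgy i j u) v hvI) ?_ ?_
        · intro u hu
          rw [← herm_ι_mul]
          exact hvA _ ⟨A.mul_mem (hA g hgx hgy) hu.1, stable (LinearMap.mulLeft ℂ _)
            (fun i j u => unitDer_ι_mul_of_notMem e x y hgx hgy i j u) u hu.2⟩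
        · exact fun S hS => repr_contractLeft_eq_zero e hd g S hS
      have hvm := mem_of_primitive e i₀ hx hy hxy A hAx hAy hvI hlow hcon
      exact eq_zero_of_herm_self_re e v (by rw [hvA v ⟨hvm, hvI⟩]; rfl)
  intro v hvI hvA
  refine key (Fintype.card G + 1) v hvI hvA fun S hS => ?_
  have := S.card_le_univ
  omega

end Invariants

/-- Differentiating a one-parameter family of exterior algebra maps that fix `ω`. -/
theorem derivation_eq_zero_of_map_eq {M : Type*} [AddCommGroup M] [Module ℂ M]
    (P K : M →ₗ[ℂ] M) (D : ExteriorAlgebra ℂ M →ₗ[ℂ] ExteriorAlgebra ℂ M) (hD1 : D 1 = 0)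
    (hD : ∀ v u, D (ExteriorAlgebra.ι ℂ v * u) =
      ExteriorAlgebra.ι ℂ (K v) * u + ExteriorAlgebra.ι ℂ v * D u)
    (ω : ExteriorAlgebra ℂ M)
    (hω : ∀ t : ℝ, ExteriorAlgebra.map
      (LinearMap.id + ((Real.cos t : ℂ) - 1) • P + (Real.sin t : ℂ) • K) ω = ω) :
    D ω = 0 := by
  let L : ℝ → M →ₗ[ℂ] M := fun t =>
    LinearMap.id + ((Real.cos t : ℂ) - 1) • P + (Real.sin t : ℂ) • K
  have hL0 : L 0 = LinearMap.id := by simp [L]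
  -- Derivatives are taken weakly, against every linear functional, so no norm on the exterior
  -- algebra is needed. At t = 0 the cosine term has derivative zero, and only K contributes.
  have key : ∀ u : ExteriorAlgebra ℂ M, ∀ ℓ : ExteriorAlgebra ℂ M →ₗ[ℂ] ℂ,
      HasDerivAt (fun t : ℝ => ℓ (ExteriorAlgebra.map (L t) u)) (ℓ (D u)) 0 := by
    intro u
    induction u using CliffordAlgebra.left_induction with
    | algebraMap r =>
      intro ℓ
      have h : D (algebraMap ℂ (ExteriorAlgebra ℂ M) r) = 0 := by
        rw [Algebra.algebraMap_eq_smul_one, map_smul, hD1, smul_zero]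
      rw [h, map_zero]
      simp only [AlgHom.commutes]
      exact hasDerivAt_const _ _
    | add u u' hu hu' =>
      intro ℓ
      simp only [map_add]
      exact (hu ℓ).add (hu' ℓ)
    | ι_mul u v hu =>
      intro ℓ
      have hc : HasDerivAt (fun t : ℝ => (Real.cos t : ℂ) - 1) (0 : ℂ) 0 := by
        simpa using ((Real.hasDerivAt_cos 0).ofReal_comp).sub_const (1 : ℂ)
      have hs : HasDerivAt (fun t : ℝ => (Real.sin t : ℂ)) (1 : ℂ) 0 := by
        simpa using (Real.hasDerivAt_sin 0).ofReal_comp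
      have h1 := hu (ℓ ∘ₗ LinearMap.mulLeft ℂ (ExteriorAlgebra.ι ℂ v))
      have h2 := hc.mul (hu (ℓ ∘ₗ LinearMap.mulLeft ℂ (ExteriorAlgebra.ι ℂ (P v))))
      have h3 := hs.mul (hu (ℓ ∘ₗ LinearMap.mulLeft ℂ (ExteriorAlgebra.ι ℂ (K v))))
      have h4 := (h1.add h2).add h3
      have e1 : (fun t : ℝ => ℓ (ExteriorAlgebra.map (L t) (ExteriorAlgebra.ι ℂ v * u))) =
          fun t : ℝ => ℓ (ExteriorAlgebra.ι ℂ v * ExteriorAlgebra.map (L t) u) +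
            ((Real.cos t : ℂ) - 1) * ℓ (ExteriorAlgebra.ι ℂ (P v) * ExteriorAlgebra.map (L t) u) +
            (Real.sin t : ℂ) * ℓ (ExteriorAlgebra.ι ℂ (K v) * ExteriorAlgebra.map (L t) u) := by
        ext t
        rw [map_mul, ExteriorAlgebra.map_apply_ι]
        simp only [L, LinearMap.add_apply, LinearMap.smul_apply, LinearMap.id_apply, map_add,
          map_smul, add_mul, smul_mul_assoc, smul_eq_mul]
      rw [e1]
      refine HasDerivAt.congr_deriv h4 ?_
      simp only [LinearMap.comp_apply, LinearMap.mulLeft_apply, hL0, ExteriorAlgebra.map_id,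
        AlgHom.id_apply, hD, map_add]
      simp [add_comm]
  refine (Module.forall_dual_apply_eq_zero_iff ℂ _).1 fun ℓ => ?_
  refine (key ω ℓ).unique ?_
  simp only [L, hω]
  exact hasDerivAt_const _ _

/-! ### Copies of SU(2) in SU(n) acting on a coordinate plane. -/

section Block

variable {n : ℕ} {i j : Fin n}

/-- The inclusion of the coordinate plane `i, j`. -/
def planeIncl (i j : Fin n) : Matrix (Fin n) (Fin 2) ℂ :=
  Matrix.of fun k a => if k = ![i, j] a then 1 else 0

theorem planeIncl_transpose_mul (hij : i ≠ j) :
    (planeIncl i j).transpose * planeIncl i j = 1 := by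
  ext a b
  simp only [Matrix.mul_apply, planeIncl, Matrix.transpose_apply, Matrix.of_apply, ite_mul, one_mul,
    zero_mul, Finset.sum_ite_eq', Finset.mem_univ, if_true]
  fin_cases a <;> fin_cases b <;> simp [hij, hij.symm]

/-- The matrix that acts by `B` on the coordinate plane `i, j`, and fixes the other coordinates. -/
def blockMat (i j : Fin n) (B : Matrix (Fin 2) (Fin 2) ℂ) : Matrix (Fin n) (Fin n) ℂ :=
  1 + planeIncl i j * ((B - 1) * (planeIncl i j).transpose)

theorem blockMat_mul (hij : i ≠ j) (B C : Matrix (Fin 2) (Fin 2) ℂ) :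
    blockMat i j B * blockMat i j C = blockMat i j (B * C) := by
  have h : planeIncl i j * ((B - 1) * (planeIncl i j).transpose) *
      (planeIncl i j * ((C - 1) * (planeIncl i j).transpose)) =
      planeIncl i j * ((B - 1) * (C - 1) * (planeIncl i j).transpose) := by
    calc _ = planeIncl i j * ((B - 1) * ((planeIncl i j).transpose * planeIncl i j) * ((C - 1) *
        (planeIncl i j).transpose)) := by simp only [Matrix.mul_assoc]
      _ = _ := by rw [planeIncl_transpose_mul hij, Matrix.mul_one, Matrix.mul_assoc]
  simp only [blockMat, mul_add, add_mul, h, one_mul, mul_one]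
  have h2 : B * C - 1 = (B - 1) + (C - 1) + (B - 1) * (C - 1) := by noncomm_ring
  rw [h2, Matrix.add_mul, Matrix.add_mul, Matrix.mul_add, Matrix.mul_add]
  abel

theorem blockMat_star (B : Matrix (Fin 2) (Fin 2) ℂ) :
    star (blockMat i j B) = blockMat i j (star B) := by
  have h : (planeIncl i j).transpose = (planeIncl i j).conjTranspose := by
    ext a k
    simp [planeIncl, apply_ite (starRingEnd ℂ)]
  simp only [blockMat, Matrix.star_eq_conjTranspose, Matrix.conjTranspose_add,
    Matrix.conjTranspose_mul, Matrix.conjTranspose_one, h, Matrix.conjTranspose_sub,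
    Matrix.conjTranspose_conjTranspose, Matrix.mul_assoc]

/-- The identity det (1 + UV) = det (1 + VU) reduces the determinant to size two. -/
theorem blockMat_det (hij : i ≠ j) (B : Matrix (Fin 2) (Fin 2) ℂ) :
    (blockMat i j B).det = B.det := by
  rw [blockMat, Matrix.det_one_add_mul_comm, Matrix.mul_assoc, planeIncl_transpose_mul hij,
    Matrix.mul_one, add_sub_cancel]

theorem blockMat_mem (hij : i ≠ j) {B : Matrix (Fin 2) (Fin 2) ℂ}
    (hB : B ∈ Matrix.specialUnitaryGroup (Fin 2) ℂ) :
    blockMat i j B ∈ Matrix.specialUnitaryGroup (Fin n) ℂ := by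
  rw [Matrix.mem_specialUnitaryGroup_iff, Matrix.mem_unitaryGroup_iff] at hB ⊢
  rw [blockMat_star, blockMat_mul hij, hB.1, blockMat_det hij, hB.2]
  simp [blockMat]

theorem blockMat_mulVec (hij : i ≠ j) (B : Matrix (Fin 2) (Fin 2) ℂ) (v : Fin n → ℂ) (k : Fin n) :
    (blockMat i j B).mulVec v k = if k = i then B 0 0 * v i + B 0 1 * v j else
      if k = j then B 1 0 * v i + B 1 1 * v j else v k := by
  have h1 : ∀ a, (planeIncl i j).transpose.mulVec v a = v (![i, j] a) := by
    intro a
    simp [Matrix.mulVec, dotProduct, planeIncl]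
  rw [blockMat, Matrix.add_mulVec, ← Matrix.mulVec_mulVec, ← Matrix.mulVec_mulVec,
    Matrix.one_mulVec, Pi.add_apply]
  simp only [Matrix.mulVec, dotProduct, Fin.sum_univ_two] at h1 ⊢
  rw [h1, h1]
  simp only [planeIncl, Matrix.of_apply, Matrix.sub_apply]
  by_cases hi : k = i
  · subst hi; simp [hij]; ring
  · by_cases hj : k = j
    · subst hj; simp [hi]; ring
    · simp [hi, hj]

/-- The one-parameter subgroup of `SU(2)` generated by a unit vector of its Lie algebra. -/
def rot (u : ℝ) (w : ℂ) (t : ℝ) : Matrix (Fin 2) (Fin 2) ℂ :=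
  !![Real.cos t + Real.sin t * (Complex.I * u), Real.sin t * w;
    - (Real.sin t * starRingEnd ℂ w), Real.cos t - Real.sin t * (Complex.I * u)]

/-- The matrix is cos t + sin t · X with X skew-Hermitian, traceless and X² = -(u² + |w|²) = -1, so
it is exp (tX). The normalisation makes the family affine in cos t and sin t. -/
theorem rot_mem {u : ℝ} {w : ℂ} (h : u ^ 2 + ‖w‖ ^ 2 = 1) (t : ℝ) :
    rot u w t ∈ Matrix.specialUnitaryGroup (Fin 2) ℂ := by
  have h1 : (u : ℂ) ^ 2 + w * starRingEnd ℂ w = 1 := by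
    rw [Complex.mul_conj']
    exact_mod_cast h
  have h2 : (Real.cos t : ℂ) ^ 2 + (Real.sin t : ℂ) ^ 2 = 1 := by
    exact_mod_cast Real.cos_sq_add_sin_sq t
  rw [Matrix.mem_specialUnitaryGroup_iff, Matrix.mem_unitaryGroup_iff]
  constructor
  · ext a b
    fin_cases a <;> fin_cases b <;>
      simp only [rot, Matrix.mul_apply, Fin.sum_univ_two, Matrix.star_apply, Matrix.of_apply,
        Matrix.cons_val', Matrix.cons_val_zero, Matrix.cons_val_one, Matrix.cons_val_fin_one,
        Fin.zero_eta, Fin.mk_one, Fin.isValue, Complex.star_def, map_add, map_sub, map_neg,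
        map_mul, Complex.conj_ofReal, Complex.conj_I, Complex.conj_conj, Matrix.one_apply,
        zero_ne_one, one_ne_zero, if_true, if_false]
    · linear_combination h2 + (Real.sin t : ℂ) ^ 2 * h1 -
        (Real.sin t : ℂ) ^ 2 * u ^ 2 * Complex.I_sq
    · ring
    · ring
    · linear_combination h2 + (Real.sin t : ℂ) ^ 2 * h1 -
        (Real.sin t : ℂ) ^ 2 * u ^ 2 * Complex.I_sq
  · rw [Matrix.det_fin_two]
    simp only [rot, Matrix.of_apply, Matrix.cons_val', Matrix.cons_val_zero, Matrix.cons_val_one,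
      Matrix.cons_val_fin_one]
    linear_combination h2 + (Real.sin t : ℂ) ^ 2 * h1 -
        (Real.sin t : ℂ) ^ 2 * u ^ 2 * Complex.I_sq

end Block

/-! ### A coframe at the base point. -/

section BasePoint

variable (m : ℕ)

/-- The point `(0, e₀)` of the sphere bundle. -/
def basePt : SphereBundle (m + 1) :=
  ⟨(0, Pi.single 0 1), by simp [Fin.sum_univ_succ]⟩

variable {m}

theorem mem_tangent_basePt {v : Ambient (m + 1)} :
    v ∈ tangent (basePt m) ↔ (v.2 0).re = 0 := by
  change ∑ j, (star ((Pi.single 0 1 : Fin (m + 1) → ℂ) j) * v.2 j).re = 0 ↔ _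
  simp [Fin.sum_univ_succ]

variable (m) in
/-- The index set of a coframe at the base point: three forms that are fixed by the stabiliser, two
copies of the standard representation and two copies of its conjugate. -/
abbrev CoIdx : Type := Fin 3 ⊕ (Fin 2 × Fin m) ⊕ (Fin 2 × Fin m)

/-- The coordinates `z_j` (`a = 0`) and `ζ_j` (`a = 1`). -/
def coordOf {n : ℕ} (a : Fin 2) (j : Fin n) : Ambient n →ₗ[ℝ] ℂ := ![zCoord j, zetaCoord j] a

/-- The forms `dz₀, dz̄₀, dζ₀`, and `dz_j, dζ_j`, `dz̄_j, dζ̄_j` for `j > 0`. -/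
def ambientCoframe : CoIdx m → Ambient (m + 1) →ₗ[ℝ] ℂ
  | Sum.inl k => ![zCoord 0, conjForm (zCoord 0), zetaCoord 0] k
  | Sum.inr (Sum.inl p) => coordOf p.1 p.2.succ
  | Sum.inr (Sum.inr p) => conjForm (coordOf p.1 p.2.succ)

/-- The restriction of `ambientCoframe` to the tangent space at the base point. -/
def coframe (g : CoIdx m) : tangent (basePt m) →ₗ[ℝ] ℂ :=
  ambientCoframe g ∘ₗ (tangent (basePt m)).subtype

theorem sum_coframe (c : CoIdx m → ℂ) (τ : tangent (basePt m)) :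
    (∑ g, c g • coframe g) τ =
      (c (.inl 0) * τ.1.1 0 + c (.inl 1) * starRingEnd ℂ (τ.1.1 0) + c (.inl 2) * τ.1.2 0) +
      ∑ i, (c (.inr (.inl (0, i))) * τ.1.1 i.succ +
        c (.inr (.inr (0, i))) * starRingEnd ℂ (τ.1.1 i.succ)) +
      ∑ i, (c (.inr (.inl (1, i))) * τ.1.2 i.succ +
        c (.inr (.inr (1, i))) * starRingEnd ℂ (τ.1.2 i.succ)) := by
  simp [coframe, ambientCoframe, coordOf, zCoord, zetaCoord, conjForm, Fintype.sum_sum_type,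
    Fintype.sum_prod_type, Fin.sum_univ_succ, Finset.sum_add_distrib]
  ring

/-- The inclusion of the `j`-th coordinate line of the first factor. -/
def inclFst (j : Fin (m + 1)) : ℂ →ₗ[ℝ] tangent (basePt m) :=
  LinearMap.codRestrict _
    (LinearMap.inl ℝ _ _ ∘ₗ LinearMap.single ℝ (fun _ : Fin (m + 1) => ℂ) j)
    fun c => mem_tangent_basePt.2 (by simp)

/-- The inclusion of the coordinate line of index `i + 1` of the second factor. -/
def inclSnd (i : Fin m) : ℂ →ₗ[ℝ] tangent (basePt m) :=
  LinearMap.codRestrict _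
    (LinearMap.inr ℝ _ _ ∘ₗ LinearMap.single ℝ (fun _ : Fin (m + 1) => ℂ) i.succ)
    fun c => mem_tangent_basePt.2 (by simp)

variable (m) in
/-- The tangent vector `(0, i e₀)`. -/
def verticalVec : tangent (basePt m) :=
  ⟨(0, Pi.single 0 Complex.I), mem_tangent_basePt.2 (by simp)⟩

theorem tangent_decomp (τ : tangent (basePt m)) :
    τ = inclFst 0 (τ.1.1 0) + (τ.1.2 0).im • verticalVec m +
      ∑ i : Fin m, inclFst i.succ (τ.1.1 i.succ) + ∑ i, inclSnd i (τ.1.2 i.succ) := by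
  have h0 : (τ.1.2 0).re = 0 := mem_tangent_basePt.1 τ.2
  apply Subtype.ext
  refine Prod.ext (funext fun j => ?_) (funext fun j => ?_)
  · refine Fin.cases ?_ (fun i => ?_) j
    · simp [inclFst, inclSnd, verticalVec, Prod.fst_sum]
    · simp [inclFst, inclSnd, verticalVec, Prod.fst_sum, Pi.single_apply]
  · refine Fin.cases ?_ (fun i => ?_) j
    · simp [inclFst, inclSnd, verticalVec, Prod.snd_sum]
      apply Complex.ext <;> simp [h0]
    · simp [inclFst, inclSnd, verticalVec, Prod.snd_sum, Pi.single_apply]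

/-- The decomposition into a complex linear and a conjugate linear part, with explicit coefficients.
-/
theorem real_linear_eq (ψ : ℂ →ₗ[ℝ] ℂ) (s : ℂ) :
    ψ s = (ψ 1 - Complex.I * ψ Complex.I) / 2 * s +
      (ψ 1 + Complex.I * ψ Complex.I) / 2 * starRingEnd ℂ s := by
  have h : ψ s = s.re * ψ 1 + s.im * ψ Complex.I := by
    conv_lhs => rw [show s = s.re • (1 : ℂ) + s.im • Complex.I by
      simp [Complex.re_add_im]]
    rw [map_add, map_smul, map_smul, Complex.real_smul, Complex.real_smul]
  have h1 : starRingEnd ℂ s = s.re - s.im * Complex.I := by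
    apply Complex.ext <;> simp
  have h2 := Complex.re_add_im s
  rw [h, h1]
  conv_rhs => rw [← h2]
  simp only [Complex.add_re, Complex.ofReal_re, Complex.mul_re, Complex.I_re, mul_zero,
    Complex.ofReal_im, Complex.I_im, mul_one, sub_self, add_zero, Complex.add_im, Complex.mul_im,
    zero_add]
  linear_combination ((s.im : ℂ) * ψ Complex.I) * Complex.I_sq

theorem eq_zero_of_forall_add_conj {A B : ℂ} (h : ∀ s, A * s + B * starRingEnd ℂ s = 0) :
    A = 0 ∧ B = 0 := by
  have h1 := h 1
  have h2 := h Complex.I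
  simp only [map_one, mul_one, Complex.conj_I] at h1 h2
  constructor
  · linear_combination h1 / 2 - Complex.I / 2 * h2 + (A - B) / 2 * Complex.I_sq
  · linear_combination h1 / 2 + Complex.I / 2 * h2 - (A - B) / 2 * Complex.I_sq

theorem coframe_linearIndependent : LinearIndependent ℂ (coframe (m := m)) := by
  rw [Fintype.linearIndependent_iff]
  intro c hc
  have ev : ∀ τ, (∑ g, c g • coframe g) τ = 0 := fun τ => by rw [hc]; rfl
  simp only [sum_coframe] at ev
  have h0 := eq_zero_of_forall_add_conj (A := c (.inl 0)) (B := c (.inl 1)) fun s => by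
    simpa [inclFst] using ev (inclFst 0 s)
  have h2 : c (.inl 2) = 0 := by
    simpa [verticalVec] using ev (verticalVec m)
  have hz := fun i => eq_zero_of_forall_add_conj (A := c (.inr (.inl (0, i))))
    (B := c (.inr (.inr (0, i)))) fun s => by
    simpa [inclFst, Pi.single_apply, Finset.sum_add_distrib, apply_ite (starRingEnd ℂ)]
      using ev (inclFst i.succ s)
  have hw := fun i => eq_zero_of_forall_add_conj (A := c (.inr (.inl (1, i))))
    (B := c (.inr (.inr (1, i)))) fun s => by
    simpa [inclSnd, Pi.single_apply, Finset.sum_add_distrib, apply_ite (starRingEnd ℂ)]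
      using ev (inclSnd i s)
  rintro (k | ⟨a, i⟩ | ⟨a, i⟩)
  · fin_cases k
    exacts [h0.1, h0.2, h2]
  · fin_cases a
    exacts [(hz i).1, (hw i).1]
  · fin_cases a
    exacts [(hz i).2, (hw i).2]

theorem coframe_span : ⊤ ≤ Submodule.span ℂ (Set.range (coframe (m := m))) := by
  intro φ _
  let ψ : Fin (m + 1) → ℂ →ₗ[ℝ] ℂ := fun j => φ ∘ₗ inclFst j
  let χ : Fin m → ℂ →ₗ[ℝ] ℂ := fun i => φ ∘ₗ inclSnd i
  let A : (ℂ →ₗ[ℝ] ℂ) → ℂ := fun ψ => (ψ 1 - Complex.I * ψ Complex.I) / 2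
  let B : (ℂ →ₗ[ℝ] ℂ) → ℂ := fun ψ => (ψ 1 + Complex.I * ψ Complex.I) / 2
  -- On each coordinate line the coefficients are the complex linear and conjugate linear parts. The
  -- third is -i φ(vertical) because dζ₀ takes the value i on the vertical vector.
  let c : CoIdx m → ℂ := Sum.elim ![A (ψ 0), B (ψ 0), - Complex.I * φ (verticalVec m)]
    (Sum.elim (fun p => ![A (ψ p.2.succ), A (χ p.2)] p.1)
      (fun p => ![B (ψ p.2.succ), B (χ p.2)] p.1))
  have h : φ = ∑ g, c g • coframe g := by
    refine LinearMap.ext fun τ => ?_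
    have h0 : (τ.1.2 0).re = 0 := mem_tangent_basePt.1 τ.2
    have h1 : τ.1.2 0 = (τ.1.2 0).im * Complex.I := by
      apply Complex.ext <;> simp [h0]
    have hψ : ∀ j s, φ (inclFst j s) = A (ψ j) * s + B (ψ j) * starRingEnd ℂ s :=
      fun j s => real_linear_eq (ψ j) s
    have hχ : ∀ j s, φ (inclSnd j s) = A (χ j) * s + B (χ j) * starRingEnd ℂ s :=
      fun j s => real_linear_eq (χ j) s
    rw [sum_coframe]
    conv_lhs => rw [tangent_decomp τ]
    simp only [map_add, map_sum, hψ, hχ, map_smul]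
    simp only [c, Sum.elim_inl, Sum.elim_inr, Matrix.cons_val_zero, Matrix.cons_val_one,
      Matrix.cons_val]
    rw [h1]
    simp only [Complex.mul_im, Complex.ofReal_re, Complex.I_im, mul_one, Complex.ofReal_im,
      Complex.I_re, mul_zero, add_zero, Complex.real_smul]
    linear_combination ((τ.1.2 0).im * φ (verticalVec m)) * Complex.I_sq
  rw [h]
  exact Submodule.sum_mem _ fun g _ =>
    Submodule.smul_mem _ _ (Submodule.subset_span ⟨g, rfl⟩)

variable (m) in
/-- `coframe` as a basis of the complexified cotangent space at the base point. -/
def coframeBasis : Basis (CoIdx m) ℂ (tangent (basePt m) →ₗ[ℝ] ℂ) :=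
  Basis.mk coframe_linearIndependent coframe_span

theorem coframeBasis_apply (g : CoIdx m) : coframeBasis m g = coframe g :=
  Basis.mk_apply _ _ _

end BasePoint

/-! ### From invariance under the group to invariance under sl(m). -/

section Invariance

/-- Stated for an arbitrary target point `q` so that it applies to stabilisers: `act g a p` equals
`p` only propositionally, and the tangent space depends on the point. -/
theorem IsInvariant.pullback_eq {n : ℕ} {ω : Form n} (hω : IsInvariant ω)
    (g : Matrix.specialUnitaryGroup (Fin n) ℂ) (a : Fin n → ℂ) {p q : SphereBundle n}
    (h : act g a p = q) (f : tangent p →ₗ[ℝ] tangent q)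
    (hf : ∀ v, (f v : Ambient n) = (g.1.mulVec v.1.1, g.1.mulVec v.1.2)) :
    pullback f (ω q) = ω p := by
  subst h
  have : f = actDiff g a p := by
    refine LinearMap.ext fun v => Subtype.ext ?_
    rw [hf]
    rfl
  rw [this]
  exact hω g a p

variable {m : ℕ}

/-- The indices of `dz_j` and `dζ_j` in the coframe. -/
abbrev idxX (p : Fin 2 × Fin m) : CoIdx m := .inr (.inl p)
/-- The indices of `dz̄_j` and `dζ̄_j` in the coframe. -/
abbrev idxY (p : Fin 2 × Fin m) : CoIdx m := .inr (.inr p)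

theorem idxX_injective : Function.Injective (idxX (m := m)) :=
  Sum.inr_injective.comp Sum.inl_injective

theorem idxY_injective : Function.Injective (idxY (m := m)) :=
  Sum.inr_injective.comp Sum.inr_injective

theorem hopLin_apply_self {G M : Type*} [AddCommGroup M] [Module ℂ M] (e : Basis G ℂ M)
    {w : Fin 2 × Fin m → G} (hw : Function.Injective w) (i j k : Fin m) (a : Fin 2) :
    hopLin e w i j (e (w (a, k))) = if k = j then e (w (a, i)) else 0 := by
  split_ifs with h
  · subst h; exact hopLin_self e w hw _ _ _
  · exact hopLin_of_ne _ _ _ _ _ fun c hc => h (Prod.ext_iff.1 (hw hc)).2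

/-- The derivative at t = 0 of invariance under `rot u w t` in the plane i, j. Pulling back
coordinates transposes the matrix, so the entry w in position (i, j) comes with E_ji. -/
theorem sl_relation_of_invariant {ω : Form (m + 1)} (hω : IsInvariant ω) {i j : Fin m}
    (hij : i ≠ j) {u : ℝ} {w : ℂ} (huw : u ^ 2 + ‖w‖ ^ 2 = 1) :
    ((Complex.I * u) • (unitDer (coframeBasis m) idxX idxY i i -
        unitDer (coframeBasis m) idxX idxY j j) +
      w • unitDer (coframeBasis m) idxX idxY j i -
      starRingEnd ℂ w • unitDer (coframeBasis m) idxX idxY i j) (ω (basePt m)) = 0 := by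
  set e := coframeBasis m with he
  -- P projects onto the covectors of index i or j, the only ones that move, and K is the generator;
  -- the pullback is 1 + (cos t - 1) P + sin t K.
  let P := hopLin e idxX i i + hopLin e idxX j j + (hopLin e idxY i i + hopLin e idxY j j)
  let K := (Complex.I * u) • (unitLin e idxX idxY i i - unitLin e idxX idxY j j) +
      w • unitLin e idxX idxY j i - starRingEnd ℂ w • unitLin e idxX idxY i j
  have hij' : i.succ ≠ j.succ := fun h => hij (Fin.succ_injective _ h)
  refine derivation_eq_zero_of_map_eq P K _ ?_ ?_ _ ?_
  · simp [unitDer_one]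
  · intro v u
    simp only [K, LinearMap.add_apply, LinearMap.sub_apply, LinearMap.smul_apply, unitDer_ι_mul,
      map_add, map_sub, map_smul, add_mul, sub_mul, mul_add, mul_sub, smul_add, smul_sub,
      smul_mul_assoc, mul_smul_comm]
    abel
  · intro t
    let B := rot u w t
    let g : Matrix.specialUnitaryGroup (Fin (m + 1)) ℂ :=
      ⟨blockMat i.succ j.succ B, blockMat_mem hij' (rot_mem huw t)⟩
    have hg : ∀ v k, g.1.mulVec v k = _ := blockMat_mulVec hij' B
    have hg0 : ∀ v, g.1.mulVec v 0 = v 0 := by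
      intro v
      rw [hg, if_neg (Fin.succ_ne_zero _).symm, if_neg (Fin.succ_ne_zero _).symm]
    have hgs : ∀ v (k : Fin m), g.1.mulVec v k.succ =
        if k = i then B 0 0 * v i.succ + B 0 1 * v j.succ else
          if k = j then B 1 0 * v i.succ + B 1 1 * v j.succ else v k.succ := by
      intro v k
      rw [hg]
      simp only [Fin.succ_inj]
    have hact : act g 0 (basePt m) = basePt m := by
      apply Subtype.ext
      refine Prod.ext ?_ (funext fun k => ?_)
      · change g.1.mulVec 0 + 0 = 0
        simp
      · change g.1.mulVec (Pi.single 0 1) k = (Pi.single 0 1 : Fin (m + 1) → ℂ) k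
        refine Fin.cases (hg0 _) (fun k => ?_) k
        rw [hgs]
        simp
    let f : tangent (basePt m) →ₗ[ℝ] tangent (basePt m) := LinearMap.restrict
      (LinearMap.prodMap (g.1.mulVecLin.restrictScalars ℝ) (g.1.mulVecLin.restrictScalars ℝ))
      fun v hv => mem_tangent_basePt.2 (by
        change (g.1.mulVec v.2 0).re = 0
        rw [hg0]
        exact mem_tangent_basePt.1 hv)
    have hf1 : ∀ τ, (f τ).1.1 = g.1.mulVec τ.1.1 := fun _ => rfl
    have hf2 : ∀ τ, (f τ).1.2 = g.1.mulVec τ.1.2 := fun _ => rfl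
    have h := hω.pullback_eq g 0 hact f fun _ => rfl
    have hL : LinearMap.id + ((Real.cos t : ℂ) - 1) • P + (Real.sin t : ℂ) • K =
        LinearMap.lcomp ℂ ℂ f := by
      have hxy : ∀ a b (k l : Fin m), hopLin e idxY k l (e (idxX (a, b))) = 0 :=
        fun a b k l => hopLin_of_ne _ _ _ _ _ (by simp [idxX, idxY])
      have hyx : ∀ a b (k l : Fin m), hopLin e idxX k l (e (idxY (a, b))) = 0 :=
        fun a b k l => hopLin_of_ne _ _ _ _ _ (by simp [idxX, idxY])
      -- The group acts in the same way on both factors of ℂⁿ × ℂⁿ; ρ stands for either component,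
      -- so that z and ζ are handled together.
      have hcomp : ∀ a : Fin 2, ∃ ρ : tangent (basePt m) → Fin (m + 1) → ℂ,
          (∀ (l : Fin m) τ, coframe (idxX (a, l)) τ = ρ τ l.succ ∧
            coframe (idxY (a, l)) τ = starRingEnd ℂ (ρ τ l.succ)) ∧
          ∀ τ, ρ (f τ) = g.1.mulVec (ρ τ) := by
        intro a
        fin_cases a
        · exact ⟨fun τ => τ.1.1, fun _ _ => ⟨rfl, rfl⟩, fun _ => rfl⟩
        · exact ⟨fun τ => τ.1.2, fun _ _ => ⟨rfl, rfl⟩, fun _ => rfl⟩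
      refine e.ext fun c => ?_
      rcases c with k | ⟨a, k⟩ | ⟨a, k⟩
      · have h1 : ∀ k' l, hopLin e idxX k' l (e (.inl k)) = 0 :=
          fun k' l => hopLin_of_ne _ _ _ _ _ (by simp [idxX])
        have h2 : ∀ k' l, hopLin e idxY k' l (e (.inl k)) = 0 :=
          fun k' l => hopLin_of_ne _ _ _ _ _ (by simp [idxY])
        simp only [P, K, unitLin, LinearMap.add_apply, LinearMap.sub_apply, LinearMap.smul_apply,
          h1, h2, LinearMap.id_apply, smul_zero, add_zero, sub_zero]
        rw [he, coframeBasis_apply]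
        refine LinearMap.ext fun τ => ?_
        fin_cases k <;>
          simp [coframe, ambientCoframe, zCoord, zetaCoord, conjForm, hf1, hf2, hg0]
      · obtain ⟨ρ, hρ, hρf⟩ := hcomp a
        simp only [P, K, unitLin, LinearMap.add_apply, LinearMap.sub_apply, LinearMap.smul_apply,
          hxy, hopLin_apply_self e idxX_injective, LinearMap.id_apply]
        simp only [he, coframeBasis_apply]
        refine LinearMap.ext fun τ => ?_
        have hτ : ∀ l, coframe (idxX (a, l)) τ = ρ τ l.succ := fun l => (hρ l τ).1
        have hr : (LinearMap.lcomp ℂ ℂ f) (coframe (idxX (a, k))) τ =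
            g.1.mulVec (ρ τ) k.succ := by
          rw [← hρf]
          exact (hρ k (f τ)).1
        rw [hr, hgs]
        simp only [LinearMap.add_apply, LinearMap.sub_apply, LinearMap.smul_apply, hτ,
          apply_ite (fun φ : tangent (basePt m) →ₗ[ℝ] ℂ => φ τ), LinearMap.zero_apply, B, rot]
        by_cases hki : k = i
        · subst hki
          simp [hij]
          ring
        · by_cases hkj : k = j
          · subst hkj
            simp [hij.symm]
            ring
          · simp [hki, hkj]
      · obtain ⟨ρ, hρ, hρf⟩ := hcomp a
        simp only [P, K, unitLin, LinearMap.add_apply, LinearMap.sub_apply, LinearMap.smul_apply,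
          hyx, hopLin_apply_self e idxY_injective, LinearMap.id_apply]
        simp only [he, coframeBasis_apply]
        refine LinearMap.ext fun τ => ?_
        have hτ : ∀ l, coframe (idxY (a, l)) τ = starRingEnd ℂ (ρ τ l.succ) :=
          fun l => (hρ l τ).2
        have hr : (LinearMap.lcomp ℂ ℂ f) (coframe (idxY (a, k))) τ =
            starRingEnd ℂ (g.1.mulVec (ρ τ) k.succ) := by
          rw [← hρf]
          exact (hρ k (f τ)).2
        rw [hr, hgs]
        simp only [LinearMap.add_apply, LinearMap.sub_apply, LinearMap.smul_apply, hτ,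
          apply_ite (fun φ : tangent (basePt m) →ₗ[ℝ] ℂ => φ τ), LinearMap.zero_apply, B, rot]
        by_cases hki : k = i
        · subst hki
          simp [hij, Complex.conj_ofReal, -Complex.ofReal_cos, -Complex.ofReal_sin]
          ring
        · by_cases hkj : k = j
          · subst hkj
            simp [hij.symm, Complex.conj_ofReal, -Complex.ofReal_cos, -Complex.ofReal_sin]
            ring
          · simp [hki, hkj]
    rw [hL]
    exact h

theorem isSlInvariant_of_invariant {ω : Form (m + 1)} (hω : IsInvariant ω) :
    IsSlInvariant (coframeBasis m) idxX idxY (ω (basePt m)) := by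
  constructor
  · intro i j hij
    -- The generators w = 1 and w = i give E_ji - E_ij and i (E_ji + E_ij), which separate the two
    -- matrix units over ℂ.
    have h1 := sl_relation_of_invariant hω hij (u := 0) (w := 1) (by simp)
    have h2 := sl_relation_of_invariant hω hij (u := 0) (w := Complex.I) (by simp)
    simp only [Complex.ofReal_zero, mul_zero, zero_smul, zero_add, map_one, one_smul,
      Complex.conj_I, neg_smul, sub_neg_eq_add, LinearMap.sub_apply,
      LinearMap.smul_apply, ← smul_add, smul_eq_zero, Complex.I_ne_zero, false_or] at h1 h2
    rw [sub_eq_zero.1 h1, ← two_smul ℂ, smul_eq_zero] at h2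
    exact h2.resolve_left two_ne_zero
  · intro i j
    by_cases hij : i = j
    · rw [hij]
    have h1 := sl_relation_of_invariant hω hij (u := 1) (w := 0) (by simp)
    simp only [Complex.ofReal_one, mul_one, map_zero, zero_smul, add_zero, sub_zero,
      LinearMap.smul_apply, LinearMap.sub_apply, smul_eq_zero, Complex.I_ne_zero, false_or] at h1
    exact sub_eq_zero.1 h1

end Invariance

/-! ### Invariance of the generating forms. -/

section Generators

variable {n : ℕ}

variable (n) in
/-- The algebra of invariant forms. -/
def invariantForms : Subalgebra ℂ (Form n) where
  carrier := {ω | IsInvariant ω}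
  mul_mem' := fun {ω ω'} h h' g a p => by
    rw [Pi.mul_apply, map_mul, h g a p, h' g a p, Pi.mul_apply]
  add_mem' := fun {ω ω'} h h' g a p => by
    rw [Pi.add_apply, map_add, h g a p, h' g a p, Pi.add_apply]
  algebraMap_mem' := fun r g a p => by
    rw [Pi.algebraMap_apply, Pi.algebraMap_apply, AlgHom.commutes]

/-- The family `U` of forms transforms under `SU(n)` by the matrices `ρ g`. -/
def TransformsBy (ρ : Matrix (Fin n) (Fin n) ℂ → Matrix (Fin n) (Fin n) ℂ) (U : Fin n → Form n) :
    Prop :=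
  ∀ (g : Matrix.specialUnitaryGroup (Fin n) ℂ) (a : Fin n → ℂ) (p : SphereBundle n) (j : Fin n),
    pullback (actDiff g a p) (U j (act g a p)) = ∑ k, ρ g.1 j k • U k p

/-- The entrywise complex conjugate of a matrix. -/
abbrev conjMat (g : Matrix (Fin n) (Fin n) ℂ) : Matrix (Fin n) (Fin n) ℂ := g.map (starRingEnd ℂ)

theorem pullback_oneForm (φ : Ambient n →ₗ[ℝ] ℂ) (g : Matrix.specialUnitaryGroup (Fin n) ℂ)
    (a : Fin n → ℂ) (p : SphereBundle n) :
    pullback (actDiff g a p) (oneForm φ (act g a p)) =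
      ExteriorAlgebra.ι ℂ ((φ ∘ₗ (tangent (act g a p)).subtype) ∘ₗ actDiff g a p) := by
  rw [pullback, oneForm, ExteriorAlgebra.map_apply_ι]
  rfl

theorem actDiff_coe (g : Matrix.specialUnitaryGroup (Fin n) ℂ)
    (a : Fin n → ℂ) (p : SphereBundle n) (v : tangent p) :
    (actDiff g a p v : Ambient n) = (g.1.mulVec v.1.1, g.1.mulVec v.1.2) := rfl

theorem dz_transforms : TransformsBy (n := n) id dz := by
  intro g a p j
  rw [dz, pullback_oneForm]
  simp only [dz, oneForm, ← map_smul, ← map_sum]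
  congr 1
  refine LinearMap.ext fun v => ?_
  simp [actDiff_coe, zCoord, Matrix.mulVec, dotProduct]

theorem dzeta_transforms : TransformsBy (n := n) id dzeta := by
  intro g a p j
  rw [dzeta, pullback_oneForm]
  simp only [dzeta, oneForm, ← map_smul, ← map_sum]
  congr 1
  refine LinearMap.ext fun v => ?_
  simp [actDiff_coe, zetaCoord, Matrix.mulVec, dotProduct]

theorem dzBar_transforms : TransformsBy (n := n) conjMat dzBar := by
  intro g a p j
  rw [dzBar, pullback_oneForm]
  simp only [dzBar, oneForm, ← map_smul, ← map_sum]
  congr 1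
  refine LinearMap.ext fun v => ?_
  simp [actDiff_coe, zCoord, conjForm, Matrix.mulVec, dotProduct]

theorem dzetaBar_transforms : TransformsBy (n := n) conjMat dzetaBar := by
  intro g a p j
  rw [dzetaBar, pullback_oneForm]
  simp only [dzetaBar, oneForm, ← map_smul, ← map_sum]
  congr 1
  refine LinearMap.ext fun v => ?_
  simp [actDiff_coe, zetaCoord, conjForm, Matrix.mulVec, dotProduct]

theorem zeta_transforms : TransformsBy (n := n) id zeta := by
  intro g a p j
  simp only [zeta, fn, AlgHom.commutes, Algebra.smul_def, ← map_mul, ← map_sum]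
  congr 1

theorem zetaBar_transforms : TransformsBy (n := n) conjMat zetaBar := by
  intro g a p j
  simp only [zetaBar, fn, AlgHom.commutes, Algebra.smul_def, ← map_mul,
    ← map_sum]
  congr 1
  simp [act, zetaCoord, conjForm, Matrix.mulVec, dotProduct]

theorem sum_mul_sum_unitary {B : Type*} [Ring B] [Algebra ℂ B] {g h : Matrix (Fin n) (Fin n) ℂ}
    (hgh : g.transpose * h = 1) (U V : Fin n → B) :
    ∑ j, (∑ k, g j k • U k) * ∑ l, h j l • V l = ∑ k, U k * V k := by
  have h1 : ∀ k l, ∑ j, g j k * h j l = if k = l then 1 else 0 := by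
    intro k l
    have := congrFun (congrFun hgh k) l
    simpa [Matrix.mul_apply, Matrix.one_apply] using this
  simp only [Finset.sum_mul_sum, smul_mul_smul_comm]
  rw [Finset.sum_comm]
  refine Finset.sum_congr rfl fun k _ => ?_
  rw [Finset.sum_comm]
  simp only [← Finset.sum_smul, h1, ite_smul, one_smul, zero_smul, Finset.sum_ite_eq,
    Finset.mem_univ, if_true]

theorem invariant_pairing {ρ ρ' : Matrix (Fin n) (Fin n) ℂ → Matrix (Fin n) (Fin n) ℂ}
    {U V : Fin n → Form n} (hU : TransformsBy ρ U) (hV : TransformsBy ρ' V)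
    (h : ∀ g ∈ Matrix.specialUnitaryGroup (Fin n) ℂ, (ρ g).transpose * ρ' g = 1) :
    ∑ j, U j * V j ∈ invariantForms n := by
  intro g a p
  simp only [Finset.sum_apply, Pi.mul_apply, map_sum, map_mul, hU g a p, hV g a p]
  exact sum_mul_sum_unitary (h g.1 g.2) _ _

theorem transpose_mul_conjMat (g : Matrix (Fin n) (Fin n) ℂ)
    (hg : g ∈ Matrix.specialUnitaryGroup (Fin n) ℂ) : (id g).transpose * conjMat g = 1 := by
  have h := Matrix.mem_unitaryGroup_iff'.1 (Matrix.specialUnitaryGroup_le_unitaryGroup hg)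
  have h2 := congrArg Matrix.transpose h
  rw [Matrix.transpose_mul, Matrix.transpose_one] at h2
  rw [← h2]
  congr 1

theorem conjMat_transpose_mul (g : Matrix (Fin n) (Fin n) ℂ)
    (hg : g ∈ Matrix.specialUnitaryGroup (Fin n) ℂ) : (conjMat g).transpose * id g = 1 :=
  Matrix.mem_unitaryGroup_iff'.1 (Matrix.specialUnitaryGroup_le_unitaryGroup hg)

theorem alpha_invariant : alpha n ∈ invariantForms n := by
  rw [alpha, Finset.sum_add_distrib]
  exact Subalgebra.smul_mem _ (add_mem
    (invariant_pairing zeta_transforms dzBar_transforms transpose_mul_conjMat)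
    (invariant_pairing zetaBar_transforms dz_transforms conjMat_transpose_mul)) _

theorem beta_invariant : beta n ∈ invariantForms n := by
  rw [beta, Finset.sum_sub_distrib]
  exact Subalgebra.smul_mem _ (sub_mem
    (invariant_pairing zeta_transforms dzBar_transforms transpose_mul_conjMat)
    (invariant_pairing zetaBar_transforms dz_transforms conjMat_transpose_mul)) _

theorem gamma_invariant : gamma n ∈ invariantForms n := by
  rw [gamma, Finset.sum_sub_distrib]
  exact Subalgebra.smul_mem _ (sub_mem
    (invariant_pairing zeta_transforms dzetaBar_transforms transpose_mul_conjMat)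
    (invariant_pairing zetaBar_transforms dzeta_transforms conjMat_transpose_mul)) _

theorem theta0_invariant : theta0 n ∈ invariantForms n :=
  Subalgebra.smul_mem _
    (invariant_pairing dzeta_transforms dzetaBar_transforms transpose_mul_conjMat) _

theorem theta2_invariant : theta2 n ∈ invariantForms n :=
  sub_mem (Subalgebra.smul_mem _
    (invariant_pairing dz_transforms dzBar_transforms transpose_mul_conjMat) _)
    (mul_mem alpha_invariant beta_invariant)

theorem thetaC_invariant : thetaC n ∈ invariantForms n :=
  add_mem (sub_mem (invariant_pairing dz_transforms dzetaBar_transforms transpose_mul_conjMat)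
    (mul_mem beta_invariant gamma_invariant))
    (Subalgebra.smul_mem _ (mul_mem alpha_invariant gamma_invariant) _)

theorem thetaCBar_invariant : thetaCBar n ∈ invariantForms n :=
  sub_mem (sub_mem (invariant_pairing dzBar_transforms dzeta_transforms conjMat_transpose_mul)
    (mul_mem beta_invariant gamma_invariant))
    (Subalgebra.smul_mem _ (mul_mem alpha_invariant gamma_invariant) _)

/-- Expand the products multilinearly over maps κ. The signed sum over π is the determinant of h
with columns selected by κ; it vanishes unless κ is a permutation and is then sign κ · det h. No
commutation rule in `B` enters. -/
theorem alternatingSum_linear_combination {B : Type*} [Ring B] [Algebra ℂ B]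
    (h : Matrix (Fin n) (Fin n) ℂ) (W : Fin n → Fin n → B) :
    ∑ π : Equiv.Perm (Fin n), ((Equiv.Perm.sign π : ℤ) : ℂ) •
      (List.ofFn fun i => ∑ k, h (π i) k • W i k).prod =
    h.det • ∑ π : Equiv.Perm (Fin n), ((Equiv.Perm.sign π : ℤ) : ℂ) •
      (List.ofFn fun i => W i (π i)).prod := by
  have h1 : ∀ c : Fin n → Fin n → ℂ, (List.ofFn fun i => ∑ k, c i k • W i k).prod =
      ∑ κ : Fin n → Fin n, (∏ i, c i (κ i)) • (List.ofFn fun i => W i (κ i)).prod := by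
    intro c
    have h2 := MultilinearMap.map_sum (MultilinearMap.mkPiAlgebraFin ℂ n B)
      (fun i k => c i k • W i k)
    simp only [MultilinearMap.map_smul_univ, MultilinearMap.mkPiAlgebraFin_apply] at h2
    exact h2
  have h3 : ∀ κ : Fin n → Fin n, ∑ π : Equiv.Perm (Fin n),
      ((Equiv.Perm.sign π : ℤ) : ℂ) * ∏ i, h (π i) (κ i) = (h.submatrix id κ).det := by
    intro κ
    rw [Matrix.det_apply']
    rfl
  simp only [h1, Finset.smul_sum, smul_smul]
  rw [Finset.sum_comm]
  simp only [← Finset.sum_smul, h3]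
  symm
  refine Fintype.sum_of_injective (fun π : Equiv.Perm (Fin n) => (π : Fin n → Fin n))
    DFunLike.coe_injective _ _ ?_ ?_
  · intro κ hκ
    have hni : ¬ Function.Injective κ := fun hi =>
      hκ ⟨Equiv.ofBijective κ (Finite.injective_iff_bijective.1 hi), rfl⟩
    simp only [Function.Injective, not_forall] at hni
    obtain ⟨i, j, hij, hne⟩ := hni
    rw [Matrix.det_zero_of_column_eq hne (by intro k; simp [hij]), zero_smul]
  · intro π
    rw [Matrix.det_permute', mul_comm]

theorem chiSum_invariant {ρ : Matrix (Fin n) (Fin n) ℂ → Matrix (Fin n) (Fin n) ℂ}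
    (hρ : ∀ g ∈ Matrix.specialUnitaryGroup (Fin n) ℂ, (ρ g).det = 1) (k : ℕ)
    {f a b : Fin n → Form n} (hf : TransformsBy ρ f) (ha : TransformsBy ρ a)
    (hb : TransformsBy ρ b) : chiSum k f a b ∈ invariantForms n := by
  refine Subalgebra.smul_mem _ ?_ _
  intro g c p
  have h := alternatingSum_linear_combination (ρ g.1) fun i j =>
    if (i : ℕ) = 0 then f j p else if (i : ℕ) ≤ k then a j p else b j p
  rw [hρ g.1 g.2, one_smul] at h
  have ev : ∀ (q : SphereBundle n) (l : List (Form n)), l.prod q = (l.map fun η => η q).prod :=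
    fun q l => map_list_prod (Pi.evalRingHom (fun p : SphereBundle n => CForms (tangent p)) q) l
  simp only [Finset.sum_apply, Pi.smul_apply, ev, map_sum, map_smul, map_list_prod, List.map_ofFn,
    Function.comp_def]
  refine (Eq.trans ?_ h).trans ?_
  · refine Finset.sum_congr rfl fun π _ => congrArg _ (congrArg List.prod (congrArg List.ofFn ?_))
    ext1 i
    split_ifs
    · exact hf g c p _
    · exact ha g c p _
    · exact hb g c p _
  · refine Finset.sum_congr rfl fun π _ => congrArg _ (congrArg List.prod (congrArg List.ofFn ?_))
    ext1 i
    split_ifs <;> rfl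

theorem det_conjMat (g : Matrix (Fin n) (Fin n) ℂ)
    (hg : g ∈ Matrix.specialUnitaryGroup (Fin n) ℂ) : (conjMat g).det = 1 := by
  have h := (RingHom.map_det (starRingEnd ℂ) g).symm
  rw [(Matrix.mem_specialUnitaryGroup_iff.1 hg).2, map_one] at h
  exact h

theorem chi_invariant (k : ℤ) : chi n k ∈ invariantForms n := by
  rw [chi]
  split_ifs
  · exact chiSum_invariant (ρ := id) (fun g hg => (Matrix.mem_specialUnitaryGroup_iff.1 hg).2) _
      zeta_transforms dz_transforms dzeta_transforms
  · exact zero_mem _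

theorem chiBar_invariant (k : ℤ) : chiBar n k ∈ invariantForms n := by
  rw [chiBar]
  split_ifs
  · exact chiSum_invariant det_conjMat _
      zetaBar_transforms dzBar_transforms dzetaBar_transforms
  · exact zero_mem _

theorem generators_invariant : generators n ⊆ invariantForms n := by
  rintro ω ((h | ⟨k, rfl⟩) | ⟨k, rfl⟩)
  · simp only [Set.mem_insert_iff, Set.mem_singleton_iff] at h
    rcases h with rfl | rfl | rfl | rfl | rfl | rfl | rfl
    · exact alpha_invariant
    · exact beta_invariant
    · exact gamma_invariant
    · exact theta0_invariant
    · exact Subalgebra.smul_mem _ (sub_mem thetaC_invariant thetaCBar_invariant) _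
    · exact theta2_invariant
    · exact Subalgebra.smul_mem _ (add_mem thetaC_invariant thetaCBar_invariant) _
  · exact chi_invariant _
  · exact chiBar_invariant _

end Generators

/-! ### Transitivity of the action and reduction to the base point. -/

section Transitivity

variable {m : ℕ}

theorem actDiff_surjective {n : ℕ} (g : Matrix.specialUnitaryGroup (Fin n) ℂ) (a : Fin n → ℂ)
    (p : SphereBundle n) : Function.Surjective (actDiff g a p) := by
  have hg : g.1 * star g.1 = 1 :=
    Matrix.mem_unitaryGroup_iff.1 (Matrix.specialUnitaryGroup_le_unitaryGroup g.2)
  have h1 : ∀ v, g.1.mulVec ((star g.1).mulVec v) = v := by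
    intro v
    rw [Matrix.mulVec_mulVec, hg, Matrix.one_mulVec]
  intro v
  refine ⟨⟨((star g.1).mulVec v.1.1, (star g.1).mulVec v.1.2), ?_⟩, ?_⟩
  · have h2 := sum_re_star_mulVec g p.1.2 ((star g.1).mulVec v.1.2)
    rw [h1] at h2
    exact h2.symm.trans v.2
  · apply Subtype.ext
    rw [actDiff_coe]
    exact Prod.ext (h1 _) (h1 _)

/-- Extend ζ to an orthonormal basis and correct the determinant in another column. A second column
exists because n ≥ 2; SU(1) is trivial and not transitive on the circle. -/
theorem exists_specialUnitary_mulVec (hm : 1 ≤ m) (ζ : Fin (m + 1) → ℂ)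
    (hζ : ∑ j, ‖ζ j‖ ^ 2 = 1) :
    ∃ g : Matrix.specialUnitaryGroup (Fin (m + 1)) ℂ, g.1.mulVec (Pi.single 0 1) = ζ := by
  have hn : ‖WithLp.toLp 2 ζ‖ = 1 := by
    rw [EuclideanSpace.norm_eq, hζ, Real.sqrt_one]
  obtain ⟨b, hb⟩ := Orthonormal.exists_orthonormalBasis_extension_of_card_eq (𝕜 := ℂ)
    (E := EuclideanSpace ℂ (Fin (m + 1))) (ι := Fin (m + 1)) (by simp)
    (v := fun _ => WithLp.toLp 2 ζ) (s := {0}) (by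
      constructor
      · intro i; exact hn
      · intro i j hij
        exact absurd (Subsingleton.elim i j) hij)
  let U := (EuclideanSpace.basisFun (Fin (m + 1)) ℂ).toBasis.toMatrix b
  have hU : U ∈ Matrix.unitaryGroup (Fin (m + 1)) ℂ :=
    OrthonormalBasis.toMatrix_orthonormalBasis_mem_unitary _ _
  have hU0 : ∀ k, U k 0 = ζ k := by
    intro k
    simp [U, Basis.toMatrix_apply, hb 0 rfl]
  have hdet : U.det * star U.det = 1 := by
    have := congrArg Matrix.det (Matrix.mem_unitaryGroup_iff.1 hU)
    rwa [Matrix.det_mul, Matrix.star_eq_conjTranspose, Matrix.det_conjTranspose,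
      Matrix.det_one] at this
  let i₁ : Fin (m + 1) := ⟨1, by omega⟩
  have hi : (0 : Fin (m + 1)) ≠ i₁ := by
    intro h
    simpa [i₁] using congrArg Fin.val h
  -- Rescaling column 1 by the conjugate of det U, which has modulus one, makes the determinant 1
  -- and leaves column 0, equal to ζ, untouched.
  let d : Fin (m + 1) → ℂ := Function.update 1 i₁ (star U.det)
  have hd0 : d 0 = 1 := by simp [d, hi]
  have hd : Matrix.diagonal d ∈ Matrix.unitaryGroup (Fin (m + 1)) ℂ := by
    rw [Matrix.mem_unitaryGroup_iff, Matrix.star_eq_conjTranspose,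
      Matrix.diagonal_conjTranspose, Matrix.diagonal_mul_diagonal, ← Matrix.diagonal_one]
    congr 1
    ext k
    by_cases hk : k = i₁
    · subst hk
      simpa [d, mul_comm] using hdet
    · simp [d, hk]
  refine ⟨⟨U * Matrix.diagonal d, Matrix.mem_specialUnitaryGroup_iff.2
    ⟨mul_mem hU hd, ?_⟩⟩, ?_⟩
  · rw [Matrix.det_mul, Matrix.det_diagonal]
    simp only [d]
    rw [Finset.prod_update_of_mem (Finset.mem_univ _)]
    simpa using hdet
  · ext k
    simp [hU0, hd0]

theorem act_transitive (hm : 1 ≤ m) (p : SphereBundle (m + 1)) :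
    ∃ g a, act g a (basePt m) = p := by
  obtain ⟨g, hg⟩ := exists_specialUnitary_mulVec hm p.1.2 p.2
  refine ⟨g, p.1.1, Subtype.ext (Prod.ext ?_ hg)⟩
  change g.1.mulVec 0 + p.1.1 = p.1.1
  simp

/-- The differentials of the action are surjective, so pullback is injective on covectors and, over
a field, on exterior algebras. Transitivity does the rest. -/
theorem IsInvariant.eq_of_basePt (hm : 1 ≤ m) {ω ω' : Form (m + 1)} (h : IsInvariant ω)
    (h' : IsInvariant ω') (h0 : ω (basePt m) = ω' (basePt m)) : ω = ω' := by
  ext1 p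
  obtain ⟨g, a, rfl⟩ := act_transitive hm p
  have hinj : Function.Injective (pullback (actDiff g a (basePt m))) := by
    refine ExteriorAlgebra.map_injective_field (LinearMap.ker_eq_bot'.2 fun φ hφ => ?_)
    refine LinearMap.ext fun v => ?_
    obtain ⟨u, rfl⟩ := actDiff_surjective g a (basePt m) v
    exact LinearMap.congr_fun hφ u
  apply hinj
  rw [h g a, h' g a, h0]

end Transitivity

/-! ### The generators at the base point. -/

section BaseValues

variable {m : ℕ}

/-- The function on `Fin m` that is `0` on the first `k` elements and `1` on the others. -/
def stepFn (k : ℕ) (s : Fin m) : Fin 2 := if (s : ℕ) < k then 0 else 1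

/-- Up to a permutation, a two-valued function is determined by its number of zeros. That number is
the k of the form χ_k that yields the symmetrised monomial of `t`. -/
theorem exists_eq_stepFn_comp (t : Fin m → Fin 2) :
    ∃ k ≤ m, ∃ σ : Equiv.Perm (Fin m), t = stepFn k ∘ σ := by
  let k := Fintype.card {s // t s = 0}
  have hk : k ≤ m := by simpa using Fintype.card_subtype_le fun s => t s = 0
  have hc : Fintype.card {s // t s = 0} = Fintype.card {s : Fin m // (s : ℕ) < k} := by
    rw [Fintype.card_subtype fun s : Fin m => (s : ℕ) < k, Fin.card_filter_val_lt,
      min_eq_right hk]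
  let φ := Fintype.equivOfCardEq hc
  refine ⟨k, hk, φ.extendSubtype, funext fun s => ?_⟩
  by_cases hs : t s = 0
  · have h := φ.extendSubtype_mem s hs
    simp only [Function.comp_apply, stepFn, if_pos h, hs]
  · have h := φ.extendSubtype_not_mem s hs
    simp only [Function.comp_apply, stepFn, if_neg h]
    omega

/-- Sorting the factors in an alternating sum of exterior products. -/
theorem sum_sign_smul_ιMulti {M ι : Type*} [AddCommGroup M] [Module ℂ M] {n : ℕ}
    (W : ι → Fin n → M) (t : Fin n → ι) :
    ∑ π : Equiv.Perm (Fin n), ((Equiv.Perm.sign π : ℤ) : ℂ) •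
      ExteriorAlgebra.ιMulti ℂ n (fun s => W (t s) (π s)) =
    ∑ σ : Equiv.Perm (Fin n), ExteriorAlgebra.ιMulti ℂ n (fun s => W (t (σ s)) s) := by
  rw [← Equiv.sum_comp (Equiv.inv (Equiv.Perm (Fin n)))]
  refine Finset.sum_congr rfl fun π _ => ?_
  have h := AlternatingMap.map_perm (ExteriorAlgebra.ιMulti ℂ n (M := M))
    (fun s => W (t s) (π⁻¹ s)) π
  simp only [Equiv.Perm.inv_def, Equiv.symm_apply_apply, Function.comp_def] at h
  simp only [Equiv.inv_apply, Equiv.Perm.inv_def, Equiv.Perm.sign_symm]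
  rw [h, Units.smul_def, Int.cast_smul_eq_zsmul]

theorem form_list_prod_apply {n : ℕ} (q : SphereBundle n) (l : List (Form n)) :
    l.prod q = (l.map fun η => η q).prod :=
  map_list_prod (Pi.evalRingHom (fun p : SphereBundle n => CForms (tangent p)) q) l

/-- The value of `chiSum` at a point where the functions `f` are the coordinates of `e₀`. -/
theorem chiSum_apply_of_single (k : ℕ) {f a b : Fin (m + 1) → Form (m + 1)}
    {p : SphereBundle (m + 1)} (W : Fin 2 → Fin (m + 1) → tangent p →ₗ[ℝ] ℂ)
    (hf : ∀ j, f j p = if j = 0 then 1 else 0)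
    (ha : ∀ j, a j p = ExteriorAlgebra.ι ℂ (W 0 j))
    (hb : ∀ j, b j p = ExteriorAlgebra.ι ℂ (W 1 j)) :
    chiSum k f a b p = (1 / ((k.factorial : ℂ) * ((m - k).factorial : ℂ))) •
      ∑ σ : Equiv.Perm (Fin m),
        ExteriorAlgebra.ιMulti ℂ m (fun s => W (stepFn k (σ s)) s.succ) := by
  have hpt : ∀ π : Equiv.Perm (Fin (m + 1)), (List.ofFn fun i : Fin (m + 1) =>
      if (i : ℕ) = 0 then f (π i) else if (i : ℕ) ≤ k then a (π i) else b (π i)).prod p =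
      (List.ofFn fun i : Fin (m + 1) => if (i : ℕ) = 0 then f (π i) p else
        if (i : ℕ) ≤ k then a (π i) p else b (π i) p).prod := by
    intro π
    rw [form_list_prod_apply, List.map_ofFn]
    refine congrArg List.prod (congrArg List.ofFn (funext fun i => ?_))
    simp only [Function.comp_apply]
    split_ifs <;> rfl
  rw [chiSum, Pi.smul_apply, Finset.sum_apply]
  congr 1
  · rw [show m + 1 - k - 1 = m - k by omega]
  -- Sort the permutations by their value at 0. Only the value 0 contributes, since f π(0) vanishes
  -- otherwise, and the permutations of the remaining indices are left. Position s + 1 is of the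
  -- first type when s + 1 ≤ k, that is, when s < k.
  rw [← Equiv.sum_comp Equiv.Perm.decomposeFin.symm, Fintype.sum_prod_type,
    Finset.sum_eq_single 0]
  · rw [← sum_sign_smul_ιMulti (fun i s => W i s.succ) (stepFn k)]
    refine Finset.sum_congr rfl fun π _ => ?_
    rw [Pi.smul_apply, hpt, List.ofFn_succ, List.prod_cons,
      ExteriorAlgebra.ιMulti_apply, Equiv.Perm.decomposeFin.symm_sign]
    simp only [Fin.val_zero, if_true, hf, one_mul,
      Equiv.Perm.decomposeFin_symm_apply_zero, Fin.val_succ, Nat.add_eq_zero_iff, one_ne_zero,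
      and_false, if_false, Equiv.Perm.decomposeFin_symm_apply_succ, Equiv.swap_self,
      Equiv.refl_apply]
    refine congrArg _ (congrArg List.prod (congrArg List.ofFn (funext fun s => ?_)))
    simp only [Nat.succ_le_iff, stepFn]
    split_ifs
    · exact ha _
    · exact hb _
  · intro j _ hj
    refine Finset.sum_eq_zero fun π _ => ?_
    rw [Pi.smul_apply, hpt, List.ofFn_succ, List.prod_cons]
    simp only [Fin.val_zero, if_true, hf,
      Equiv.Perm.decomposeFin_symm_apply_zero, if_neg hj, zero_mul, smul_zero]
  · simp

theorem zeta_basePt (j : Fin (m + 1)) : zeta j (basePt m) = if j = 0 then 1 else 0 := by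
  change algebraMap ℂ _ ((Pi.single 0 1 : Fin (m + 1) → ℂ) j) = _
  rw [Pi.single_apply]
  split_ifs <;> simp

theorem zetaBar_basePt (j : Fin (m + 1)) : zetaBar j (basePt m) = if j = 0 then 1 else 0 := by
  change algebraMap ℂ _ (starRingEnd ℂ ((Pi.single 0 1 : Fin (m + 1) → ℂ) j)) = _
  rw [Pi.single_apply]
  split_ifs <;> simp

/-- Tangency to the sphere at e₀ makes the ζ₀ component purely imaginary. This accounts for three,
not four, trivial covectors. -/
theorem dzetaBar_zero_basePt : dzetaBar 0 (basePt m) = - dzeta 0 (basePt m) := by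
  rw [dzetaBar, dzeta, oneForm, oneForm, ← map_neg]
  congr 1
  refine LinearMap.ext fun v => ?_
  have h : (v.1.2 0).re = 0 := mem_tangent_basePt.1 v.2
  change starRingEnd ℂ (v.1.2 0) = - v.1.2 0
  apply Complex.ext <;> simp [h]

theorem alpha_basePt : alpha (m + 1) (basePt m) =
    (1 / 2 : ℂ) • (dzBar 0 (basePt m) + dz 0 (basePt m)) := by
  simp [alpha, Finset.sum_apply, zeta_basePt, zetaBar_basePt, Finset.sum_add_distrib]

theorem beta_basePt : beta (m + 1) (basePt m) =
    (Complex.I / 2) • (dzBar 0 (basePt m) - dz 0 (basePt m)) := by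
  simp [beta, Finset.sum_apply, zeta_basePt, zetaBar_basePt, Finset.sum_sub_distrib]

theorem gamma_basePt : gamma (m + 1) (basePt m) = - Complex.I • dzeta 0 (basePt m) := by
  simp only [gamma, Finset.sum_apply, zeta_basePt, zetaBar_basePt, Finset.sum_sub_distrib,
    Pi.smul_apply, Pi.sub_apply, Pi.mul_apply, ite_mul, one_mul, zero_mul, Finset.sum_ite_eq',
    Finset.mem_univ, if_true, dzetaBar_zero_basePt]
  module

theorem alpha_add_I_beta_basePt :
    alpha (m + 1) (basePt m) + Complex.I • beta (m + 1) (basePt m) = dz 0 (basePt m) := by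
  rw [alpha_basePt, beta_basePt, smul_smul,
    show Complex.I * (Complex.I / 2) = -(1 / 2) by linear_combination Complex.I_sq / 2]
  module

theorem alpha_sub_I_beta_basePt :
    alpha (m + 1) (basePt m) - Complex.I • beta (m + 1) (basePt m) = dzBar 0 (basePt m) := by
  rw [alpha_basePt, beta_basePt, smul_smul,
    show Complex.I * (Complex.I / 2) = -(1 / 2) by linear_combination Complex.I_sq / 2]
  module

theorem I_gamma_basePt : Complex.I • gamma (m + 1) (basePt m) = dzeta 0 (basePt m) := by
  rw [gamma_basePt, smul_smul, mul_neg, Complex.I_mul_I, neg_neg, one_smul]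

variable (m) in
/-- The values at the base point of the algebra generated by the generators. -/
def baseAlgebra : Subalgebra ℂ (CForms (tangent (basePt m))) :=
  (Algebra.adjoin ℂ (generators (m + 1))).map
    (Pi.evalAlgHom ℂ (fun p : SphereBundle (m + 1) => CForms (tangent p)) (basePt m))

theorem apply_basePt_mem {ω : Form (m + 1)} (h : ω ∈ generators (m + 1)) :
    ω (basePt m) ∈ baseAlgebra m :=
  ⟨ω, Algebra.subset_adjoin h, rfl⟩

theorem alpha_mem : alpha (m + 1) (basePt m) ∈ baseAlgebra m :=
  apply_basePt_mem (by simp [generators])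

theorem beta_mem : beta (m + 1) (basePt m) ∈ baseAlgebra m :=
  apply_basePt_mem (by simp [generators])

theorem gamma_mem : gamma (m + 1) (basePt m) ∈ baseAlgebra m :=
  apply_basePt_mem (by simp [generators])

theorem thetaS_mem : thetaS (m + 1) (basePt m) ∈ baseAlgebra m :=
  apply_basePt_mem (by simp [generators])

theorem theta1_mem : theta1 (m + 1) (basePt m) ∈ baseAlgebra m :=
  apply_basePt_mem (by simp [generators])

theorem dz_zero_mem : dz 0 (basePt m) ∈ baseAlgebra m := by
  rw [← alpha_add_I_beta_basePt]
  exact add_mem alpha_mem (Subalgebra.smul_mem _ beta_mem _)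

theorem dzBar_zero_mem : dzBar 0 (basePt m) ∈ baseAlgebra m := by
  rw [← alpha_sub_I_beta_basePt]
  exact sub_mem alpha_mem (Subalgebra.smul_mem _ beta_mem _)

theorem dzeta_zero_mem : dzeta 0 (basePt m) ∈ baseAlgebra m := by
  rw [← I_gamma_basePt]
  exact Subalgebra.smul_mem _ gamma_mem _

theorem dzetaBar_zero_mem : dzetaBar 0 (basePt m) ∈ baseAlgebra m := by
  rw [dzetaBar_zero_basePt]
  exact neg_mem dzeta_zero_mem

theorem coframe_inl_mem (k : Fin 3) :
    ExteriorAlgebra.ι ℂ (coframe (m := m) (.inl k)) ∈ baseAlgebra m := by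
  fin_cases k
  · exact dz_zero_mem
  · exact dzBar_zero_mem
  · exact dzeta_zero_mem

/-- The terms of positive index in an invariant pairing. -/
theorem pairing_mem_of_sum {U V : Fin (m + 1) → Form (m + 1)} {a b : Fin 2}
    (hU : ∀ i, U i.succ (basePt m) = ExteriorAlgebra.ι ℂ (coframe (idxX (a, i))))
    (hV : ∀ i, V i.succ (basePt m) = ExteriorAlgebra.ι ℂ (coframe (idxY (b, i))))
    (hU0 : U 0 (basePt m) ∈ baseAlgebra m) (hV0 : V 0 (basePt m) ∈ baseAlgebra m)
    (h : (∑ j, U j * V j) (basePt m) ∈ baseAlgebra m) :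
    pairing (coframeBasis m) idxX idxY a b ∈ baseAlgebra m := by
  have h1 : pairing (coframeBasis m) idxX idxY a b =
      (∑ j, U j * V j) (basePt m) - U 0 (basePt m) * V 0 (basePt m) := by
    simp only [pairing, coframeBasis_apply, Finset.sum_apply, Pi.mul_apply, Fin.sum_univ_succ, hU,
      hV]
    abel
  rw [h1]
  exact sub_mem h (mul_mem hU0 hV0)

theorem thetaC_mem : thetaC (m + 1) (basePt m) ∈ baseAlgebra m := by
  have h : thetaC (m + 1) = thetaS (m + 1) - Complex.I • theta1 (m + 1) := by
    rw [thetaS, theta1, smul_smul,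
      show Complex.I * (Complex.I / 2) = -(1 / 2) by linear_combination Complex.I_sq / 2]
    module
  rw [h]
  exact sub_mem thetaS_mem (Subalgebra.smul_mem _ theta1_mem _)

theorem thetaCBar_mem : thetaCBar (m + 1) (basePt m) ∈ baseAlgebra m := by
  have h : thetaCBar (m + 1) = thetaS (m + 1) + Complex.I • theta1 (m + 1) := by
    rw [thetaS, theta1, smul_smul,
      show Complex.I * (Complex.I / 2) = -(1 / 2) by linear_combination Complex.I_sq / 2]
    module
  rw [h]
  exact add_mem thetaS_mem (Subalgebra.smul_mem _ theta1_mem _)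

/-- Each full sum over j is recovered from the θ by adding back products of α, β, γ; removing its j
= 0 term, a product of trivial covectors, leaves the pairing. -/
theorem pairing_mem (a b : Fin 2) :
    pairing (coframeBasis m) idxX idxY a b ∈ baseAlgebra m := by
  have hab := mul_mem (alpha_mem (m := m)) beta_mem
  have hac := mul_mem (alpha_mem (m := m)) gamma_mem
  have hbc := mul_mem (beta_mem (m := m)) gamma_mem
  have h00 : (∑ j, dz j * dzBar j) (basePt m) ∈ baseAlgebra m := by
    have h : ∑ j, dz j * dzBar j = (-2 * Complex.I) •
        (theta2 (m + 1) + alpha (m + 1) * beta (m + 1)) := by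
      rw [theta2, sub_add_cancel, smul_smul,
        show -2 * Complex.I * (Complex.I / 2) = 1 by linear_combination -Complex.I_sq, one_smul]
    rw [h]
    exact Subalgebra.smul_mem _ (add_mem (apply_basePt_mem (by simp [generators])) hab) _
  have h11 : (∑ j, dzeta j * dzetaBar j) (basePt m) ∈ baseAlgebra m := by
    have h : ∑ j, dzeta j * dzetaBar j = (-2 * Complex.I) • theta0 (m + 1) := by
      rw [theta0, smul_smul,
        show -2 * Complex.I * (Complex.I / 2) = 1 by linear_combination -Complex.I_sq, one_smul]
    rw [h]
    exact Subalgebra.smul_mem _ (apply_basePt_mem (by simp [generators])) _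
  have h01 : (∑ j, dz j * dzetaBar j) (basePt m) ∈ baseAlgebra m := by
    have h : ∑ j, dz j * dzetaBar j = thetaC (m + 1) + beta (m + 1) * gamma (m + 1) -
        Complex.I • (alpha (m + 1) * gamma (m + 1)) := by
      rw [thetaC]
      abel
    rw [h]
    exact sub_mem (add_mem thetaC_mem hbc) (Subalgebra.smul_mem _ hac _)
  have h10 : (∑ j, dzeta j * dzBar j) (basePt m) ∈ baseAlgebra m := by
    -- `thetaCBar` has its factors in the opposite order to the pairing, hence a sign.
    have h1 : ∀ j : Fin (m + 1), dzeta j * dzBar j = - (dzBar j * dzeta j) := fun j =>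
      funext fun p => eq_neg_of_add_eq_zero_left (ExteriorAlgebra.ι_add_mul_swap _ _)
    have h : ∑ j, dzeta j * dzBar j = -(thetaCBar (m + 1) + beta (m + 1) * gamma (m + 1) +
        Complex.I • (alpha (m + 1) * gamma (m + 1))) := by
      simp only [h1, Finset.sum_neg_distrib, thetaCBar]
      abel
    rw [h]
    exact neg_mem (add_mem (add_mem thetaCBar_mem hbc) (Subalgebra.smul_mem _ hac _))
  fin_cases a <;> fin_cases b
  · exact pairing_mem_of_sum (fun _ => rfl) (fun _ => rfl) dz_zero_mem dzBar_zero_mem h00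
  · exact pairing_mem_of_sum (fun _ => rfl) (fun _ => rfl) dz_zero_mem dzetaBar_zero_mem h01
  · exact pairing_mem_of_sum (fun _ => rfl) (fun _ => rfl) dzeta_zero_mem dzBar_zero_mem h10
  · exact pairing_mem_of_sum (fun _ => rfl) (fun _ => rfl) dzeta_zero_mem dzetaBar_zero_mem h11

/-- The covector `dz_j` or `dζ_j` at a point. -/
def holCovec {n : ℕ} (p : SphereBundle n) (a : Fin 2) (j : Fin n) : tangent p →ₗ[ℝ] ℂ :=
  coordOf a j ∘ₗ (tangent p).subtype

/-- The covector `dz̄_j` or `dζ̄_j` at a point. -/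
def antiCovec {n : ℕ} (p : SphereBundle n) (a : Fin 2) (j : Fin n) : tangent p →ₗ[ℝ] ℂ :=
  conjForm (coordOf a j) ∘ₗ (tangent p).subtype

theorem chi_basePt {k : ℕ} (hk : k ≤ m) :
    chi (m + 1) k (basePt m) = (1 / ((k.factorial : ℂ) * ((m - k).factorial : ℂ))) •
      ∑ σ : Equiv.Perm (Fin m),
        ExteriorAlgebra.ιMulti ℂ m (fun s => holCovec (basePt m) (stepFn k (σ s)) s.succ) := by
  rw [chi, if_pos ⟨by omega, by omega⟩, Int.toNat_natCast]
  exact chiSum_apply_of_single k _ zeta_basePt (fun _ => rfl) (fun _ => rfl)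

theorem chiBar_basePt {k : ℕ} (hk : k ≤ m) :
    chiBar (m + 1) k (basePt m) = (1 / ((k.factorial : ℂ) * ((m - k).factorial : ℂ))) •
      ∑ σ : Equiv.Perm (Fin m),
        ExteriorAlgebra.ιMulti ℂ m (fun s => antiCovec (basePt m) (stepFn k (σ s)) s.succ) := by
  rw [chiBar, if_pos ⟨by omega, by omega⟩, Int.toNat_natCast]
  exact chiSum_apply_of_single k _ zetaBar_basePt (fun _ => rfl) (fun _ => rfl)

theorem factorial_coeff_ne_zero (k l : ℕ) :
    (1 / ((k.factorial : ℂ) * (l.factorial : ℂ))) ≠ 0 :=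
  one_div_ne_zero (mul_ne_zero (Nat.cast_ne_zero.2 (Nat.factorial_ne_zero _))
    (Nat.cast_ne_zero.2 (Nat.factorial_ne_zero _)))

/-- The symmetrised sum depends only on the number of zeros of `t`, so the step functions, which are
realised by χ_k or χ̄_k, are enough. -/
theorem siteMon_sum_mem {w : Fin 2 × Fin m → CoIdx m} (ξ : ℕ → CForms (tangent (basePt m)))
    (hξ : ∀ k ≤ m, ξ k ∈ baseAlgebra m)
    (h : ∀ k ≤ m, ∃ c : ℂ, c ≠ 0 ∧ ξ k = c • ∑ σ : Equiv.Perm (Fin m),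
      siteMon (coframeBasis m) w (stepFn k ∘ σ)) (t : Fin m → Fin 2) :
    ∑ σ : Equiv.Perm (Fin m), siteMon (coframeBasis m) w (t ∘ σ) ∈ baseAlgebra m := by
  obtain ⟨k, hk, τ, rfl⟩ := exists_eq_stepFn_comp t
  have h1 : ∑ σ : Equiv.Perm (Fin m), siteMon (coframeBasis m) w ((stepFn k ∘ τ) ∘ σ) =
      ∑ σ : Equiv.Perm (Fin m), siteMon (coframeBasis m) w (stepFn k ∘ σ) :=
    Equiv.sum_comp (Equiv.mulLeft τ) fun σ : Equiv.Perm (Fin m) =>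
      siteMon (coframeBasis m) w (stepFn k ∘ σ)
  obtain ⟨c, hc, h2⟩ := h k hk
  rw [h1, show ∑ σ : Equiv.Perm (Fin m), siteMon (coframeBasis m) w (stepFn k ∘ σ) =
    c⁻¹ • ξ k by rw [h2, smul_smul, inv_mul_cancel₀ hc, one_smul]]
  exact Subalgebra.smul_mem _ (hξ k hk) _

theorem siteMon_idxX_sum_mem (t : Fin m → Fin 2) :
    ∑ σ : Equiv.Perm (Fin m), siteMon (coframeBasis m) idxX (t ∘ σ) ∈ baseAlgebra m := by
  refine siteMon_sum_mem (fun k => chi (m + 1) k (basePt m)) (fun k hk => ?_) (fun k hk => ?_) t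
  · refine apply_basePt_mem (Or.inl (Or.inr ⟨⟨k, by omega⟩, rfl⟩))
  · refine ⟨_, factorial_coeff_ne_zero k (m - k), (chi_basePt hk).trans ?_⟩
    simp only [siteMon, coframeBasis_apply]
    rfl

theorem siteMon_idxY_sum_mem (t : Fin m → Fin 2) :
    ∑ σ : Equiv.Perm (Fin m), siteMon (coframeBasis m) idxY (t ∘ σ) ∈ baseAlgebra m := by
  refine siteMon_sum_mem (fun k => chiBar (m + 1) k (basePt m)) (fun k hk => ?_)
    (fun k hk => ?_) t
  · refine apply_basePt_mem (Or.inr ⟨⟨k, by omega⟩, rfl⟩)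
  · refine ⟨_, factorial_coeff_ne_zero k (m - k), (chiBar_basePt hk).trans ?_⟩
    simp only [siteMon, coframeBasis_apply]
    rfl

/-- Every invariant form lies in the algebra generated by the generators. -/
theorem mem_adjoin_of_invariant (hm : 1 ≤ m) {ω : Form (m + 1)} (hω : IsInvariant ω) :
    ω ∈ Algebra.adjoin ℂ (generators (m + 1)) := by
  -- Any order will do; it only fixes the signs of the basis monomials.
  let _ : LinearOrder (CoIdx m) :=
    LinearOrder.lift' (Fintype.equivFin (CoIdx m)) (Equiv.injective _)
  have h : ω (basePt m) ∈ baseAlgebra m := by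
    refine mem_of_isSlInvariant (coframeBasis m) (x := idxX) (y := idxY) ⟨0, hm⟩ idxX_injective
      idxY_injective (by simp [idxX, idxY]) _ ?_ pairing_mem siteMon_idxX_sum_mem
      siteMon_idxY_sum_mem (isSlInvariant_of_invariant hω)
    rintro (k | p | p) hx hy
    · rw [coframeBasis_apply]
      exact coframe_inl_mem k
    · exact absurd ⟨p, rfl⟩ hx
    · exact absurd ⟨p, rfl⟩ hy
  obtain ⟨ω', hω', h0⟩ := h
  have hinv : IsInvariant ω' := Algebra.adjoin_le generators_invariant hω'
  rw [hω.eq_of_basePt hm hinv h0.symm]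
  exact hω'

end BaseValues

/-! ### Exterior algebra elements as alternating maps. -/

section AlternatingMaps

variable {V W : Type*} [AddCommGroup V] [Module ℝ V] [AddCommGroup W] [Module ℝ W]

theorem toAlt_ιMulti_self (k : ℕ) (φ : Fin k → V →ₗ[ℝ] ℂ) (v : Fin k → V) :
    toAlt k (ExteriorAlgebra.ιMulti ℂ k φ) v =
      Matrix.det (Matrix.of fun j i => φ i (v j)) := by
  rw [toAlt, ExteriorAlgebra.liftAlternating_apply_ιMulti, Pi.single_eq_same]
  rfl

theorem toAlt_ιMulti_of_ne {k l : ℕ} (h : l ≠ k) (φ : Fin l → V →ₗ[ℝ] ℂ) :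
    toAlt k (ExteriorAlgebra.ιMulti ℂ l φ) = 0 := by
  rw [toAlt, ExteriorAlgebra.liftAlternating_apply_ιMulti, Pi.single_eq_of_ne h]
  rfl

theorem ιMulti_induction {M : Type*} [AddCommGroup M] [Module ℂ M]
    {C : ExteriorAlgebra ℂ M → Prop}
    (h0 : C 0) (hadd : ∀ u v, C u → C v → C (u + v)) (hsmul : ∀ (c : ℂ) u, C u → C (c • u))
    (hι : ∀ k (v : Fin k → M), C (ExteriorAlgebra.ιMulti ℂ k v)) (u : ExteriorAlgebra ℂ M) :
    C u := by
  have h : u ∈ Submodule.span ℂ (Set.range fun x : Σ n, (Fin n → M) =>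
      ExteriorAlgebra.ιMulti ℂ x.1 x.2) := by
    rw [ExteriorAlgebra.ιMulti_span]
    trivial
  induction h using Submodule.span_induction with
  | mem x hx => obtain ⟨y, rfl⟩ := hx; exact hι _ _
  | zero => exact h0
  | add x y _ _ hx hy => exact hadd _ _ hx hy
  | smul c x _ hx => exact hsmul _ _ hx

theorem toAlt_pullback (f : V →ₗ[ℝ] W) (u : CForms W) (k : ℕ) (v : Fin k → V) :
    toAlt k (pullback f u) v = toAlt k u fun i => f (v i) := by
  induction u using ιMulti_induction with
  | h0 => simp
  | hadd u u' hu hu' => simp [hu, hu']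
  | hsmul c u hu => simp [hu]
  | hι l φ =>
    rw [pullback, ExteriorAlgebra.map_apply_ιMulti]
    by_cases h : l = k
    · subst h
      rw [toAlt_ιMulti_self, toAlt_ιMulti_self]
      rfl
    · rw [toAlt_ιMulti_of_ne h, toAlt_ιMulti_of_ne h]
      rfl

theorem toAlt_zero_ι_mul (φ : V →ₗ[ℝ] ℂ) (u : CForms V) :
    toAlt 0 (ExteriorAlgebra.ι ℂ φ * u) = 0 := by
  induction u using ιMulti_induction with
  | h0 => simp
  | hadd u u' hu hu' => rw [mul_add, map_add, hu, hu', add_zero]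
  | hsmul c u hu => rw [mul_smul_comm, map_smul, hu, smul_zero]
  | hι l ψ =>
    have h : ExteriorAlgebra.ι ℂ φ * ExteriorAlgebra.ιMulti ℂ l ψ =
        ExteriorAlgebra.ιMulti ℂ (l + 1) (Matrix.vecCons φ ψ) := by
      rw [ExteriorAlgebra.ιMulti_succ_apply]
      simp
    rw [h, toAlt_ιMulti_of_ne (Nat.succ_ne_zero l)]

/-- Laplace expansion of the determinant along the column of φ. The right side has the shape of the
exterior derivative of a function times a constant form. -/
theorem toAlt_succ_ι_mul (φ : V →ₗ[ℝ] ℂ) (u : CForms V) (k : ℕ) (v : Fin (k + 1) → V) :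
    toAlt (k + 1) (ExteriorAlgebra.ι ℂ φ * u) v =
      ∑ i : Fin (k + 1), (-1) ^ (i : ℕ) * (φ (v i) * toAlt k u (i.removeNth v)) := by
  induction u using ιMulti_induction with
  | h0 => simp
  | hadd u u' hu hu' =>
    simp only [mul_add, map_add, AlternatingMap.add_apply, hu, hu', Finset.sum_add_distrib]
  | hsmul c u hu =>
    simp only [mul_smul_comm, map_smul, AlternatingMap.smul_apply, hu, smul_eq_mul,
      Finset.mul_sum]
    refine Finset.sum_congr rfl fun i _ => ?_
    ring
  | hι l ψ =>
    have h : ExteriorAlgebra.ι ℂ φ * ExteriorAlgebra.ιMulti ℂ l ψ =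
        ExteriorAlgebra.ιMulti ℂ (l + 1) (Matrix.vecCons φ ψ) := by
      rw [ExteriorAlgebra.ιMulti_succ_apply]
      simp
    rw [h]
    by_cases hl : l = k
    · subst hl
      rw [toAlt_ιMulti_self, Matrix.det_succ_column_zero]
      refine Finset.sum_congr rfl fun i _ => ?_
      rw [toAlt_ιMulti_self, mul_assoc]
      rfl
    · rw [toAlt_ιMulti_of_ne (by omega)]
      simp [toAlt_ιMulti_of_ne hl]

end AlternatingMaps

/-! ### Smoothness of the generated algebra. -/

section Smooth

variable {n : ℕ}

theorem continuous_toAlt (k : ℕ) (u : CForms (Ambient n)) :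
    Continuous fun v : Fin k → Ambient n => toAlt k u v := by
  induction u using ιMulti_induction with
  | h0 => simpa using continuous_const
  | hadd u u' hu hu' =>
    simp only [map_add, AlternatingMap.add_apply]
    exact hu.add hu'
  | hsmul c u hu =>
    simp only [map_smul, AlternatingMap.smul_apply]
    exact hu.const_smul c
  | hι l φ =>
    by_cases h : l = k
    · subst h
      simp only [toAlt_ιMulti_self]
      refine Continuous.matrix_det (continuous_matrix fun j i => ?_)
      exact (φ i).continuous_of_finiteDimensional.comp (continuous_apply j)
    · simpa [toAlt_ιMulti_of_ne h] using continuous_const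

/-- `toAlt` as a continuous alternating map. -/
def contAlt (k : ℕ) (u : CForms (Ambient n)) : Ambient n [⋀^Fin k]→L[ℝ] ℂ :=
  { toAlt k u with cont := continuous_toAlt k u }

theorem contAlt_apply (k : ℕ) (u : CForms (Ambient n)) (v : Fin k → Ambient n) :
    contAlt k u v = toAlt k u v := rfl

/-- The form on the sphere bundle that is the restriction of a function times a constant form. -/
def restrictForm (f : Ambient n → ℂ) (u : CForms (Ambient n)) : Form n :=
  fun p => f p.1 • pullback (tangent p).subtype u

/-- The extension of `restrictForm` to the ambient space. -/
def ambientForm (f : Ambient n → ℂ) (u : CForms (Ambient n)) (k : ℕ) (x : Ambient n) :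
    Ambient n [⋀^Fin k]→L[ℝ] ℂ :=
  f x • contAlt k u

theorem ambientForm_contDiff {f : Ambient n → ℂ} (hf : ContDiff ℝ (⊤ : ℕ∞) f)
    (u : CForms (Ambient n)) (k : ℕ) : ContDiff ℝ (⊤ : ℕ∞) (ambientForm f u k) :=
  hf.smul contDiff_const

theorem ambientForm_restrictsTo (f : Ambient n → ℂ) (u : CForms (Ambient n)) :
    RestrictsTo (ambientForm f u) (restrictForm f u) := by
  intro k p v
  simp only [ambientForm, restrictForm, ContinuousAlternatingMap.smul_apply, contAlt_apply,
    map_smul, AlternatingMap.smul_apply, toAlt_pullback]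
  rfl

theorem RestrictsTo.add {η η' : ∀ k : ℕ, Ambient n → Ambient n [⋀^Fin k]→L[ℝ] ℂ}
    {ω ω' : Form n} (h : RestrictsTo η ω) (h' : RestrictsTo η' ω') :
    RestrictsTo (η + η') (ω + ω') := by
  intro k p v
  simp only [Pi.add_apply, ContinuousAlternatingMap.add_apply, h k p v, h' k p v, map_add,
    AlternatingMap.add_apply]

theorem restrictsTo_zero : RestrictsTo (n := n) 0 0 := by
  intro k p v
  simp

theorem IsSmooth.add {ω ω' : Form n} (h : IsSmooth ω) (h' : IsSmooth ω') : IsSmooth (ω + ω') := by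
  obtain ⟨η, h1, h2⟩ := h
  obtain ⟨η', h1', h2'⟩ := h'
  exact ⟨η + η', fun k => (h1 k).add (h1' k), h2.add h2'⟩

theorem isSmooth_zero : IsSmooth (0 : Form n) :=
  ⟨0, fun _ => contDiff_const, restrictsTo_zero⟩

variable (n) in
/-- The restrictions to the sphere bundle of smooth functions times constant forms. -/
def restrictForms : Set (Form n) :=
  {ω | ∃ f u, ContDiff ℝ (⊤ : ℕ∞) f ∧ ω = restrictForm f u}

variable (n) in
/-- The algebra generated by the restrictions of smooth functions and of constant forms. -/
def smoothForms : Subalgebra ℂ (Form n) :=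
  (Submodule.span ℂ (restrictForms n)).toSubalgebra
    (Submodule.subset_span ⟨fun _ => 1, 1, contDiff_const, by
      ext1 p; simp [restrictForm]⟩)
    (by
      intro ω ω' h h'
      induction h using Submodule.span_induction with
      | mem x hx =>
        induction h' using Submodule.span_induction with
        | mem y hy =>
          obtain ⟨f, u, hf, rfl⟩ := hx
          obtain ⟨f', u', hf', rfl⟩ := hy
          refine Submodule.subset_span ⟨fun x => f x * f' x, u * u', hf.mul hf', ?_⟩
          ext1 p
          simp only [restrictForm, Pi.mul_apply, smul_mul_smul_comm, map_mul]
        | zero => rw [mul_zero]; exact zero_mem _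
        | add y y' _ _ h1 h2 => rw [mul_add]; exact add_mem h1 h2
        | smul c y _ h1 => rw [mul_smul_comm]; exact Submodule.smul_mem _ _ h1
      | zero => rw [zero_mul]; exact zero_mem _
      | add y y' _ _ h1 h2 => rw [add_mul]; exact add_mem h1 h2
      | smul c y _ h1 => rw [smul_mul_assoc]; exact Submodule.smul_mem _ _ h1)

theorem restrictForm_smul (c : ℂ) (f : Ambient n → ℂ) (u : CForms (Ambient n)) :
    c • restrictForm f u = restrictForm f (c • u) := by
  ext1 p
  simp only [restrictForm, Pi.smul_apply, map_smul]
  rw [smul_comm]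

/-- Elements are sums of smooth functions times constant forms, which extend to the ambient space
termwise; scalars are absorbed into the constant form. -/
theorem isSmooth_of_mem_smoothForms {ω : Form n} (h : ω ∈ smoothForms n) : IsSmooth ω := by
  refine Submodule.closure_induction (R := ℂ) (s := restrictForms n) (p := fun ω _ => IsSmooth ω)
    isSmooth_zero (fun _ _ _ _ => IsSmooth.add) ?_ h
  rintro c _ ⟨f, u, hf, rfl⟩
  rw [restrictForm_smul]
  exact ⟨ambientForm f (c • u), ambientForm_contDiff hf _, ambientForm_restrictsTo f _⟩

theorem contDiff_linear (φ : Ambient n →ₗ[ℝ] ℂ) : ContDiff ℝ (⊤ : ℕ∞) φ :=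
  (LinearMap.toContinuousLinearMap φ).contDiff

theorem fn_mem_smoothForms (φ : Ambient n →ₗ[ℝ] ℂ) : fn φ ∈ smoothForms n :=
  Submodule.subset_span ⟨φ, 1, contDiff_linear φ, by
    ext1 p
    rw [restrictForm, map_one, ← Algebra.algebraMap_eq_smul_one]
    rfl⟩

theorem pullback_subtype_ι (p : SphereBundle n) (φ : Ambient n →ₗ[ℝ] ℂ) :
    pullback (tangent p).subtype (ExteriorAlgebra.ι ℂ φ) = oneForm φ p := by
  rw [pullback, ExteriorAlgebra.map_apply_ι]
  rfl

theorem oneForm_mem_smoothForms (φ : Ambient n →ₗ[ℝ] ℂ) : oneForm φ ∈ smoothForms n :=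
  Submodule.subset_span ⟨fun _ => 1, ExteriorAlgebra.ι ℂ φ, contDiff_const, by
    ext1 p
    rw [restrictForm, one_smul, pullback_subtype_ι]⟩

theorem chiSum_mem_smoothForms (k : ℕ) {f a b : Fin n → Form n} (hf : ∀ j, f j ∈ smoothForms n)
    (ha : ∀ j, a j ∈ smoothForms n) (hb : ∀ j, b j ∈ smoothForms n) :
    chiSum k f a b ∈ smoothForms n := by
  refine Subalgebra.smul_mem _ (sum_mem fun π _ => Subalgebra.smul_mem _ (list_prod_mem ?_) _) _
  intro η hη
  obtain ⟨i, rfl⟩ := (List.mem_ofFn' _ _).1 hη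
  simp only
  split_ifs
  exacts [hf _, ha _, hb _]

theorem generators_smooth : generators n ⊆ smoothForms n := by
  have hfn := fun φ => fn_mem_smoothForms (n := n) φ
  have hone := fun φ => oneForm_mem_smoothForms (n := n) φ
  have hα : alpha n ∈ smoothForms n := Subalgebra.smul_mem _ (sum_mem fun j _ =>
    add_mem (mul_mem (hfn _) (hone _)) (mul_mem (hfn _) (hone _))) _
  have hβ : beta n ∈ smoothForms n := Subalgebra.smul_mem _ (sum_mem fun j _ =>
    sub_mem (mul_mem (hfn _) (hone _)) (mul_mem (hfn _) (hone _))) _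
  have hγ : gamma n ∈ smoothForms n := Subalgebra.smul_mem _ (sum_mem fun j _ =>
    sub_mem (mul_mem (hfn _) (hone _)) (mul_mem (hfn _) (hone _))) _
  have hC : thetaC n ∈ smoothForms n :=
    add_mem (sub_mem (sum_mem fun j _ => mul_mem (hone _) (hone _)) (mul_mem hβ hγ))
      (Subalgebra.smul_mem _ (mul_mem hα hγ) _)
  have hCB : thetaCBar n ∈ smoothForms n :=
    sub_mem (sub_mem (sum_mem fun j _ => mul_mem (hone _) (hone _)) (mul_mem hβ hγ))
      (Subalgebra.smul_mem _ (mul_mem hα hγ) _)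
  rintro ω ((h | ⟨k, rfl⟩) | ⟨k, rfl⟩)
  · simp only [Set.mem_insert_iff, Set.mem_singleton_iff] at h
    rcases h with rfl | rfl | rfl | rfl | rfl | rfl | rfl
    · exact hα
    · exact hβ
    · exact hγ
    · exact Subalgebra.smul_mem _ (sum_mem fun j _ => mul_mem (hone _) (hone _)) _
    · exact Subalgebra.smul_mem _ (sub_mem hC hCB) _
    · exact sub_mem (Subalgebra.smul_mem _ (sum_mem fun j _ => mul_mem (hone _) (hone _)) _)
        (mul_mem hα hβ)
    · exact Subalgebra.smul_mem _ (add_mem hC hCB) _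
  · simp only [chi]
    split_ifs
    · exact chiSum_mem_smoothForms _ (fun _ => hfn _) (fun _ => hone _) fun _ => hone _
    · exact zero_mem _
  · simp only [chiBar]
    split_ifs
    · exact chiSum_mem_smoothForms _ (fun _ => hfn _) (fun _ => hone _) fun _ => hone _
    · exact zero_mem _

end Smooth

/-! ### Exterior derivatives of restricted forms. -/

section ExteriorDerivative

variable {n : ℕ}

theorem HasExtDeriv.add {ω ω' ψ ψ' : Form n} (h : HasExtDeriv ω ψ) (h' : HasExtDeriv ω' ψ') :
    HasExtDeriv (ω + ω') (ψ + ψ') := by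
  obtain ⟨η, h1, h2, h3⟩ := h
  obtain ⟨η', h1', h2', h3'⟩ := h'
  refine ⟨η + η', fun k => (h1 k).add (h1' k), h2.add h2', ?_⟩
  have : ambientD (η + η') = ambientD η + ambientD η' := by
    funext k x
    cases k with
    | zero => simp [ambientD]
    | succ k =>
      exact extDeriv_add ((h1 k).differentiable (by simp) x) ((h1' k).differentiable (by simp) x)
  rw [this]
  exact h3.add h3'

theorem hasExtDeriv_zero : HasExtDeriv (0 : Form n) 0 := by
  refine ⟨0, fun _ => contDiff_const, restrictsTo_zero, ?_⟩
  have : ambientD (n := n) 0 = 0 := by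
    funext k x
    cases k with
    | zero => rfl
    | succ k =>
      ext v
      change extDeriv (fun _ => 0) x v = 0
      rw [extDeriv_apply (differentiableAt_const _)]
      simp
  rw [this]
  exact restrictsTo_zero

theorem HasExtDeriv.sum {ι : Type*} (s : Finset ι) {ω ψ : ι → Form n}
    (h : ∀ i ∈ s, HasExtDeriv (ω i) (ψ i)) : HasExtDeriv (∑ i ∈ s, ω i) (∑ i ∈ s, ψ i) := by
  classical
  induction s using Finset.induction_on with
  | empty => exact hasExtDeriv_zero
  | insert a s ha ih =>
    rw [Finset.sum_insert ha, Finset.sum_insert ha]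
    exact (h a (Finset.mem_insert_self _ _)).add
      (ih fun i hi => h i (Finset.mem_insert_of_mem hi))

/-- The exterior derivative of a linear function times a constant form. -/
theorem hasExtDeriv_restrictForm (φ : Ambient n →ₗ[ℝ] ℂ) (u : CForms (Ambient n)) :
    HasExtDeriv (restrictForm φ u) (restrictForm (fun _ => 1) (ExteriorAlgebra.ι ℂ φ * u)) := by
  refine ⟨ambientForm φ u, ambientForm_contDiff (contDiff_linear φ) u,
    ambientForm_restrictsTo _ _, ?_⟩
  intro k p v
  rw [restrictForm, one_smul, toAlt_pullback]
  cases k with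
  | zero => rw [toAlt_zero_ι_mul]; rfl
  | succ k =>
    rw [toAlt_succ_ι_mul]
    change extDeriv (ambientForm φ u k) p.1 _ = _
    rw [extDeriv_apply ((ambientForm_contDiff (contDiff_linear φ) u k).differentiable (by simp) _)]
    refine Finset.sum_congr rfl fun i _ => ?_
    have h : HasFDerivAt (fun x : Ambient n =>
        ambientForm φ u k x (i.removeNth fun i => (v i : Ambient n)))
        (contAlt k u (i.removeNth fun i => (v i : Ambient n)) •
          LinearMap.toContinuousLinearMap φ) p.1 :=
      ((LinearMap.toContinuousLinearMap φ).hasFDerivAt (x := p.1)).mul_const _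
    rw [h.fderiv]
    simp [contAlt_apply, mul_comm]

end ExteriorDerivative

/-! ### The exterior derivative of χ_k. -/

section StructureEquation

variable {m : ℕ}

/-- The constant form `dz_{π(2)} ∧ … ∧ dz_{π(k+1)} ∧ dζ_{π(k+2)} ∧ … ∧ dζ_{π(n)}` on the ambient
space. -/
def tailForm (k : ℕ) (π : Equiv.Perm (Fin (m + 1))) : CForms (Ambient (m + 1)) :=
  (List.ofFn fun s : Fin m => ExteriorAlgebra.ι ℂ (coordOf (stepFn k s) (π s.succ))).prod

theorem ofFn_prod_eq_mul_tailForm (k : ℕ) (f : Fin (m + 1) → Form (m + 1))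
    (π : Equiv.Perm (Fin (m + 1))) (p : SphereBundle (m + 1)) :
    (List.ofFn fun i : Fin (m + 1) => if (i : ℕ) = 0 then f (π i) else
      if (i : ℕ) ≤ k then dz (π i) else dzeta (π i)).prod p =
    f (π 0) p * pullback (tangent p).subtype (tailForm k π) := by
  rw [List.ofFn_succ, List.prod_cons, Pi.mul_apply, form_list_prod_apply, tailForm, map_list_prod,
    List.map_ofFn, List.map_ofFn]
  refine congrArg₂ _ rfl (congrArg List.prod (congrArg List.ofFn (funext fun s => ?_)))
  simp only [Function.comp_apply, pullback_subtype_ι, Fin.val_succ, Nat.add_eq_zero_iff,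
    one_ne_zero, and_false, if_false, Nat.succ_le_iff, stepFn]
  split_ifs <;> rfl

/-- Each term is a coordinate function ζ times a constant form, so d only replaces ζ by dζ. -/
theorem hasExtDeriv_chiSum (k : ℕ) :
    HasExtDeriv (n := m + 1) (chiSum k zeta dz dzeta) (chiSum k dzeta dz dzeta) := by
  let c : ℂ := 1 / ((k.factorial : ℂ) * ((m + 1 - k - 1).factorial : ℂ))
  let u : Equiv.Perm (Fin (m + 1)) → CForms (Ambient (m + 1)) := fun π =>
    c • ((Equiv.Perm.sign π : ℤ) : ℂ) • tailForm k π
  have h1 : chiSum k zeta dz dzeta = ∑ π, restrictForm (zetaCoord (π 0)) (u π) := by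
    ext1 p
    simp only [chiSum, Pi.smul_apply, Finset.sum_apply, ofFn_prod_eq_mul_tailForm, Finset.smul_sum,
      restrictForm, u, map_smul]
    refine Finset.sum_congr rfl fun π _ => ?_
    rw [zeta, fn, ← Algebra.smul_def, smul_comm (zetaCoord (π 0) p.1) c,
      smul_comm (zetaCoord (π 0) p.1) ((Equiv.Perm.sign π : ℤ) : ℂ)]
  have h2 : chiSum k dzeta dz dzeta = ∑ π : Equiv.Perm (Fin (m + 1)),
      restrictForm (fun _ => 1) (ExteriorAlgebra.ι ℂ (zetaCoord (π 0)) * u π) := by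
    ext1 p
    simp only [chiSum, Pi.smul_apply, Finset.sum_apply, ofFn_prod_eq_mul_tailForm, Finset.smul_sum,
      restrictForm, u, mul_smul_comm, map_smul, one_smul, map_mul, pullback_subtype_ι]
    rfl
  rw [h1, h2]
  exact HasExtDeriv.sum _ fun π _ => hasExtDeriv_restrictForm _ _

/-- The positions of the three kinds of factors in `chiSum` when `f = b`. -/
def headStep (k : ℕ) : Fin (m + 1) → Fin 2 := Fin.cons 1 (stepFn k)

/-- Slots 0 and p have the same type, so exchanging them does not change the sequence of types. -/
theorem headStep_swap_of_eq_one {k : ℕ} {p : Fin (m + 1)} (hp : headStep k p = 1) (s : Fin m) :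
    headStep k (Equiv.swap 0 p s.succ) = stepFn k s := by
  rw [Equiv.swap_apply_def, if_neg (Fin.succ_ne_zero s)]
  split_ifs with h
  · rw [← h, headStep, Fin.cons_succ] at hp
    rw [hp]
    rfl
  · rfl

/-- Using up the dz in slot q puts the head dζ in its place; moving that to slot k - 1, the last one
of type dz, restores a step function, now with k - 1 entries dz. -/
theorem headStep_swap_succ {k : ℕ} {q : Fin m} (hq : (q : ℕ) < k) (hk : k ≤ m) (s : Fin m) :
    headStep k (Equiv.swap 0 q.succ s.succ) =
      stepFn (k - 1) (Equiv.swap q ⟨k - 1, by omega⟩ s) := by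
  rw [Equiv.swap_apply_def, if_neg (Fin.succ_ne_zero s), Equiv.swap_apply_def]
  simp only [Fin.succ_inj]
  split_ifs with h h'
  · simp [headStep, stepFn]
  · have hne : (s : ℕ) ≠ q := fun e => h (Fin.ext e)
    have hs : (s : ℕ) = k - 1 := congrArg Fin.val h'
    simp only [headStep, stepFn, Fin.cons_succ]
    rw [if_pos (by omega), if_pos (by omega)]
  · have hs : (s : ℕ) ≠ k - 1 := fun e => h' (Fin.ext e)
    simp only [headStep, stepFn, Fin.cons_succ]
    exact if_congr (by omega) rfl rfl

/-- Split by the slot that supplies the covector of index 0: k slots have type 0, and the other m +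
1 - k, the head included, have type 1. Within each class all slots contribute equally. -/
theorem sum_ιMulti_headStep {M : Type*} [AddCommGroup M] [Module ℂ M]
    (W : Fin 2 → Fin (m + 1) → M) {k : ℕ} (hk : k ≤ m) :
    ∑ σ : Equiv.Perm (Fin (m + 1)),
      ExteriorAlgebra.ιMulti ℂ (m + 1) (fun s => W (headStep k (σ s)) s) =
    (k : ℂ) • (ExteriorAlgebra.ι ℂ (W 0 0) * ∑ σ : Equiv.Perm (Fin m),
      ExteriorAlgebra.ιMulti ℂ m (fun s => W (stepFn (k - 1) (σ s)) s.succ)) +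
    ((m : ℂ) + 1 - k) • (ExteriorAlgebra.ι ℂ (W 1 0) * ∑ σ : Equiv.Perm (Fin m),
      ExteriorAlgebra.ιMulti ℂ m (fun s => W (stepFn k (σ s)) s.succ)) := by
  have h1 : ∀ p : Fin (m + 1), headStep k p = 1 → ∑ e : Equiv.Perm (Fin m),
      ExteriorAlgebra.ιMulti ℂ (m + 1)
        (fun s => W (headStep k (Equiv.Perm.decomposeFin.symm (p, e) s)) s) =
      ExteriorAlgebra.ι ℂ (W 1 0) * ∑ σ : Equiv.Perm (Fin m),
        ExteriorAlgebra.ιMulti ℂ m (fun s => W (stepFn k (σ s)) s.succ) := by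
    intro p hp
    rw [Finset.mul_sum]
    refine Finset.sum_congr rfl fun e _ => ?_
    simp only [ExteriorAlgebra.ιMulti_apply, List.ofFn_succ, List.prod_cons,
      Equiv.Perm.decomposeFin_symm_apply_zero, Equiv.Perm.decomposeFin_symm_apply_succ, hp,
      headStep_swap_of_eq_one hp]
  have h0 : ∀ q : Fin m, (q : ℕ) < k → ∑ e : Equiv.Perm (Fin m),
      ExteriorAlgebra.ιMulti ℂ (m + 1)
        (fun s => W (headStep k (Equiv.Perm.decomposeFin.symm (q.succ, e) s)) s) =
      ExteriorAlgebra.ι ℂ (W 0 0) * ∑ σ : Equiv.Perm (Fin m),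
        ExteriorAlgebra.ιMulti ℂ m (fun s => W (stepFn (k - 1) (σ s)) s.succ) := by
    intro q hq
    rw [← Equiv.sum_comp (Equiv.mulLeft (Equiv.swap q ⟨k - 1, by omega⟩)), Finset.mul_sum]
    refine Finset.sum_congr rfl fun e _ => ?_
    have hh : headStep k q.succ = 0 := by simp [headStep, stepFn, hq]
    simp only [ExteriorAlgebra.ιMulti_apply, List.ofFn_succ, List.prod_cons,
      Equiv.Perm.decomposeFin_symm_apply_zero, Equiv.Perm.decomposeFin_symm_apply_succ, hh,
      headStep_swap_succ hq hk, Equiv.coe_mulLeft, Equiv.Perm.mul_apply]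
    simp
  rw [← Equiv.sum_comp Equiv.Perm.decomposeFin.symm, Fintype.sum_prod_type, Fin.sum_univ_succ,
    h1 0 rfl]
  have h2 : ∀ q : Fin m, ∑ e : Equiv.Perm (Fin m), ExteriorAlgebra.ιMulti ℂ (m + 1)
      (fun s => W (headStep k (Equiv.Perm.decomposeFin.symm (q.succ, e) s)) s) =
      if (q : ℕ) < k then ExteriorAlgebra.ι ℂ (W 0 0) * ∑ σ : Equiv.Perm (Fin m),
        ExteriorAlgebra.ιMulti ℂ m (fun s => W (stepFn (k - 1) (σ s)) s.succ)
      else ExteriorAlgebra.ι ℂ (W 1 0) * ∑ σ : Equiv.Perm (Fin m),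
        ExteriorAlgebra.ιMulti ℂ m (fun s => W (stepFn k (σ s)) s.succ) := by
    intro q
    split_ifs with hq
    · exact h0 q hq
    · exact h1 _ (by simp [headStep, stepFn, hq])
  have hc : (Finset.univ.filter fun q : Fin m => (q : ℕ) < k).card = k := by
    rw [Fin.card_filter_val_lt, min_eq_right hk]
  have hc' : (Finset.univ.filter fun q : Fin m => ¬ (q : ℕ) < k).card = m - k := by
    have h := Finset.card_filter_add_card_filter_not (s := Finset.univ)
      (fun q : Fin m => (q : ℕ) < k)
    rw [hc, Finset.card_univ, Fintype.card_fin] at h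
    omega
  rw [Finset.sum_congr rfl fun q _ => h2 q, Finset.sum_ite, Finset.sum_const, Finset.sum_const,
    hc, hc', ← Nat.cast_smul_eq_nsmul ℂ, ← Nat.cast_smul_eq_nsmul ℂ, Nat.cast_sub hk]
  module

theorem chiSum_dzeta_basePt {k : ℕ} (hk : k ≤ m) :
    chiSum k dzeta dz dzeta (basePt m) =
      (((m + 1 : ℕ) : ℂ) - k) • (dz 0 (basePt m) * chi (m + 1) ((k : ℤ) - 1) (basePt m) +
        dzeta 0 (basePt m) * chi (m + 1) k (basePt m)) := by
  have h : chiSum k dzeta dz dzeta (basePt m) =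
      (1 / ((k.factorial : ℂ) * ((m - k).factorial : ℂ))) •
      ∑ σ : Equiv.Perm (Fin (m + 1)), ExteriorAlgebra.ιMulti ℂ (m + 1)
        (fun s => holCovec (basePt m) (headStep k (σ s)) s) := by
    rw [← sum_sign_smul_ιMulti (holCovec (basePt m)), chiSum, Pi.smul_apply, Finset.sum_apply,
      show m + 1 - k - 1 = m - k by omega]
    refine congrArg _ (Finset.sum_congr rfl fun π _ => ?_)
    rw [Pi.smul_apply, form_list_prod_apply, List.map_ofFn, ExteriorAlgebra.ιMulti_apply]
    refine congrArg _ (congrArg List.prod (congrArg List.ofFn (funext fun i => ?_)))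
    refine Fin.cases rfl (fun s => ?_) i
    simp only [Function.comp_apply, Fin.val_succ, Nat.add_eq_zero_iff, one_ne_zero, and_false,
      if_false, Nat.succ_le_iff, headStep, Fin.cons_succ, stepFn]
    split_ifs <;> rfl
  rw [h, sum_ιMulti_headStep _ hk, smul_add, smul_add, chi_basePt hk, mul_smul_comm]
  congr 1
  · cases k with
    | zero => simp [chi]
    | succ k =>
      rw [show ((k + 1 : ℕ) : ℤ) - 1 = k by push_cast; ring, chi_basePt (by omega), mul_smul_comm,
        smul_smul, smul_smul, Nat.add_sub_cancel]
      refine congrArg₂ _ ?_ rfl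
      -- With k shifted by one, the identity is (k+1) / ((k+1)! l!) = (l+1) / (k! (l+1)!), where l +
      -- 1 is the factor n - (k+1).
      obtain ⟨l, rfl⟩ : ∃ l, m = k + 1 + l := ⟨m - (k + 1), by omega⟩
      rw [show k + 1 + l - (k + 1) = l by omega, show k + 1 + l - k = l + 1 by omega,
        Nat.factorial_succ, Nat.factorial_succ]
      have hk0 : (k.factorial : ℂ) ≠ 0 := Nat.cast_ne_zero.2 (Nat.factorial_ne_zero _)
      have hl0 : (l.factorial : ℂ) ≠ 0 := Nat.cast_ne_zero.2 (Nat.factorial_ne_zero _)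
      have hk1 : (k : ℂ) + 1 ≠ 0 := Nat.cast_add_one_ne_zero k
      have hl1 : (l : ℂ) + 1 ≠ 0 := Nat.cast_add_one_ne_zero l
      push_cast
      field_simp
      ring
  · rw [smul_smul, smul_smul, mul_comm, Nat.cast_add, Nat.cast_one]
    rfl

theorem chiSum_dzeta_eq (hm : 1 ≤ m) {k : ℕ} (hk : k ≤ m) :
    chiSum k dzeta dz dzeta = (((m + 1 : ℕ) : ℂ) - k) •
      ((alpha (m + 1) + Complex.I • beta (m + 1)) * chi (m + 1) ((k : ℤ) - 1) +
        Complex.I • (gamma (m + 1) * chi (m + 1) k)) := by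
  have h1 : chiSum k dzeta dz dzeta ∈ invariantForms (m + 1) :=
    chiSum_invariant (ρ := id) (fun g hg => (Matrix.mem_specialUnitaryGroup_iff.1 hg).2) _
      dzeta_transforms dz_transforms dzeta_transforms
  have h2 : (((m + 1 : ℕ) : ℂ) - k) •
      ((alpha (m + 1) + Complex.I • beta (m + 1)) * chi (m + 1) ((k : ℤ) - 1) +
        Complex.I • (gamma (m + 1) * chi (m + 1) k)) ∈ invariantForms (m + 1) :=
    Subalgebra.smul_mem _ (add_mem
      (mul_mem (add_mem alpha_invariant (Subalgebra.smul_mem _ beta_invariant _))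
        (chi_invariant _))
      (Subalgebra.smul_mem _ (mul_mem gamma_invariant (chi_invariant _)) _)) _
  refine IsInvariant.eq_of_basePt hm h1 h2 ?_
  rw [chiSum_dzeta_basePt hk]
  simp only [Pi.smul_apply, Pi.add_apply, Pi.mul_apply]
  rw [alpha_add_I_beta_basePt, ← smul_mul_assoc, I_gamma_basePt]

theorem hasExtDeriv_chi (hm : 1 ≤ m) (k : ℤ) :
    HasExtDeriv (chi (m + 1) k) ((((m + 1 : ℕ) : ℂ) - k) •
      ((alpha (m + 1) + Complex.I • beta (m + 1)) * chi (m + 1) (k - 1) +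
        Complex.I • (gamma (m + 1) * chi (m + 1) k))) := by
  by_cases hk : 0 ≤ k ∧ k < (m + 1 : ℕ)
  · obtain ⟨l, rfl⟩ := Int.eq_ofNat_of_zero_le hk.1
    have hl : l ≤ m := by omega
    have h := hasExtDeriv_chiSum (m := m) l
    rw [chiSum_dzeta_eq hm hl] at h
    have hc : chi (m + 1) (l : ℤ) = chiSum l zeta dz dzeta := by
      rw [chi, if_pos hk, Int.toNat_natCast]
    rw [Int.cast_natCast]
    exact hc ▸ h
  · have hc : chi (m + 1) k = 0 := by rw [chi, if_neg hk]
    -- Outside the range χ_k = 0. At k = n the form χ_{k-1} need not vanish, but the factor n - k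
    -- does; for every other such k both χ_k and χ_{k-1} are zero.
    by_cases hk' : k = (m + 1 : ℕ)
    · have h0 : ((m + 1 : ℕ) : ℂ) - k = 0 := by rw [hk']; push_cast; ring
      rw [hc, h0, zero_smul]
      exact hasExtDeriv_zero
    · have hc' : chi (m + 1) (k - 1) = 0 := by rw [chi, if_neg (by omega)]
      rw [hc, hc', mul_zero, mul_zero, smul_zero, add_zero, smul_zero]
      exact hasExtDeriv_zero

end StructureEquation

end SUForms
end

theorem proposition3p2 (n : ℕ) (hn : 2 ≤ n) :
    (Algebra.adjoin ℂ (SUForms.generators n) : Set (SUForms.Form n)) =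
        {ω | SUForms.IsSmooth ω ∧ SUForms.IsInvariant ω} ∧
      ∀ k : ℤ, SUForms.HasExtDeriv (SUForms.chi n k)
        (((n : ℂ) - k) •
          ((SUForms.alpha n + Complex.I • SUForms.beta n) * SUForms.chi n (k - 1) +
            Complex.I • (SUForms.gamma n * SUForms.chi n k))) := by
  obtain ⟨m, rfl⟩ : ∃ m, n = m + 1 := ⟨n - 1, by omega⟩
  have hm : 1 ≤ m := by omega
  refine ⟨Set.ext fun ω => ⟨fun h => ⟨?_, ?_⟩, fun h => ?_⟩, SUForms.hasExtDeriv_chi hm⟩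
  · exact SUForms.isSmooth_of_mem_smoothForms (Algebra.adjoin_le SUForms.generators_smooth h)
  · exact Algebra.adjoin_le SUForms.generators_invariant h
  · exact SUForms.mem_adjoin_of_invariant hm h.2
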